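/- Let $\mathbb K$ be a commutative ring with unit. Algebras are associative unital $\mathbb K$-algebras; an $A$-bimodule has the same $\mathbb K$-action from both sides. A chain algebra is a differential graded algebra $X_*=\bigoplus_{n\ge 0}X_n$ with differential of degree $-1$ satisfying the Leibniz rule; weak equivalences are the homology isomorphisms, fibrations are the morphisms surjective in positive degrees, and $X_*$ is cofibrant if the morphism $\mathbb K\to X_*$ has the left lifting property with respect to all fibrations that are weak equivalences. For a chain algebra $X_*$ and an $H_0(X_*)$-bimodule $M$ (placed in degree $0$), $\mathsf H^n(X_*,M)$ is the $n$-th cohomology of the total complex of the bicomplex $\operatorname{Hom}_{\mathbb K}((X_*^{\otimes p})_q,M)$ with the Hochschild coboundary and the differential induced from that of $X_*^{\otimes p}$. The Shukla cohomology of an algebra $A$ with coefficients in an $A$-bimodule $M$ is $\mathrm{Shukla}^n(A,M):=\mathsf H^n(A^c_*,M)$, where $A^c_*\to A$ is a cofibrant replacement, i.e. a weak equivalence from a cofibrant chain algebra to $A$ (concentrated in degree $0$). An abelian extension of $A$ by $M$ is an exact sequence $0\to M\to E\to A\to 0$, where $E\to A$ is a homomorphism of unital algebras, $M^2=0$ in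 $E$, and the induced $A$-bimodule structure on $M$ is the given one. A crossed bimodule is a homomorphism $\partial:C_1\to C_0$ of bimodules over an algebra $C_0$ with $\partial(c)c'=c\,\partial(c')$ for $c,c'\in C_1$. A crossed extension of $A$ by $M$ is an exact sequence $0\to M\to C_1\xrightarrow{\partial}C_0\to A\to 0$, where $\partial$ is a crossed bimodule, $C_0\to A$ is a homomorphism of unital algebras and the induced $A$-bimodule structure on $M$ is the given one. Morphisms of abelian (crossed) extensions are the morphisms of unital algebras (of crossed bimodules) inducing the identity on $M$ and $A$. $\mathbf{Extalg}(A,M)$ and $\mathbf{Cros}(A,M)$ denote the sets of connected components of the categories of all abelian, respectively all crossed, extensions of $A$ by $M$; no splitting over $\mathbb K$ is required. **Theorem.** Every algebra has a cofibrant replacement, and every homomorphism of algebras $\varphi:A\to B$ is covered by a morphism between any given cofibrant replacements of $A$ and $B$. For every algebra $A$, every $A$-bimodule $M$ and every cofibrant replacement of $A$ there are bijections $$\mathrm{Shukla}^2(A,M)\cong\mathbf{Extalg}(A,M),\qquad \mathrm{Shukla}^3(A,M)\cong\mathbf{Cros}(A,M),$$ which can be chosen naturally and $\mathbb K$-linearly,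 in the following sense. Let $\varphi:A\to B$ be a homomorphism of algebras, $M$ an $A$-bimodule, $N$ a $B$-bimodule and $f:M\to N$ a homomorphism of bimodules along $\varphi$. Let $x\in\mathrm{Shukla}^n(A,M)$ and $y\in\mathrm{Shukla}^n(B,N)$ with $n=2$ or $n=3$, where $\varphi^*$ is computed by any morphism over $\varphi$ of the cofibrant replacements. Then $f_*x=\varphi^*y$ if and only if the components of extensions that correspond to $x$ and $y$ have representatives between which there is a morphism inducing $f$ and $\varphi$ on the ends. Moreover, the sum in $\mathrm{Shukla}^n(A,M)$ corresponds to the Baer sum of extensions, and multiplication by $c\in\mathbb K$ corresponds to the pushforward of extensions along $c\cdot\mathrm{id}_M$. -/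

import Mathlib

open MulOpposite

universe u

noncomputable section

/-! ### Bimodules

An `A`-bimodule over the ground ring `K` is a `K`-module `M` with a left and a right `A`-action
(the right action is a left action of `Aᵐᵒᵖ`, so `m a` is `op a • m`) which commute with each other
and which restrict to the given action of `K` on both sides. -/

/-- A homomorphism from an `A`-bimodule `M` to a `B`-bimodule `N` along an algebra homomorphism
`φ : A → B`, that is, a homomorphism of `A`-bimodules from `M` to `N` restricted along `φ`. -/
structure BimoduleHom {K A B : Type u} [CommRing K] [Ring A] [Algebra K A] [Ring B] [Algebra K B]
    (φ : A →ₐ[K] B) (M N : Type u)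
    [AddCommGroup M] [Module K M] [Module A M] [Module Aᵐᵒᵖ M]
    [AddCommGroup N] [Module K N] [Module B N] [Module Bᵐᵒᵖ N] where
  toLinearMap : M →ₗ[K] N
  map_smul_left : ∀ (a : A) (m : M), toLinearMap (a • m) = φ a • toLinearMap m
  map_smul_right : ∀ (a : A) (m : M), toLinearMap (op a • m) = op (φ a) • toLinearMap m

namespace BimoduleHom

/-- The identity of a bimodule. -/
def id (K A M : Type u) [CommRing K] [Ring A] [Algebra K A]
    [AddCommGroup M] [Module K M] [Module A M] [Module Aᵐᵒᵖ M] :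
    BimoduleHom (AlgHom.id K A) M M where
  toLinearMap := LinearMap.id
  map_smul_left _ _ := rfl
  map_smul_right _ _ := rfl

/-- Multiplication by a scalar `c` of the ground ring, as an endomorphism of a bimodule. -/
def scalar {K : Type u} (A M : Type u) [CommRing K] [Ring A] [Algebra K A]
    [AddCommGroup M] [Module K M] [Module A M] [Module Aᵐᵒᵖ M]
    [IsScalarTower K A M] [IsScalarTower K Aᵐᵒᵖ M] (c : K) :
    BimoduleHom (AlgHom.id K A) M M where
  toLinearMap := c • LinearMap.id
  map_smul_left a m := by simpa using smul_comm c a m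
  map_smul_right a m := by simpa using smul_comm c (op a) m

end BimoduleHom

/-! ### Chain algebras -/

/-- A chain algebra over `K`: a graded unital algebra `⨁_{n ≥ 0} X_n` with a differential of
degree `-1` satisfying the Leibniz rule. -/
structure ChainAlgebra (K : Type u) [CommRing K] where
  carrier : Type u
  [ring : Ring carrier]
  [algebra : Algebra K carrier]
  deg : ℕ → Submodule K carrier
  [graded : GradedAlgebra deg]
  d : carrier →ₗ[K] carrier
  d_mem : ∀ (n : ℕ) (x : carrier), x ∈ deg (n + 1) → d x ∈ deg n
  d_deg_zero : ∀ x ∈ deg 0, d x = 0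
  d_d : ∀ x, d (d x) = 0
  leibniz : ∀ (n : ℕ) (x y : carrier), x ∈ deg n → d (x * y) = d x * y + (-1) ^ n * (x * d y)

attribute [instance] ChainAlgebra.ring ChainAlgebra.algebra ChainAlgebra.graded

namespace ChainAlgebra

variable {K : Type u} [CommRing K]

/-- Morphisms of chain algebras. -/
structure Hom (X Y : ChainAlgebra K) where
  toAlgHom : X.carrier →ₐ[K] Y.carrier
  map_deg : ∀ (n : ℕ) (x : X.carrier), x ∈ X.deg n → toAlgHom x ∈ Y.deg n
  map_d : ∀ x : X.carrier, toAlgHom (X.d x) = Y.d (toAlgHom x)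

/-- A morphism is a weak equivalence if it induces a bijection on homology in every degree
(the two clauses are injectivity and surjectivity in degree `n`). -/
def Hom.IsWeakEquiv {X Y : ChainAlgebra K} (f : X.Hom Y) : Prop :=
  ∀ n : ℕ,
    (∀ x ∈ X.deg n, X.d x = 0 → (∃ y ∈ Y.deg (n + 1), Y.d y = f.toAlgHom x) →
      ∃ x' ∈ X.deg (n + 1), X.d x' = x) ∧
    (∀ y ∈ Y.deg n, Y.d y = 0 →
      ∃ x ∈ X.deg n, X.d x = 0 ∧ ∃ y' ∈ Y.deg (n + 1), Y.d y' = f.toAlgHom x - y)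

/-- A morphism is a fibration if it is surjective in positive degrees. -/
def Hom.IsFibration {X Y : ChainAlgebra K} (f : X.Hom Y) : Prop :=
  ∀ n : ℕ, 0 < n → ∀ y ∈ Y.deg n, ∃ x ∈ X.deg n, f.toAlgHom x = y

/-- `P` is cofibrant: the morphism from the initial chain algebra `K` to `P` has the left lifting
property with respect to all morphisms that are fibrations and weak equivalences. -/
def IsCofibrant (P : ChainAlgebra K) : Prop :=
  ∀ (X Y : ChainAlgebra K) (p : X.Hom Y) (h : P.Hom Y), p.IsFibration → p.IsWeakEquiv →
    ∃ l : P.Hom X, ∀ x, p.toAlgHom (l.toAlgHom x) = h.toAlgHom x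

/-- The grading of an algebra that is concentrated in degree zero. -/
def trivialGrading (K A : Type u) [CommRing K] [Ring A] [Algebra K A] : ℕ → Submodule K A :=
  fun n => if n = 0 then ⊤ else ⊥

instance (A : Type u) [Ring A] [Algebra K A] : GradedAlgebra (trivialGrading K A) where
  one_mem := by simp [trivialGrading]
  mul_mem := by
    intro i j x y hx hy
    by_cases hi : i = 0
    · by_cases hj : j = 0
      · simp [trivialGrading, hi, hj]
      · have : y = 0 := by simpa [trivialGrading, hj] using hy
        simp [this]
    · have : x = 0 := by simpa [trivialGrading, hi] using hx
      simp [this]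
  toDecomposition := DirectSum.Decomposition.ofLinearMap _
    (DirectSum.lof K ℕ (fun i => trivialGrading K A i) 0 ∘ₗ
      LinearMap.codRestrict (trivialGrading K A 0) LinearMap.id (by simp [trivialGrading]))
    (by ext x; simp [DirectSum.lof_eq_of])
    (by
      ext i x : 2
      by_cases hi : i = 0
      · subst hi
        simp [DirectSum.lof_eq_of]
        rfl
      · have hx : x = 0 := by
          have := x.2
          simp only [trivialGrading, hi, if_false, Submodule.mem_bot] at this
          exact Subtype.ext this
        simp [hx])

/-- An algebra, regarded as a chain algebra concentrated in degree zero. -/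
def ofAlgebra (K A : Type u) [CommRing K] [Ring A] [Algebra K A] : ChainAlgebra K where
  carrier := A
  deg := trivialGrading K A
  d := 0
  d_mem _ _ _ := Submodule.zero_mem _
  d_deg_zero _ _ := rfl
  d_d _ := rfl
  leibniz _ _ _ _ := by simp

/-- The automorphism `x ↦ (-1)^|x| x` of the underlying module of a chain algebra. -/
def sgn (X : ChainAlgebra K) : X.carrier →ₗ[K] X.carrier :=
  DirectSum.toModule K ℕ X.carrier (fun n => (-1 : K) ^ n • (X.deg n).subtype) ∘ₗ
    (DirectSum.decomposeLinearEquiv X.deg).toLinearMap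

theorem sgn_of_mem (X : ChainAlgebra K) {n : ℕ} {x : X.carrier} (hx : x ∈ X.deg n) :
    X.sgn x = (-1 : K) ^ n • x := by
  have h : DirectSum.decomposeLinearEquiv X.deg x = DirectSum.lof K ℕ (fun i => X.deg i) n ⟨x, hx⟩ :=
    DirectSum.decompose_of_mem _ hx
  simp [sgn, h, DirectSum.toModule_lof]

end ChainAlgebra

/-! ### Hochschild cohomology of a chain algebra

`X` is a chain algebra, `ρ : X → A` is (the underlying algebra homomorphism of) a morphism of chain
algebras to an algebra `A` in degree zero, and `M` is an `A`-bimodule, which is a bimodule over `X`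
in degree zero through `ρ`. -/

namespace Hochschild

variable {K : Type u} [CommRing K]

/-- Total cochains: a family of `K`-multilinear maps `X^p → M`, that is of linear maps
`X^{⊗p} → M`, one for each `p`. -/
abbrev Cochain (X : ChainAlgebra K) (M : Type u) [AddCommGroup M] [Module K M] : Type u :=
  (p : ℕ) → MultilinearMap K (fun _ : Fin p => X.carrier) M

/-- The total cochains of degree `n`: in tensor degree `p` they are the linear maps
`X^{⊗p} → M` that vanish outside the chain degree `n - p`; they are zero if `p > n`. -/
def cochains (X : ChainAlgebra K) (M : Type u) [AddCommGroup M] [Module K M] (n : ℕ) :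
    Submodule K (Cochain X M) where
  carrier := {c | ∀ (p : ℕ) (k : Fin p → ℕ) (x : Fin p → X.carrier),
    (∀ j, x j ∈ X.deg (k j)) → p + ∑ j, k j ≠ n → c p x = 0}
  zero_mem' _ _ _ _ _ := rfl
  add_mem' ha hb p k x hx hn := by simp [ha p k x hx hn, hb p k x hx hn]
  smul_mem' c a ha p k x hx hn := by simp [ha p k x hx hn]

/-- The maps `x ↦ (ε x_1, …, ε x_{i-1}, d x_i, x_{i+1}, …)` with `ε x = (-1)^|x| x`, whose sum over
`i` is the differential of the complex `X^{⊗p}`. -/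
def tensorD (X : ChainAlgebra K) {p : ℕ} (i j : Fin p) : X.carrier →ₗ[K] X.carrier :=
  if j < i then X.sgn else if j = i then X.d else LinearMap.id

/-- The differential of `Hom(X^{⊗p}, M)` induced by that of `X^{⊗p}`. -/
def innerD (X : ChainAlgebra K) (M : Type u) [AddCommGroup M] [Module K M] (p : ℕ) :
    MultilinearMap K (fun _ : Fin p => X.carrier) M →ₗ[K]
      MultilinearMap K (fun _ : Fin p => X.carrier) M :=
  ∑ i : Fin p, MultilinearMap.compLinearMapₗ (tensorD X i)

theorem update_succ_comp {X : Type u} {p : ℕ} (x : Fin (p + 1) → X) (j : Fin p) (a : X) :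
    (fun k : Fin p => Function.update x j.succ a k.succ) =
      Function.update (fun k => x k.succ) j a := by
  ext k; simp [Function.update_apply]

theorem update_castSucc_comp {X : Type u} {p : ℕ} (x : Fin (p + 1) → X) (j : Fin p) (a : X) :
    (fun k : Fin p => Function.update x j.castSucc a k.castSucc) =
      Function.update (fun k => x k.castSucc) j a := by
  ext k; simp [Function.update_apply]

section Outer

variable {A : Type u} [Ring A] [Algebra K A]

/-- The coface `(x_0, …, x_p) ↦ x_0 u(x_1, …, x_p)`. -/
def cofaceLeft (X : ChainAlgebra K) (ρ : X.carrier →ₐ[K] A) (M : Type u) [AddCommGroup M]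
    [Module K M] [Module A M] [IsScalarTower K A M] (p : ℕ) :
    MultilinearMap K (fun _ : Fin p => X.carrier) M →ₗ[K]
      MultilinearMap K (fun _ : Fin (p + 1) => X.carrier) M where
  toFun u := MultilinearMap.mk' (fun x => ρ (x 0) • u (fun j => x j.succ))
    (fun x j a b => by
      refine Fin.cases ?_ (fun j => ?_) j
      · simp [add_smul]
      · simp only [update_succ_comp, Function.update_of_ne (Fin.succ_ne_zero j).symm]
        simp)
    (fun x j c a => by
      refine Fin.cases ?_ (fun j => ?_) j
      · simp
      · simp only [update_succ_comp, Function.update_of_ne (Fin.succ_ne_zero j).symm]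
        simpa using (smul_comm c (ρ (x 0)) (u _)).symm)
  map_add' u v := by ext x; simp
  map_smul' c u := by ext x; simpa using (smul_comm c (ρ (x 0)) (u fun j => x j.succ)).symm

/-- The coface `(x_0, …, x_p) ↦ u(x_0, …, x_{p-1}) x_p`. -/
def cofaceRight (X : ChainAlgebra K) (ρ : X.carrier →ₐ[K] A) (M : Type u) [AddCommGroup M]
    [Module K M] [Module Aᵐᵒᵖ M] [IsScalarTower K Aᵐᵒᵖ M] (p : ℕ) :
    MultilinearMap K (fun _ : Fin p => X.carrier) M →ₗ[K]
      MultilinearMap K (fun _ : Fin (p + 1) => X.carrier) M where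
  toFun u := MultilinearMap.mk' (fun x => op (ρ (x (Fin.last p))) • u (fun j => x j.castSucc))
    (fun x j a b => by
      refine Fin.lastCases ?_ (fun j => ?_) j
      · simp [add_smul]
      · simp only [update_castSucc_comp, Function.update_of_ne (Fin.castSucc_lt_last j).ne']
        simp)
    (fun x j c a => by
      refine Fin.lastCases ?_ (fun j => ?_) j
      · simp
      · simp only [update_castSucc_comp, Function.update_of_ne (Fin.castSucc_lt_last j).ne']
        simpa using (smul_comm c (op (ρ (x (Fin.last p)))) (u _)).symm)
  map_add' u v := by ext x; simp
  map_smul' c u := by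
    ext x; simpa using (smul_comm c (op (ρ (x (Fin.last p)))) (u fun j => x j.castSucc)).symm

end Outer

theorem contractNth_update (X : ChainAlgebra K) {p : ℕ} (i : Fin p) (x : Fin (p + 1) → X.carrier)
    (j : Fin (p + 1)) : ∃ (k : Fin p) (L : X.carrier →ₗ[K] X.carrier), ∀ a,
      Fin.contractNth i.castSucc (· * ·) (Function.update x j a) =
        Function.update (Fin.contractNth i.castSucc (· * ·) x) k (L a) := by
  have hi := i.2
  have hj := j.2
  rcases lt_trichotomy (j : ℕ) i with h | h | h
  · refine ⟨⟨j, by omega⟩, LinearMap.id, fun a => ?_⟩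
    ext k
    simp only [Fin.contractNth, Function.update_apply, Fin.ext_iff, Fin.val_castSucc, Fin.val_succ,
      LinearMap.id_apply]
    grind
  · refine ⟨i, LinearMap.mulRight K (x i.succ), fun a => ?_⟩
    obtain rfl : j = i.castSucc := Fin.ext h
    ext k
    rcases eq_or_ne k i with rfl | hk
    · simp [Fin.contractNth, Fin.ext_iff]
    · simp only [Fin.contractNth, Function.update_apply, Fin.ext_iff, Fin.val_castSucc,
        Fin.val_succ, hk, if_false]
      grind
  · by_cases h' : (j : ℕ) = i + 1
    · refine ⟨i, LinearMap.mulLeft K (x i.castSucc), fun a => ?_⟩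
      obtain rfl : j = i.succ := Fin.ext h'
      ext k
      rcases eq_or_ne k i with rfl | hk
      · simp [Fin.contractNth, Fin.ext_iff]
      · simp only [Fin.contractNth, Function.update_apply, Fin.ext_iff, Fin.val_castSucc,
          Fin.val_succ, hk, if_false]
        grind
    · refine ⟨⟨j - 1, by omega⟩, LinearMap.id, fun a => ?_⟩
      ext k
      simp only [Fin.contractNth, Function.update_apply, Fin.ext_iff, Fin.val_castSucc,
        Fin.val_succ, LinearMap.id_apply]
      grind

/-- The coface `(x_0, …, x_p) ↦ u(x_0, …, x_i x_{i+1}, …, x_p)`. -/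
def cofaceMid (X : ChainAlgebra K) (M : Type u) [AddCommGroup M] [Module K M] (p : ℕ)
    (i : Fin p) :
    MultilinearMap K (fun _ : Fin p => X.carrier) M →ₗ[K]
      MultilinearMap K (fun _ : Fin (p + 1) => X.carrier) M where
  toFun u := MultilinearMap.mk' (fun x => u (Fin.contractNth i.castSucc (· * ·) x))
    (fun x j a b => by
      obtain ⟨k, L, h⟩ := contractNth_update X i x j
      simp [h])
    (fun x j c a => by
      obtain ⟨k, L, h⟩ := contractNth_update X i x j
      simp [h])
  map_add' u v := by ext x; simp
  map_smul' c u := by ext x; simp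

section Cohomology

variable {A : Type u} [Ring A] [Algebra K A] (X : ChainAlgebra K) (ρ : X.carrier →ₐ[K] A)
  (M : Type u) [AddCommGroup M] [Module K M] [Module A M] [Module Aᵐᵒᵖ M]
  [IsScalarTower K A M] [IsScalarTower K Aᵐᵒᵖ M]

/-- The Hochschild coboundary, the alternating sum of the cofaces. -/
def outerD (p : ℕ) : MultilinearMap K (fun _ : Fin p => X.carrier) M →ₗ[K]
    MultilinearMap K (fun _ : Fin (p + 1) => X.carrier) M :=
  cofaceLeft X ρ M p + ∑ i : Fin p, (-1 : K) ^ ((i : ℕ) + 1) • cofaceMid X M p i +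
    (-1 : K) ^ (p + 1) • cofaceRight X ρ M p

/-- The differential of the total complex. -/
def totalD : Cochain X M →ₗ[K] Cochain X M :=
  LinearMap.pi fun p => match p with
    | 0 => innerD X M 0 ∘ₗ LinearMap.proj 0
    | p + 1 => outerD X ρ M p ∘ₗ LinearMap.proj p +
        (-1 : K) ^ (p + 1) • (innerD X M (p + 1) ∘ₗ LinearMap.proj (p + 1))

/-- The cocycles of degree `n`. -/
def cocycles (n : ℕ) : Submodule K (Cochain X M) :=
  cochains X M n ⊓ LinearMap.ker (totalD X ρ M)

/-- The coboundaries of degree `n`. -/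
def coboundaries : ℕ → Submodule K (Cochain X M)
  | 0 => ⊥
  | n + 1 => (cochains X M n).map (totalD X ρ M)

/-- The Hochschild cohomology `H^n(X, M)` of the chain algebra `X`. -/
abbrev Cohomology (n : ℕ) : Type u :=
  cocycles X ρ M n ⧸ (coboundaries X ρ M n).submoduleOf (cocycles X ρ M n)

end Cohomology

section Functoriality

variable {A B : Type u} [Ring A] [Algebra K A] [Ring B] [Algebra K B]
  {M : Type u} [AddCommGroup M] [Module K M] [Module A M] [Module Aᵐᵒᵖ M]
  [IsScalarTower K A M] [IsScalarTower K Aᵐᵒᵖ M]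
  {N : Type u} [AddCommGroup N] [Module K N] [Module B N] [Module Bᵐᵒᵖ N]
  [IsScalarTower K B N] [IsScalarTower K Bᵐᵒᵖ N]

/-- Composition of cochains with a bimodule homomorphism. -/
def pushCochain (X : ChainAlgebra K) {φ : A →ₐ[K] B} (f : BimoduleHom φ M N) :
    Cochain X M →ₗ[K] Cochain X N where
  toFun c p := f.toLinearMap.compMultilinearMap (c p)
  map_add' a b := by ext; simp
  map_smul' a b := by ext; simp

theorem totalD_pushCochain (X : ChainAlgebra K) (ρ : X.carrier →ₐ[K] A) {φ : A →ₐ[K] B}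
    (f : BimoduleHom φ M N) (c : Cochain X M) :
    totalD X (φ.comp ρ) N (pushCochain X f c) = pushCochain X f (totalD X ρ M c) := by
  funext p
  cases p with
  | zero =>
    ext x
    simp [totalD, pushCochain, innerD]
  | succ p =>
    ext x
    simp [totalD, pushCochain, innerD, outerD, cofaceLeft, cofaceRight, cofaceMid,
      f.map_smul_left, f.map_smul_right]

/-- Composition of cochains with a morphism of chain algebras. -/
def pullCochain {X Y : ChainAlgebra K} (g : X.Hom Y) (N : Type u) [AddCommGroup N] [Module K N] :
    Cochain Y N →ₗ[K] Cochain X N where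
  toFun c p := (c p).compLinearMap fun _ => g.toAlgHom.toLinearMap
  map_add' a b := by ext; simp
  map_smul' a b := by ext; simp

theorem map_sgn {X Y : ChainAlgebra K} (g : X.Hom Y) (x : X.carrier) :
    g.toAlgHom (X.sgn x) = Y.sgn (g.toAlgHom x) := by
  induction x using DirectSum.Decomposition.inductionOn X.deg with
  | zero => simp
  | homogeneous x => simp [X.sgn_of_mem x.2, Y.sgn_of_mem (g.map_deg _ _ x.2)]
  | add x y hx hy => simp [hx, hy]

theorem totalD_pullCochain {X Y : ChainAlgebra K} (g : X.Hom Y) (ρ : Y.carrier →ₐ[K] B)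
    (c : Cochain Y N) :
    totalD X (ρ.comp g.toAlgHom) N (pullCochain g N c) = pullCochain g N (totalD Y ρ N c) := by
  have h (p : ℕ) (i j : Fin p) (x : X.carrier) :
      g.toAlgHom (tensorD X i j x) = tensorD Y i j (g.toAlgHom x) := by
    unfold tensorD
    split_ifs <;> simp [map_sgn, g.map_d]
  have hm (p : ℕ) (i : Fin (p + 1)) (x : Fin (p + 1) → X.carrier) :
      (fun k => g.toAlgHom (Fin.contractNth i (· * ·) x k)) =
        Fin.contractNth i (· * ·) fun k => g.toAlgHom (x k) :=
    Fin.comp_contractNth (f := g.toAlgHom) (· * ·) (· * ·) (map_mul g.toAlgHom) i x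
  funext p
  cases p with
  | zero =>
    ext x
    simp [totalD, pullCochain, innerD]
  | succ p =>
    ext x
    simp [totalD, pullCochain, innerD, outerD, cofaceLeft, cofaceRight, cofaceMid, h,
      hm]

/-- The homomorphism `f_* : H^n(X, M) → H^n(X, N)` induced by a homomorphism of bimodules. -/
def push (X : ChainAlgebra K) (ρ : X.carrier →ₐ[K] A) {φ : A →ₐ[K] B} (f : BimoduleHom φ M N)
    (n : ℕ) : Cohomology X ρ M n →ₗ[K] Cohomology X (φ.comp ρ) N n :=
  Submodule.mapQ _ _ ((pushCochain X f).restrict (p := cocycles X ρ M n)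
      (q := cocycles X (φ.comp ρ) N n) (by
    rintro c ⟨hc, hd⟩
    refine ⟨fun p k x hx hn => ?_, ?_⟩
    · simp [pushCochain, hc p k x hx hn]
    · refine LinearMap.mem_ker.2 ?_
      rw [totalD_pushCochain, LinearMap.mem_ker.1 hd, map_zero])) (by
    rintro ⟨c, hc⟩ h
    cases n with
    | zero =>
      obtain rfl : c = 0 := h
      exact map_zero (pushCochain X f)
    | succ n =>
      obtain ⟨e, he, rfl⟩ := h
      refine ⟨pushCochain X f e, fun p k x hx hn => ?_, totalD_pushCochain X ρ f e⟩
      simp [pushCochain, he p k x hx hn])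

/-- The homomorphism `g^* : H^n(Y, N) → H^n(X, N)` induced by a morphism `g : X → Y` of chain
algebras. -/
def pull {X Y : ChainAlgebra K} (g : X.Hom Y) (ρ : Y.carrier →ₐ[K] B) {σ : X.carrier →ₐ[K] B}
    (hg : ρ.comp g.toAlgHom = σ) (N : Type u) [AddCommGroup N] [Module K N] [Module B N]
    [Module Bᵐᵒᵖ N] [IsScalarTower K B N] [IsScalarTower K Bᵐᵒᵖ N] (n : ℕ) :
    Cohomology Y ρ N n →ₗ[K] Cohomology X σ N n :=
  Submodule.mapQ _ _ ((pullCochain g N).restrict (p := cocycles Y ρ N n)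
      (q := cocycles X σ N n) (by
    subst hg
    rintro c ⟨hc, hd⟩
    refine ⟨fun p k x hx hn => hc p k _ (fun j => g.map_deg _ _ (hx j)) hn, ?_⟩
    refine LinearMap.mem_ker.2 ?_
    rw [totalD_pullCochain, LinearMap.mem_ker.1 hd, map_zero])) (by
    subst hg
    rintro ⟨c, hc⟩ h
    cases n with
    | zero =>
      obtain rfl : c = 0 := h
      exact map_zero (pullCochain g N)
    | succ n =>
      obtain ⟨e, he, rfl⟩ := h
      exact ⟨pullCochain g N e, fun p k x hx hn => he p k _ (fun j => g.map_deg _ _ (hx j)) hn,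
        totalD_pullCochain g ρ e⟩)

end Functoriality

end Hochschild

/-! ### Shukla cohomology -/

section Shukla

variable (K : Type u) [CommRing K]

/-- A cofibrant replacement of an algebra `A`: a cofibrant chain algebra `P` with a weak equivalence
`π` from `P` to `A` (in degree zero). -/
structure CofibrantReplacement (A : Type u) [Ring A] [Algebra K A] where
  P : ChainAlgebra K
  isCofibrant : P.IsCofibrant
  π : P.Hom (ChainAlgebra.ofAlgebra K A)
  isWeakEquiv : π.IsWeakEquiv

variable {K} {A B : Type u} [Ring A] [Algebra K A] [Ring B] [Algebra K B]

/-- The weak equivalence of a cofibrant replacement as a homomorphism of algebras. -/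
def CofibrantReplacement.aug (Q : CofibrantReplacement K A) : Q.P.carrier →ₐ[K] A :=
  Q.π.toAlgHom

/-- The Shukla cohomology `Shukla^n(A, M)`: the Hochschild cohomology with coefficients in `M` of
a cofibrant replacement of `A`. -/
abbrev Shukla (Q : CofibrantReplacement K A) (M : Type u) [AddCommGroup M] [Module K M]
    [Module A M] [Module Aᵐᵒᵖ M] [IsScalarTower K A M] [IsScalarTower K Aᵐᵒᵖ M] (n : ℕ) : Type u :=
  Hochschild.Cohomology Q.P Q.aug M n

/-- The morphisms between cofibrant replacements of `A` and of `B` that cover `φ : A → B`. -/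
def CofibrantReplacement.Lift (Q : CofibrantReplacement K A) (Q' : CofibrantReplacement K B)
    (φ : A →ₐ[K] B) : Type u :=
  {g : Q.P.Hom Q'.P // Q'.aug.comp g.toAlgHom = φ.comp Q.aug}

/-- The relation `f_* x = φ^* y` in `Shukla^n(A, φ^* N)`, for `x` in `Shukla^n(A, M)` and `y` in
`Shukla^n(B, N)`, where `φ^*` is computed by a morphism `g` of cofibrant replacements over `φ`. -/
def Shukla.Corresponds {Q : CofibrantReplacement K A} {Q' : CofibrantReplacement K B}
    {φ : A →ₐ[K] B} (g : Q.Lift Q' φ) {M N : Type u}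
    [AddCommGroup M] [Module K M] [Module A M] [Module Aᵐᵒᵖ M]
    [IsScalarTower K A M] [IsScalarTower K Aᵐᵒᵖ M]
    [AddCommGroup N] [Module K N] [Module B N] [Module Bᵐᵒᵖ N]
    [IsScalarTower K B N] [IsScalarTower K Bᵐᵒᵖ N]
    (f : BimoduleHom φ M N) (n : ℕ) (x : Shukla Q M n) (y : Shukla Q' N n) : Prop :=
  Hochschild.push Q.P Q.aug f n x = Hochschild.pull g.1 Q'.aug g.2 N n y

end Shukla

/-! ### Abelian extensions -/

/-- An abelian extension `0 → M → E → A → 0` of the algebra `A` by the `A`-bimodule `M`: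
`M² = 0` in `E` and the induced bimodule structure on `M` is the given one. -/
structure AbelianExtension (K A M : Type u) [CommRing K] [Ring A] [Algebra K A]
    [AddCommGroup M] [Module K M] [Module A M] [Module Aᵐᵒᵖ M] where
  E : Type u
  [ring : Ring E]
  [algebra : Algebra K E]
  ι : M →ₗ[K] E
  π : E →ₐ[K] A
  ι_injective : Function.Injective ι
  exact : ∀ e : E, π e = 0 ↔ ∃ m, ι m = e
  π_surjective : Function.Surjective π
  mul_ι_ι : ∀ m m' : M, ι m * ι m' = 0
  smul_left : ∀ (e : E) (m : M), ι (π e • m) = e * ι m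
  smul_right : ∀ (e : E) (m : M), ι (op (π e) • m) = ι m * e

attribute [instance] AbelianExtension.ring AbelianExtension.algebra

namespace AbelianExtension

variable {K : Type u} [CommRing K] {A B : Type u} [Ring A] [Algebra K A] [Ring B] [Algebra K B]
  {M N : Type u} [AddCommGroup M] [Module K M] [Module A M] [Module Aᵐᵒᵖ M]
  [AddCommGroup N] [Module K N] [Module B N] [Module Bᵐᵒᵖ N]

/-- A morphism of extensions that induces `φ : A → B` and `f : M → N` on the ends. -/
structure HomOver {φ : A →ₐ[K] B} (f : BimoduleHom φ M N) (X : AbelianExtension K A M)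
    (Y : AbelianExtension K B N) where
  toAlgHom : X.E →ₐ[K] Y.E
  map_ι : ∀ m, toAlgHom (X.ι m) = Y.ι (f.toLinearMap m)
  map_π : ∀ e, Y.π (toAlgHom e) = φ (X.π e)

/-- The morphisms of the category of abelian extensions of `A` by `M`: they induce the identity
of `M` and of `A`. -/
abbrev Hom (X Y : AbelianExtension K A M) : Type u := HomOver (BimoduleHom.id K A M) X Y

/-- `Z` is a Baer sum of `X` and `Y`: the fibre product `X.E ×_A Y.E`, which is an extension of `A`
by `M × M`, maps to `Z.E` by a morphism that induces the addition `M × M → M` and the identity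
of `A`. -/
def IsBaerSum (X Y Z : AbelianExtension K A M) : Prop :=
  ∃ h : AlgHom.equalizer (X.π.comp (AlgHom.fst K X.E Y.E)) (Y.π.comp (AlgHom.snd K X.E Y.E)) →ₐ[K]
      Z.E,
    (∀ e, Z.π (h e) = X.π e.1.1) ∧
    ∀ e m m', e.1 = (X.ι m, Y.ι m') → h e = Z.ι (m + m')

end AbelianExtension

/-- `Extalg(A, M)`: the connected components of the category of abelian extensions of `A` by `M`
(the quotient by the equivalence relation generated by the existence of a morphism). -/
def Extalg (K A M : Type u) [CommRing K] [Ring A] [Algebra K A]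
    [AddCommGroup M] [Module K M] [Module A M] [Module Aᵐᵒᵖ M] : Type (u + 1) :=
  Quot fun X Y : AbelianExtension K A M => Nonempty (X.Hom Y)

namespace Extalg

variable {K : Type u} [CommRing K] {A B : Type u} [Ring A] [Algebra K A] [Ring B] [Algebra K B]
  {M N : Type u} [AddCommGroup M] [Module K M] [Module A M] [Module Aᵐᵒᵖ M]
  [AddCommGroup N] [Module K N] [Module B N] [Module Bᵐᵒᵖ N]

/-- The class of an extension. -/
def mk (X : AbelianExtension K A M) : Extalg K A M := Quot.mk _ X

/-- The relation `f_* x = φ^* y` in `Extalg(A, φ^* N)`, for `x` in `Extalg(A, M)` and `y` in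
`Extalg(B, N)`: the classes have representatives with a morphism of extensions over `φ` and `f`. For
`φ = id` this is the graph of the pushforward `f_*` of extensions; if `f` is bijective it is the
graph of the pullback `φ^*`. -/
def Corresponds {φ : A →ₐ[K] B} (f : BimoduleHom φ M N) (x : Extalg K A M) (y : Extalg K B N) :
    Prop :=
  ∃ X Y, mk X = x ∧ mk Y = y ∧ Nonempty (AbelianExtension.HomOver f X Y)

/-- The class `z` is the Baer sum of the classes `x` and `y`. -/
def IsBaerSum (x y z : Extalg K A M) : Prop :=
  ∃ X Y Z, mk X = x ∧ mk Y = y ∧ mk Z = z ∧ AbelianExtension.IsBaerSum X Y Z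

end Extalg

/-! ### Crossed extensions -/

/-- A crossed bimodule: an algebra `C₀`, a bimodule `C₁` over it and a homomorphism of bimodules
`∂ : C₁ → C₀` with `∂(c) c' = c ∂(c')`. -/
structure CrossedBimodule (K : Type u) [CommRing K] where
  C₀ : Type u
  C₁ : Type u
  [ring : Ring C₀]
  [algebra : Algebra K C₀]
  [addCommGroup : AddCommGroup C₁]
  [module : Module K C₁]
  [moduleLeft : Module C₀ C₁]
  [moduleRight : Module C₀ᵐᵒᵖ C₁]
  [smulCommClass : SMulCommClass C₀ C₀ᵐᵒᵖ C₁]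
  [isScalarTowerLeft : IsScalarTower K C₀ C₁]
  [isScalarTowerRight : IsScalarTower K C₀ᵐᵒᵖ C₁]
  bd : C₁ →ₗ[K] C₀
  bd_smul_left : ∀ (a : C₀) (c : C₁), bd (a • c) = a * bd c
  bd_smul_right : ∀ (a : C₀) (c : C₁), bd (op a • c) = bd c * a
  bd_smul_bd : ∀ c c' : C₁, bd c • c' = op (bd c') • c

attribute [instance] CrossedBimodule.ring CrossedBimodule.algebra CrossedBimodule.addCommGroup
  CrossedBimodule.module CrossedBimodule.moduleLeft CrossedBimodule.moduleRight
  CrossedBimodule.smulCommClass CrossedBimodule.isScalarTowerLeft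
  CrossedBimodule.isScalarTowerRight

/-- A crossed extension of the algebra `A` by the `A`-bimodule `M`: an exact sequence
`0 → M → C₁ → C₀ → A → 0` where `C₁ → C₀` is a crossed bimodule, `C₀ → A` is a homomorphism of
algebras, and the induced bimodule structure on `M` is the given one. -/
structure CrossedExtension (K A M : Type u) [CommRing K] [Ring A] [Algebra K A]
    [AddCommGroup M] [Module K M] [Module A M] [Module Aᵐᵒᵖ M] extends CrossedBimodule K where
  ι : M →ₗ[K] C₁
  π : C₀ →ₐ[K] A
  ι_injective : Function.Injective ι
  exact₁ : ∀ c : C₁, bd c = 0 ↔ ∃ m, ι m = c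
  exact₀ : ∀ a : C₀, π a = 0 ↔ ∃ c, bd c = a
  π_surjective : Function.Surjective π
  smul_left : ∀ (a : C₀) (m : M), ι (π a • m) = a • ι m
  smul_right : ∀ (a : C₀) (m : M), ι (op (π a) • m) = op a • ι m

namespace CrossedExtension

variable {K : Type u} [CommRing K] {A B : Type u} [Ring A] [Algebra K A] [Ring B] [Algebra K B]
  {M N : Type u} [AddCommGroup M] [Module K M] [Module A M] [Module Aᵐᵒᵖ M]
  [AddCommGroup N] [Module K N] [Module B N] [Module Bᵐᵒᵖ N]

/-- A morphism of crossed bimodules that induces `φ : A → B` and `f : M → N` on the ends. -/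
structure HomOver {φ : A →ₐ[K] B} (f : BimoduleHom φ M N) (X : CrossedExtension K A M)
    (Y : CrossedExtension K B N) where
  hom₀ : X.C₀ →ₐ[K] Y.C₀
  hom₁ : BimoduleHom hom₀ X.C₁ Y.C₁
  map_bd : ∀ c, Y.bd (hom₁.toLinearMap c) = hom₀ (X.bd c)
  map_ι : ∀ m, hom₁.toLinearMap (X.ι m) = Y.ι (f.toLinearMap m)
  map_π : ∀ a, Y.π (hom₀ a) = φ (X.π a)

/-- The morphisms of the category of crossed extensions of `A` by `M`: they induce the identity
of `M` and of `A`. -/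
abbrev Hom (X Y : CrossedExtension K A M) : Type u := HomOver (BimoduleHom.id K A M) X Y

/-- `Z` is a Baer sum of `X` and `Y`: the crossed bimodule `X.C₁ × Y.C₁ → X.C₀ ×_A Y.C₀`, which is a
crossed extension of `A` by `M × M`, maps to `Z` by a morphism of crossed bimodules that induces the
addition `M × M → M` and the identity of `A`. -/
def IsBaerSum (X Y Z : CrossedExtension K A M) : Prop :=
  ∃ (h₀ : AlgHom.equalizer (X.π.comp (AlgHom.fst K X.C₀ Y.C₀)) (Y.π.comp (AlgHom.snd K X.C₀ Y.C₀))
        →ₐ[K] Z.C₀) (h₁ : X.C₁ × Y.C₁ →ₗ[K] Z.C₁),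
    (∀ a c c', h₁ (a.1.1 • c, a.1.2 • c') = h₀ a • h₁ (c, c')) ∧
    (∀ a c c', h₁ (op a.1.1 • c, op a.1.2 • c') = op (h₀ a) • h₁ (c, c')) ∧
    (∀ a c c', a.1 = (X.bd c, Y.bd c') → Z.bd (h₁ (c, c')) = h₀ a) ∧
    (∀ a, Z.π (h₀ a) = X.π a.1.1) ∧
    ∀ m m', h₁ (X.ι m, Y.ι m') = Z.ι (m + m')

end CrossedExtension

/-- `Cros(A, M)`: the connected components of the category of crossed extensions of `A` by `M`
(the quotient by the equivalence relation generated by the existence of a morphism). -/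
def Cros (K A M : Type u) [CommRing K] [Ring A] [Algebra K A]
    [AddCommGroup M] [Module K M] [Module A M] [Module Aᵐᵒᵖ M] : Type (u + 1) :=
  Quot fun X Y : CrossedExtension K A M => Nonempty (X.Hom Y)

namespace Cros

variable {K : Type u} [CommRing K] {A B : Type u} [Ring A] [Algebra K A] [Ring B] [Algebra K B]
  {M N : Type u} [AddCommGroup M] [Module K M] [Module A M] [Module Aᵐᵒᵖ M]
  [AddCommGroup N] [Module K N] [Module B N] [Module Bᵐᵒᵖ N]

/-- The class of a crossed extension. -/
def mk (X : CrossedExtension K A M) : Cros K A M := Quot.mk _ X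

/-- The relation `f_* x = φ^* y` in `Cros(A, φ^* N)`, for `x` in `Cros(A, M)` and `y` in
`Cros(B, N)`: the classes have representatives with a morphism of crossed extensions over `φ` and
`f`. For `φ = id` this is the graph of the pushforward `f_*`; if `f` is bijective it is the graph of
the pullback `φ^*`. -/
def Corresponds {φ : A →ₐ[K] B} (f : BimoduleHom φ M N) (x : Cros K A M) (y : Cros K B N) : Prop :=
  ∃ X Y, mk X = x ∧ mk Y = y ∧ Nonempty (CrossedExtension.HomOver f X Y)

/-- The class `z` is the Baer sum of the classes `x` and `y`. -/
def IsBaerSum (x y z : Cros K A M) : Prop :=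
  ∃ X Y Z, mk X = x ∧ mk Y = y ∧ mk Z = z ∧ CrossedExtension.IsBaerSum X Y Z

end Cros

end

/-!
The underlying algebra of a cofibrant chain algebra `P` is projective: homomorphisms of algebras
from `P` lift through surjections (`ChainAlgebra.IsCofibrant.exists_algHom_lift`). Indeed `P` is a
retract of a chain algebra `Resolution.resolution P` whose underlying algebra is free. The same
construction, applied to an algebra `A` in degree zero, yields a cofibrant replacement of `A`.

Projectivity says that square-zero extensions of `P` split, so Hochschild 2-cocycles on `P` are
coboundaries (`ChainAlgebra.IsCofibrant.exists_derivation_lift`); a trilinear cocycle is a bilinear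
one with values in a bimodule of linear maps, so it is a coboundary, too. Hence the total complex
reduces to the complex of derivations: for a cofibrant replacement `P → A` and `n = 1, 2`, every
class in `H^{n+1}(P, M)` is the class of a derivation `D : P_n → M` with `D d = 0`, and two such
derivations define the same class if and only if they differ by `t d` for a derivation
`t : P_{n-1} → M` (`Hochschild.exists_cls_eq_two`, `Hochschild.exists_cls_eq_three`,
`Hochschild.IsDerCocycle.cls_eq`, `Hochschild.IsDerCocycle.exists_of_cls_eq_two`,
`Hochschild.IsDerCocycle.exists_of_cls_eq_three`).

An abelian extension is a chain algebra `M → E` with homology `A`, and a crossed extension is a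
chain algebra `M → C₁ → C₀` with homology `A`. By projectivity `P → A` lifts to a morphism from `P`
to this chain algebra, whose top component is a derivation `D` as above; its class is the one that
the extension represents (`AbelianExtension.Represents`, `CrossedExtension.Represents`). A morphism
of extensions over `f` and `φ` yields two lifts of the same homomorphism, which are homotopic, so
the classes correspond (`AbelianExtension.Represents.corresponds`,
`CrossedExtension.Represents.corresponds`).

Conversely, `P` is acyclic in positive degrees, so `d x ↦ D x` is a well-defined homomorphism to `M`
from the kernel of `P₀ → A` if `n = 1`, and from the kernel of `P₁ → P₀` if `n = 2`. The pushout
along it is an extension that represents the class of `D`, and it maps to every extension whose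
class corresponds to that class (`AbelianExtension.exists_universal`,
`CrossedExtension.exists_universal`). This gives injectivity, surjectivity and naturality at once.
The Baer sum is classified by the sum of the derivations, and the action of a scalar is an instance
of naturality.
-/

noncomputable section

set_option linter.unusedSectionVars false

/-! ### Chain algebras: signs, projections and lifting of cells -/

namespace ChainAlgebra

variable {K : Type u} [CommRing K]

/-- A statement about the elements of a chain algebra that is additive holds if it holds for
homogeneous elements. -/
theorem homogeneous_induction (X : ChainAlgebra K) {p : X.carrier → Prop}
    (homogeneous : ∀ n, ∀ x ∈ X.deg n, p x) (add : ∀ x y, p x → p y → p (x + y)) (x : X.carrier) :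
    p x :=
  DirectSum.Decomposition.inductionOn X.deg (homogeneous 0 0 (Submodule.zero_mem _))
    (fun y => homogeneous _ y.1 y.2) add x

theorem sgn_mul (X : ChainAlgebra K) (x y : X.carrier) : X.sgn (x * y) = X.sgn x * X.sgn y := by
  induction x using X.homogeneous_induction with
  | add x x' hx hx' => simp [add_mul, hx, hx']
  | homogeneous n x hx =>
    induction y using X.homogeneous_induction with
    | add y y' hy hy' => simp [mul_add, hy, hy']
    | homogeneous m y hy =>
      rw [X.sgn_of_mem hx, X.sgn_of_mem hy, X.sgn_of_mem (SetLike.mul_mem_graded hx hy)]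
      rw [smul_mul_smul_comm, pow_add]

theorem sgn_mem (X : ChainAlgebra K) {n : ℕ} {x : X.carrier} (hx : x ∈ X.deg n) :
    X.sgn x ∈ X.deg n := by
  rw [X.sgn_of_mem hx]; exact Submodule.smul_mem _ _ hx

theorem d_sgn (X : ChainAlgebra K) (x : X.carrier) : X.d (X.sgn x) = -X.sgn (X.d x) := by
  induction x using X.homogeneous_induction with
  | add x x' hx hx' => simp [hx, hx', add_comm]
  | homogeneous n x hx =>
    cases n with
    | zero => simp [X.sgn_of_mem hx, X.d_deg_zero x hx]
    | succ n =>
      simp [X.sgn_of_mem hx, X.sgn_of_mem (X.d_mem n x hx), pow_succ]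

theorem sgn_sgn (X : ChainAlgebra K) (x : X.carrier) : X.sgn (X.sgn x) = x := by
  induction x using X.homogeneous_induction with
  | add x x' hx hx' => simp [hx, hx']
  | homogeneous n x hx =>
    simp [X.sgn_of_mem hx, smul_smul, ← mul_pow]

/-- The Leibniz rule for elements that need not be homogeneous. -/
theorem d_mul (X : ChainAlgebra K) (x y : X.carrier) :
    X.d (x * y) = X.d x * y + X.sgn x * X.d y := by
  induction x using X.homogeneous_induction with
  | add x x' hx hx' => simp only [add_mul, map_add, hx, hx']; abel
  | homogeneous n x hx =>
    rw [X.leibniz n x y hx, X.sgn_of_mem hx]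
    rcases neg_one_pow_eq_or K n with h | h <;> rcases Nat.even_or_odd n with h' | h' <;>
      simp [h'.neg_one_pow]

theorem one_mem (X : ChainAlgebra K) : (1 : X.carrier) ∈ X.deg 0 := SetLike.one_mem_graded _

theorem mul_mem (X : ChainAlgebra K) {m n : ℕ} {x y : X.carrier} (hx : x ∈ X.deg m)
    (hy : y ∈ X.deg n) : x * y ∈ X.deg (m + n) := SetLike.mul_mem_graded hx hy

/-- The projection of a chain algebra to its part of degree `n`. -/
def proj (X : ChainAlgebra K) (n : ℕ) : X.carrier →ₗ[K] X.carrier := GradedAlgebra.proj X.deg n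

theorem proj_mem (X : ChainAlgebra K) (n : ℕ) (x : X.carrier) : X.proj n x ∈ X.deg n := by
  rw [proj, GradedAlgebra.proj_apply]; exact SetLike.coe_mem _

theorem proj_of_mem (X : ChainAlgebra K) {n : ℕ} {x : X.carrier} (hx : x ∈ X.deg n) :
    X.proj n x = x := by
  rw [proj, GradedAlgebra.proj_apply, DirectSum.decompose_of_mem_same _ hx]

theorem proj_of_mem_ne (X : ChainAlgebra K) {m n : ℕ} {x : X.carrier} (hx : x ∈ X.deg m)
    (h : m ≠ n) : X.proj n x = 0 := by
  rw [proj, GradedAlgebra.proj_apply, DirectSum.decompose_of_mem_ne _ hx h]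

/-- The projection of a chain algebra to its part of degree zero, as an endomorphism of the
underlying algebra. -/
def projZero (X : ChainAlgebra K) : X.carrier →ₐ[K] X.carrier :=
  { GradedRing.projZeroRingHom X.deg with
    commutes' := fun c => X.proj_of_mem (SetLike.algebraMap_mem_graded X.deg c) }

theorem projZero_of_mem (X : ChainAlgebra K) {x : X.carrier} (hx : x ∈ X.deg 0) :
    X.projZero x = x := X.proj_of_mem hx

theorem projZero_mem (X : ChainAlgebra K) (x : X.carrier) : X.projZero x ∈ X.deg 0 :=
  X.proj_mem 0 x

theorem projZero_of_pos (X : ChainAlgebra K) {n : ℕ} {x : X.carrier} (hx : x ∈ X.deg (n + 1)) :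
    X.projZero x = 0 := X.proj_of_mem_ne hx (Nat.succ_ne_zero n)

/-- The map `f` vanishes on the elements of positive degree. -/
def KillsPos (X : ChainAlgebra K) {G : Type*} [Zero G] (f : X.carrier → G) : Prop :=
  ∀ n, ∀ x ∈ X.deg (n + 1), f x = 0

theorem KillsPos.comp_projZero {X : ChainAlgebra K} {G F : Type*} [AddMonoid G]
    [FunLike F X.carrier G] [AddMonoidHomClass F X.carrier G] {f : F} (hf : X.KillsPos f)
    (x : X.carrier) : f (X.projZero x) = f x := by
  induction x using X.homogeneous_induction with
  | add x x' hx hx' => simp [hx, hx']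
  | homogeneous n x hx =>
    cases n with
    | zero => rw [X.projZero_of_mem hx]
    | succ n => rw [X.projZero_of_pos hx, hf n x hx, map_zero]

theorem KillsPos.comp_sgn {X : ChainAlgebra K} {G F : Type*} [AddMonoid G]
    [FunLike F X.carrier G] [AddMonoidHomClass F X.carrier G] {f : F} (hf : X.KillsPos f)
    (x : X.carrier) : f (X.sgn x) = f x := by
  induction x using X.homogeneous_induction with
  | add x x' hx hx' => simp [hx, hx']
  | homogeneous n x hx =>
    cases n with
    | zero => simp [X.sgn_of_mem hx]
    | succ n => rw [hf n x hx, hf n _ (X.sgn_mem hx)]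

/-- The identity morphism of a chain algebra. -/
def Hom.id (X : ChainAlgebra K) : X.Hom X where
  toAlgHom := AlgHom.id K X.carrier
  map_deg _ _ h := h
  map_d _ := rfl

/-- A morphism to a chain algebra in degree zero vanishes in positive degrees. -/
theorem Hom.killsPos {X : ChainAlgebra K} {A : Type u} [Ring A] [Algebra K A]
    (f : X.Hom (ofAlgebra K A)) : X.KillsPos f.toAlgHom := fun n x hx => by
  have h : f.toAlgHom x ∈ trivialGrading K A (n + 1) := f.map_deg _ x hx
  exact (Submodule.mem_bot K).1 h

/-- An acyclic fibration is surjective in every degree. -/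
theorem Hom.surjective_of_acyclicFibration {X Y : ChainAlgebra K} {p : X.Hom Y}
    (hf : p.IsFibration) (hw : p.IsWeakEquiv) {n : ℕ} {y : Y.carrier} (hy : y ∈ Y.deg n) :
    ∃ x ∈ X.deg n, p.toAlgHom x = y := by
  cases n with
  | succ n => exact hf _ n.succ_pos y hy
  | zero =>
    obtain ⟨x, hx, -, y', hy', h⟩ := (hw 0).2 y hy (Y.d_deg_zero y hy)
    obtain ⟨x', hx', rfl⟩ := hf 1 one_pos y' hy'
    refine ⟨x - X.d x', Submodule.sub_mem _ hx (X.d_mem 0 x' hx'), ?_⟩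
    rw [map_sub, p.map_d, h, sub_sub_cancel]

/-- Lifting of a cell through an acyclic fibration: a cycle `z` together with an element `y` that
bounds the image of `z` is covered by an element that bounds `z`. -/
theorem Hom.exists_lift_cell {X Y : ChainAlgebra K} {p : X.Hom Y}
    (hf : p.IsFibration) (hw : p.IsWeakEquiv) {n : ℕ} {z : X.carrier} (hz : z ∈ X.deg n)
    (hdz : X.d z = 0) {y : Y.carrier} (hy : y ∈ Y.deg (n + 1)) (hyz : Y.d y = p.toAlgHom z) :
    ∃ x ∈ X.deg (n + 1), X.d x = z ∧ p.toAlgHom x = y := by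
  obtain ⟨x₁, hx₁, rfl⟩ := (hw n).1 z hz hdz ⟨y, hy, hyz⟩
  -- The difference of `y` and the image of `x₁` is a cycle; it is corrected by a cycle of `X`
  -- up to a boundary, and the boundary lifts because `p` is surjective in positive degrees.
  obtain ⟨x₂, hx₂, hdx₂, y', hy', h⟩ := (hw (n + 1)).2 (y - p.toAlgHom x₁)
    (Submodule.sub_mem _ hy (p.map_deg _ _ hx₁)) (by rw [map_sub, hyz, p.map_d, sub_self])
  obtain ⟨x₃, hx₃, rfl⟩ := hf (n + 2) (Nat.succ_pos _) y' hy'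
  refine ⟨x₁ + x₂ - X.d x₃, Submodule.sub_mem _ (Submodule.add_mem _ hx₁ hx₂)
    (X.d_mem _ _ hx₃), ?_, ?_⟩
  · rw [map_sub, map_add, hdx₂, X.d_d, add_zero, sub_zero]
  · rw [map_sub, map_add, p.map_d, h]; abel

end ChainAlgebra

/-! ### Free algebras on weighted generators -/

namespace WeightedFree

variable {K S : Type u} [CommRing K] (w : S → ℕ)

/-- The part of weight `n` of the free algebra on generators `s` of weight `w s`: it is spanned by
the words of weight `n`. -/
def deg (n : ℕ) : Submodule K (FreeAlgebra K S) :=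
  Submodule.span K {x | ∃ l : List S, (l.map w).sum = n ∧ (l.map (FreeAlgebra.ι K)).prod = x}

theorem prod_mem_deg (l : List S) :
    (l.map (FreeAlgebra.ι K)).prod ∈ deg (K := K) w (l.map w).sum :=
  Submodule.subset_span ⟨l, rfl, rfl⟩

theorem ι_mem_deg (s : S) : FreeAlgebra.ι K s ∈ deg w (w s) := by
  simpa using prod_mem_deg (K := K) w [s]

instance : SetLike.GradedMonoid (deg (K := K) w) where
  one_mem := by simpa using prod_mem_deg (K := K) w []
  mul_mem := by
    intro i j x y hx hy
    induction hx using Submodule.span_induction with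
    | zero => simp
    | add x x' _ _ hx hx' => rw [add_mul]; exact Submodule.add_mem _ hx hx'
    | smul c x _ hx => rw [smul_mul_assoc]; exact Submodule.smul_mem _ _ hx
    | mem x hx =>
      obtain ⟨l, rfl, rfl⟩ := hx
      induction hy using Submodule.span_induction with
      | zero => simp
      | add x x' _ _ hx hx' => rw [mul_add]; exact Submodule.add_mem _ hx hx'
      | smul c x _ hx => rw [mul_smul_comm]; exact Submodule.smul_mem _ _ hx
      | mem x hx =>
        obtain ⟨l', rfl, rfl⟩ := hx
        simpa using prod_mem_deg (K := K) w (l ++ l')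

/-- The homomorphism from the free algebra to the direct sum of its parts. -/
def decomposeHom : FreeAlgebra K S →ₐ[K] DirectSum ℕ fun i => deg (K := K) w i :=
  FreeAlgebra.lift K fun s => DirectSum.of (fun i => deg (K := K) w i) (w s)
    ⟨FreeAlgebra.ι K s, ι_mem_deg w s⟩

theorem decomposeHom_prod (l : List S) :
    decomposeHom w (l.map (FreeAlgebra.ι K)).prod =
      DirectSum.of (fun i => deg (K := K) w i) (l.map w).sum ⟨_, prod_mem_deg w l⟩ := by
  induction l with
  | nil => simp only [List.map_nil, List.prod_nil, map_one]; rfl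
  | cons s l ih =>
    simp only [List.map_cons, List.prod_cons, map_mul, ih]
    rw [decomposeHom, FreeAlgebra.lift_ι_apply, DirectSum.of_mul_of]
    rfl

instance : GradedAlgebra (deg (K := K) w) :=
  GradedAlgebra.ofAlgHom (deg (K := K) w) (decomposeHom w)
    (by ext s; simp [decomposeHom])
    (by
      rintro i ⟨x, hx⟩
      induction hx using Submodule.span_induction with
      | zero =>
        rw [map_zero]
        exact (map_zero (DirectSum.of (fun i => deg (K := K) w i) i)).symm
      | add x y hx hy ihx ihy =>
        simp only [map_add, ihx, ihy]
        exact (map_add (DirectSum.of (fun i => deg (K := K) w i) i) ⟨x, hx⟩ ⟨y, hy⟩).symm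
      | smul c x hx ih =>
        simp only [map_smul, ih]
        exact ((DirectSum.lof K ℕ (fun i => deg (K := K) w i) i).map_smul c ⟨x, hx⟩).symm
      | mem x hx => obtain ⟨l, rfl, rfl⟩ := hx; exact decomposeHom_prod w l)

/-- The automorphism that multiplies a generator `s` with `(-1)^(w s)`. -/
def sgn : FreeAlgebra K S →ₐ[K] FreeAlgebra K S :=
  FreeAlgebra.lift K fun s => (-1 : K) ^ w s • FreeAlgebra.ι K s

theorem sgn_of_mem {n : ℕ} {x : FreeAlgebra K S} (hx : x ∈ deg w n) :
    sgn w x = (-1 : K) ^ n • x := by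
  induction hx using Submodule.span_induction with
  | zero => simp
  | add x y _ _ hx hy => simp [hx, hy]
  | smul c x _ hx => rw [map_smul, hx, smul_comm]
  | mem x hx =>
    obtain ⟨l, rfl, rfl⟩ := hx
    induction l with
    | nil => simp
    | cons s l ih =>
      simp only [List.map_cons, List.prod_cons, List.sum_cons, map_mul, ih]
      rw [sgn, FreeAlgebra.lift_ι_apply, smul_mul_smul_comm, pow_add]

variable (δ : S → FreeAlgebra K S)

/-- The homomorphism `x ↦ (ε x, d x; 0, x)` to the triangular matrices, where `ε` is the sign
automorphism and `d` is the skew derivation with `d s = δ s` on generators. -/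
def skewMatrix : FreeAlgebra K S →ₐ[K] Matrix (Fin 2) (Fin 2) (FreeAlgebra K S) :=
  FreeAlgebra.lift K fun s => !![(-1 : K) ^ w s • FreeAlgebra.ι K s, δ s; 0, FreeAlgebra.ι K s]

/-- The skew derivation of the free algebra with given values on generators. -/
def skew : FreeAlgebra K S →ₗ[K] FreeAlgebra K S where
  toFun x := skewMatrix w δ x 0 1
  map_add' x y := by simp
  map_smul' c x := by simp

theorem skewMatrix_apply (x : FreeAlgebra K S) :
    skewMatrix w δ x = !![sgn w x, skew w δ x; 0, x] := by
  have h : skewMatrix w δ x 0 0 = sgn w x ∧ skewMatrix w δ x 1 0 = 0 ∧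
      skewMatrix w δ x 1 1 = x := by
    induction x using FreeAlgebra.induction with
    | grade0 c => simp [Matrix.algebraMap_matrix_apply]
    | grade1 s => simp [skewMatrix, sgn]
    | mul x y hx hy => simp [Matrix.mul_apply, hx, hy]
    | add x y hx hy => simp [hx, hy]
  ext i j
  fin_cases i <;> fin_cases j <;> simp [h, skew]

@[simp] theorem skew_ι (s : S) : skew w δ (FreeAlgebra.ι K s) = δ s := by
  simp [skew, skewMatrix]

@[simp] theorem skew_algebraMap (c : K) : skew w δ (algebraMap K _ c) = 0 := by
  simp [skew, Matrix.algebraMap_matrix_apply]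

theorem skew_mul (x y : FreeAlgebra K S) :
    skew w δ (x * y) = skew w δ x * y + sgn w x * skew w δ y := by
  have h := congrFun (congrFun (map_mul (skewMatrix w δ) x y) 0) 1
  simp only [skewMatrix_apply] at h
  simpa [Matrix.mul_apply, add_comm] using h

/-- The part of weight `n - 1`, which is zero for `n = 0`. -/
def degPred : ℕ → Submodule K (FreeAlgebra K S)
  | 0 => ⊥
  | n + 1 => deg w n

theorem mul_mem_degPred_left {m n : ℕ} {x y : FreeAlgebra K S} (hx : x ∈ degPred w m)
    (hy : y ∈ deg w n) : x * y ∈ degPred w (m + n) := by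
  cases m with
  | zero => simp [(Submodule.mem_bot K).1 hx]
  | succ m => rw [Nat.succ_add]; exact SetLike.mul_mem_graded (A := deg (K := K) w) hx hy

theorem mul_mem_degPred_right {m n : ℕ} {x y : FreeAlgebra K S} (hx : x ∈ deg w m)
    (hy : y ∈ degPred w n) : x * y ∈ degPred w (m + n) := by
  cases n with
  | zero => simp [(Submodule.mem_bot K).1 hy]
  | succ n => exact SetLike.mul_mem_graded (A := deg (K := K) w) hx hy

variable {w δ} in
theorem skew_mem_degPred (hδ : ∀ s, δ s ∈ degPred w (w s)) {n : ℕ} {x : FreeAlgebra K S}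
    (hx : x ∈ deg w n) : skew w δ x ∈ degPred w n := by
  induction hx using Submodule.span_induction with
  | zero => simp
  | add x y _ _ hx hy => rw [map_add]; exact Submodule.add_mem _ hx hy
  | smul c x _ hx => rw [map_smul]; exact Submodule.smul_mem _ _ hx
  | mem x hx =>
    obtain ⟨l, rfl, rfl⟩ := hx
    induction l with
    | nil =>
      have : skew w δ (1 : FreeAlgebra K S) = 0 := by simpa using skew_algebraMap w δ (1 : K)
      simp [this]
    | cons s l ih =>
      simp only [List.map_cons, List.prod_cons, List.sum_cons, skew_mul, skew_ι]
      refine Submodule.add_mem _ (mul_mem_degPred_left w (hδ s) (prod_mem_deg w l))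
        (mul_mem_degPred_right w ?_ ih)
      rw [sgn_of_mem w (ι_mem_deg w s)]
      exact Submodule.smul_mem _ _ (ι_mem_deg w s)

variable {w δ} in
theorem skew_sgn (hδ : ∀ s, δ s ∈ degPred w (w s)) (x : FreeAlgebra K S) :
    skew w δ (sgn w x) = -sgn w (skew w δ x) := by
  induction x using DirectSum.Decomposition.inductionOn (deg (K := K) w) with
  | zero => simp
  | add x y hx hy => simp [hx, hy, add_comm]
  | @homogeneous n x =>
    have h := skew_mem_degPred hδ x.2
    rw [sgn_of_mem w x.2, map_smul]
    cases n with
    | zero => simp [(Submodule.mem_bot K).1 h]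
    | succ n => simp [sgn_of_mem w (n := n) h, pow_succ]

/-- The free algebra on weighted generators, with a differential that is given on generators. -/
def chainAlgebra (hδ : ∀ s, δ s ∈ degPred w (w s)) (hδδ : ∀ s, skew w δ (δ s) = 0) :
    ChainAlgebra K where
  carrier := FreeAlgebra K S
  deg := deg w
  d := skew w δ
  d_mem n x hx := skew_mem_degPred hδ hx
  d_deg_zero x hx := (Submodule.mem_bot K).1 (skew_mem_degPred hδ hx)
  d_d x := by
    induction x using FreeAlgebra.induction with
    | grade0 c => simp
    | grade1 s => simp [hδδ]
    | mul x y hx hy =>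
      simp only [skew_mul, map_add, hx, hy, skew_sgn hδ]
      noncomm_ring
    | add x y hx hy => simp [hx, hy]
  leibniz n x y hx := by
    rw [skew_mul, sgn_of_mem w hx]
    rcases neg_one_pow_eq_or K n with h | h <;> rcases Nat.even_or_odd n with h' | h' <;>
      simp [h'.neg_one_pow]

/-- A homomorphism from the free algebra that preserves the weights of the generators preserves
the grading. -/
theorem lift_mem_deg (X : ChainAlgebra K) {m : S → X.carrier} (hm : ∀ s, m s ∈ X.deg (w s)) {n : ℕ}
    {x : FreeAlgebra K S} (hx : x ∈ deg w n) : FreeAlgebra.lift K m x ∈ X.deg n := by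
  induction hx using Submodule.span_induction with
  | zero => simp
  | add x y _ _ hx hy => rw [map_add]; exact Submodule.add_mem _ hx hy
  | smul c x _ hx => rw [map_smul]; exact Submodule.smul_mem _ _ hx
  | mem x hx =>
    obtain ⟨l, rfl, rfl⟩ := hx
    induction l with
    | nil => simpa using X.one_mem
    | cons s l ih =>
      simp only [List.map_cons, List.prod_cons, List.sum_cons, map_mul, FreeAlgebra.lift_ι_apply]
      exact X.mul_mem (hm s) ih

theorem lift_sgn (X : ChainAlgebra K) {m : S → X.carrier} (hm : ∀ s, m s ∈ X.deg (w s))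
    (x : FreeAlgebra K S) : FreeAlgebra.lift K m (sgn w x) = X.sgn (FreeAlgebra.lift K m x) := by
  induction x using DirectSum.Decomposition.inductionOn (deg (K := K) w) with
  | zero => simp
  | add x y hx hy => simp [hx, hy]
  | @homogeneous n x =>
    rw [sgn_of_mem w x.2, X.sgn_of_mem (lift_mem_deg w X hm x.2), map_smul]

end WeightedFree

/-! ### Semi-free resolutions -/

namespace Resolution

variable {K : Type u} [CommRing K] (Y : ChainAlgebra K)

/-- Formal expressions in the generators of the semi-free resolution of `Y`. The generators are
`base y` with `y` in degree zero, and `cell n y t`, which is meant to be an element of degree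
`n + 1` over `y` with boundary the value of the expression `t`. -/
inductive Term : Type u
  | base (y : Y.deg 0) : Term
  | cell (n : ℕ) (y : Y.deg (n + 1)) (t : Term) : Term
  | scalar (c : K) : Term
  | add (s t : Term) : Term
  | mul (s t : Term) : Term

/-- The generators of the resolution. -/
abbrev Gen : Type u := Y.deg 0 ⊕ (Σ n : ℕ, Y.deg (n + 1)) × Term Y

variable {Y}

/-- The degree of a generator. -/
def wt : Gen Y → ℕ := Sum.elim (fun _ => 0) fun g => g.1.1 + 1

/-- The value of an expression in the free algebra. -/
def eval : Term Y → FreeAlgebra K (Gen Y)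
  | .base y => FreeAlgebra.ι K (.inl y)
  | .cell n y t => FreeAlgebra.ι K (.inr (⟨n, y⟩, t))
  | .scalar c => algebraMap K _ c
  | .add s t => eval s + eval t
  | .mul s t => eval s * eval t

theorem eval_base_mem (y : Y.deg 0) : eval (.base y) ∈ WeightedFree.deg (K := K) wt 0 :=
  WeightedFree.ι_mem_deg (K := K) wt (.inl y)

theorem eval_cell_mem (n : ℕ) (y : Y.deg (n + 1)) (t : Term Y) :
    eval (.cell n y t) ∈ WeightedFree.deg (K := K) wt (n + 1) :=
  WeightedFree.ι_mem_deg (K := K) wt (.inr (⟨n, y⟩, t))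

theorem eval_surjective (x : FreeAlgebra K (Gen Y)) : ∃ t, eval t = x := by
  induction x using FreeAlgebra.induction with
  | grade0 c => exact ⟨.scalar c, rfl⟩
  | grade1 g =>
    rcases g with y | ⟨⟨n, y⟩, t⟩
    · exact ⟨.base y, rfl⟩
    · exact ⟨.cell n y t, rfl⟩
  | mul x y hx hy =>
    obtain ⟨s, rfl⟩ := hx
    obtain ⟨t, rfl⟩ := hy
    exact ⟨.mul s t, rfl⟩
  | add x y hx hy =>
    obtain ⟨s, rfl⟩ := hx
    obtain ⟨t, rfl⟩ := hy
    exact ⟨.add s t, rfl⟩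

open Classical in
/-- The boundary of an expression and its image in `Y`, by recursion. The boundary of `cell n y t`
is the value of `t` and its image is `y` if `t` is a cycle of degree `n` with image the boundary
of `y`; otherwise both are zero. -/
def bdAug : Term Y → FreeAlgebra K (Gen Y) × Y.carrier
  | .base y => (0, y)
  | .cell n y t =>
    if eval t ∈ WeightedFree.deg wt n ∧ (bdAug t).1 = 0 ∧ (bdAug t).2 = Y.d y then (eval t, y)
    else 0
  | .scalar c => (0, algebraMap K _ c)
  | .add s t => bdAug s + bdAug t
  | .mul s t => ((bdAug s).1 * eval t + WeightedFree.sgn wt (eval s) * (bdAug t).1,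
      (bdAug s).2 * (bdAug t).2)

/-- The condition under which a cell is attached along the value of an expression. -/
def Good (n : ℕ) (y : Y.deg (n + 1)) (t : Term Y) : Prop :=
  eval t ∈ WeightedFree.deg wt n ∧ (bdAug t).1 = 0 ∧ (bdAug t).2 = Y.d y

/-- The boundary and the image of a generator. -/
def genBdAug : Gen Y → FreeAlgebra K (Gen Y) × Y.carrier :=
  Sum.elim (fun y => bdAug (.base y)) fun g => bdAug (.cell g.1.1 g.1.2 g.2)

theorem bdAug_cell {n : ℕ} {y : Y.deg (n + 1)} {t : Term Y} (h : Good n y t) :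
    bdAug (.cell n y t) = (eval t, (y : Y.carrier)) := if_pos h

theorem bdAug_cell_of_not {n : ℕ} {y : Y.deg (n + 1)} {t : Term Y} (h : ¬ Good n y t) :
    bdAug (.cell n y t) = 0 := if_neg h

theorem genBd_mem (g : Gen Y) : (genBdAug g).1 ∈ WeightedFree.degPred wt (wt g) := by
  rcases g with y | ⟨⟨n, y⟩, t⟩
  · exact Submodule.zero_mem _
  · by_cases h : Good n y t
    · simp only [genBdAug, Sum.elim_inr, bdAug_cell h]
      exact h.1
    · simp [genBdAug, bdAug_cell_of_not h]

theorem genAug_mem (g : Gen Y) : (genBdAug g).2 ∈ Y.deg (wt g) := by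
  rcases g with y | ⟨⟨n, y⟩, t⟩
  · exact y.2
  · by_cases h : Good n y t
    · simp only [genBdAug, Sum.elim_inr, bdAug_cell h]
      exact y.2
    · simp [genBdAug, bdAug_cell_of_not h]

/-- The augmentation of the resolution on the underlying algebras. -/
def aug : FreeAlgebra K (Gen Y) →ₐ[K] Y.carrier := FreeAlgebra.lift K fun g => (genBdAug g).2

/-- The differential of the resolution. -/
def bd : FreeAlgebra K (Gen Y) →ₗ[K] FreeAlgebra K (Gen Y) :=
  WeightedFree.skew wt fun g => (genBdAug g).1

theorem bd_ι (g : Gen Y) : bd (FreeAlgebra.ι K g) = (genBdAug g).1 := WeightedFree.skew_ι _ _ g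

theorem bd_mul (x y : FreeAlgebra K (Gen Y)) :
    bd (x * y) = bd x * y + WeightedFree.sgn wt x * bd y := WeightedFree.skew_mul _ _ x y

theorem bd_algebraMap (c : K) : bd (algebraMap K (FreeAlgebra K (Gen Y)) c) = 0 :=
  WeightedFree.skew_algebraMap _ _ c

theorem aug_ι (g : Gen Y) : aug (FreeAlgebra.ι K g) = (genBdAug g).2 := FreeAlgebra.lift_ι_apply _ g

/-- The boundary that is computed by recursion on expressions is the differential of their value. -/
theorem bdAug_eq (t : Term Y) : bdAug t = (bd (eval t), aug (eval t)) := by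
  induction t with
  | base y => simp [eval, aug_ι, bd_ι, genBdAug]
  | cell n y t ih => simp [eval, aug_ι, bd_ι, genBdAug]
  | scalar c => simp [eval, bdAug, bd_algebraMap]
  | add s t hs ht => simp [eval, bdAug, hs, ht]
  | mul s t hs ht => simp [eval, bdAug, hs, ht, bd_mul]

theorem Good.bd_eval {n : ℕ} {y : Y.deg (n + 1)} {t : Term Y} (h : Good n y t) :
    bd (eval t) = 0 := by
  have := h.2.1
  rwa [bdAug_eq] at this

theorem Good.aug_eval {n : ℕ} {y : Y.deg (n + 1)} {t : Term Y} (h : Good n y t) :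
    aug (eval t) = Y.d y := by
  have := h.2.2
  rwa [bdAug_eq] at this

theorem bd_cell {n : ℕ} {y : Y.deg (n + 1)} {t : Term Y} (h : Good n y t) :
    bd (eval (.cell n y t)) = eval t := by
  rw [eval, bd_ι]; simp [genBdAug, bdAug_cell h]

theorem bd_cell_of_not {n : ℕ} {y : Y.deg (n + 1)} {t : Term Y} (h : ¬ Good n y t) :
    bd (eval (.cell n y t)) = 0 := by
  rw [eval, bd_ι]; simp [genBdAug, bdAug_cell_of_not h]

theorem bd_genBd (g : Gen Y) : bd (genBdAug g).1 = 0 := by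
  rcases g with y | ⟨⟨n, y⟩, t⟩
  · simp [genBdAug, bdAug]
  · by_cases h : Good n y t
    · simpa [genBdAug, bdAug_cell h] using h.bd_eval
    · simp [genBdAug, bdAug_cell_of_not h]

theorem aug_mem {n : ℕ} {x : FreeAlgebra K (Gen Y)} (hx : x ∈ WeightedFree.deg wt n) :
    aug x ∈ Y.deg n := WeightedFree.lift_mem_deg wt Y genAug_mem hx

theorem aug_bd (x : FreeAlgebra K (Gen Y)) : aug (bd x) = Y.d (aug x) := by
  have hs (x : FreeAlgebra K (Gen Y)) : aug (WeightedFree.sgn wt x) = Y.sgn (aug x) :=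
    WeightedFree.lift_sgn wt Y genAug_mem x
  induction x using FreeAlgebra.induction with
  | grade0 c =>
    simp [bd_algebraMap, Y.d_deg_zero _ (SetLike.algebraMap_mem_graded Y.deg c)]
  | grade1 g =>
    rw [bd_ι, aug_ι]
    rcases g with y | ⟨⟨n, y⟩, t⟩
    · simp [genBdAug, bdAug, Y.d_deg_zero _ y.2]
    · by_cases h : Good n y t
      · simpa [genBdAug, bdAug_cell h] using h.aug_eval
      · simp [genBdAug, bdAug_cell_of_not h]
  | mul x y hx hy => simp [bd_mul, Y.d_mul, hx, hy, hs]
  | add x y hx hy => simp [hx, hy]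

variable (Y)

/-- The semi-free resolution of `Y`: a cell is attached to every cycle of the free algebra along
with every element of `Y` that bounds its image. -/
def resolution : ChainAlgebra K :=
  WeightedFree.chainAlgebra (wt (Y := Y)) (fun g => (genBdAug g).1) genBd_mem bd_genBd

/-- The augmentation of the semi-free resolution. -/
def resolutionHom : (resolution Y).Hom Y where
  toAlgHom := aug
  map_deg _ _ hx := aug_mem hx
  map_d := aug_bd

variable {Y}

/-- Every cycle of the resolution whose image is a boundary is killed by a cell. -/
theorem exists_cell {n : ℕ} {z : FreeAlgebra K (Gen Y)} (hz : z ∈ WeightedFree.deg wt n)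
    (hdz : bd z = 0) {y : Y.carrier} (hy : y ∈ Y.deg (n + 1)) (hyz : Y.d y = aug z) :
    ∃ x ∈ WeightedFree.deg wt (n + 1), bd x = z ∧ aug x = y := by
  obtain ⟨t, rfl⟩ := eval_surjective z
  have h : Good n ⟨y, hy⟩ t := by
    refine ⟨hz, ?_, ?_⟩ <;> rw [bdAug_eq]
    exacts [hdz, hyz.symm]
  refine ⟨_, WeightedFree.ι_mem_deg wt (.inr (⟨n, ⟨y, hy⟩⟩, t)), bd_cell h, ?_⟩
  simp [aug_ι, genBdAug, bdAug_cell h]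

/-- Every cycle of `Y` is the image of a cycle of the resolution. -/
theorem exists_cycle {n : ℕ} {y : Y.carrier} (hy : y ∈ Y.deg n) (hdy : Y.d y = 0) :
    ∃ x ∈ WeightedFree.deg wt n, bd x = 0 ∧ aug (Y := Y) x = y := by
  cases n with
  | zero =>
    refine ⟨_, WeightedFree.ι_mem_deg wt (.inl ⟨y, hy⟩), ?_, ?_⟩
    · simp [bd_ι, genBdAug, bdAug]
    · simp [aug_ι, genBdAug, bdAug]
  | succ n =>
    exact exists_cell (z := 0) (Submodule.zero_mem _) (map_zero _) hy (by rw [hdy, map_zero])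

variable (Y)

theorem resolutionHom_isWeakEquiv : (resolutionHom Y).IsWeakEquiv := by
  refine fun n => ⟨fun x hx hdx ⟨y, hy, h⟩ => ?_, fun y hy hdy => ?_⟩
  · obtain ⟨x', hx', h', -⟩ := exists_cell hx hdx hy h
    exact ⟨x', hx', h'⟩
  · obtain ⟨x, hx, hdx, h⟩ := exists_cycle hy hdy
    exact ⟨x, hx, hdx, 0, Submodule.zero_mem _,
      (map_zero Y.d).trans (sub_eq_zero.2 h).symm⟩

theorem resolutionHom_isFibration : (resolutionHom Y).IsFibration := by
  intro n hn y hy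
  obtain ⟨n, rfl⟩ := Nat.exists_eq_succ_of_ne_zero hn.ne'
  have hdy := Y.d_mem n y hy
  obtain ⟨z, hz, hdz, h⟩ := exists_cycle hdy (Y.d_d y)
  obtain ⟨x, hx, -, h⟩ := exists_cell hz hdz hy h.symm
  exact ⟨x, hx, h⟩

section Lifting

variable {Y} {X Z : ChainAlgebra K} (p : X.Hom Z) (h : FreeAlgebra K (Gen Y) →ₐ[K] Z.carrier)

open Classical in
/-- The value of a lift of `h` through `p` on an expression, by recursion; on a cell it is an
element over the image of the cell whose boundary is the lift of the boundary. -/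
def liftTerm : Term Y → X.carrier
  | .base y => if H : ∃ x ∈ X.deg 0, p.toAlgHom x = h (eval (.base y)) then H.choose else 0
  | .cell n y t =>
    if H : ∃ x ∈ X.deg (n + 1), (Good n y t → X.d x = liftTerm t) ∧ (¬ Good n y t → X.d x = 0) ∧
      p.toAlgHom x = h (eval (.cell n y t)) then H.choose else 0
  | .scalar c => algebraMap K _ c
  | .add s t => liftTerm s + liftTerm t
  | .mul s t => liftTerm s * liftTerm t

/-- The lift on generators. -/
def liftGen : Gen Y → X.carrier :=
  Sum.elim (fun y => liftTerm p h (.base y)) fun g => liftTerm p h (.cell g.1.1 g.1.2 g.2)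

/-- The lift of `h` through `p`. -/
def lift : FreeAlgebra K (Gen Y) →ₐ[K] X.carrier := FreeAlgebra.lift K (liftGen p h)

theorem lift_ι (g : Gen Y) : lift p h (FreeAlgebra.ι K g) = liftGen p h g :=
  FreeAlgebra.lift_ι_apply _ g

theorem liftTerm_eq (t : Term Y) : liftTerm p h t = lift p h (eval t) := by
  induction t with
  | base y => simp [eval, lift_ι, liftGen]
  | cell n y t ih => simp [eval, lift_ι, liftGen]
  | scalar c => simp [eval, liftTerm]
  | add s t hs ht => simp [eval, liftTerm, hs, ht]
  | mul s t hs ht => simp [eval, liftTerm, hs, ht]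

theorem liftGen_mem (g : Gen Y) : liftGen p h g ∈ X.deg (wt g) := by
  rcases g with y | ⟨⟨n, y⟩, t⟩
  · simp only [liftGen, Sum.elim_inl, liftTerm]
    split_ifs with H
    exacts [H.choose_spec.1, Submodule.zero_mem _]
  · simp only [liftGen, Sum.elim_inr, liftTerm]
    split_ifs with H
    exacts [H.choose_spec.1, Submodule.zero_mem _]

theorem lift_mem {n : ℕ} {x : FreeAlgebra K (Gen Y)} (hx : x ∈ WeightedFree.deg wt n) :
    lift p h x ∈ X.deg n := WeightedFree.lift_mem_deg wt X (liftGen_mem p h) hx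

theorem lift_sgn (x : FreeAlgebra K (Gen Y)) :
    lift p h (WeightedFree.sgn wt x) = X.sgn (lift p h x) :=
  WeightedFree.lift_sgn wt X (liftGen_mem p h) x

variable {p h}

/-- The lift is compatible with the differentials and with `p`. Since every element of the
resolution is the value of an expression, this is an induction on expressions. -/
theorem lift_spec (hf : p.IsFibration) (hw : p.IsWeakEquiv)
    (hdeg : ∀ n, ∀ x ∈ WeightedFree.deg wt n, h x ∈ Z.deg n) (hd : ∀ x, h (bd x) = Z.d (h x))
    (t : Term Y) :
    X.d (lift p h (eval t)) = lift p h (bd (eval t)) ∧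
      p.toAlgHom (lift p h (eval t)) = h (eval t) := by
  induction t with
  | base y =>
    have H : ∃ x ∈ X.deg 0, p.toAlgHom x = h (eval (.base y)) :=
      p.surjective_of_acyclicFibration hf hw (hdeg _ _ (eval_base_mem y))
    rw [← liftTerm_eq, liftTerm, dif_pos H]
    refine ⟨?_, H.choose_spec.2⟩
    rw [X.d_deg_zero _ H.choose_spec.1, eval, bd_ι]
    simp [genBdAug, bdAug]
  | cell n y t ih =>
    have hmem : h (eval (.cell n y t)) ∈ Z.deg (n + 1) :=
      hdeg _ _ (eval_cell_mem n y t)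
    rw [← liftTerm_eq] at ih
    by_cases hg : Good n y t
    · have H : ∃ x ∈ X.deg (n + 1), (Good n y t → X.d x = liftTerm p h t) ∧
          (¬ Good n y t → X.d x = 0) ∧ p.toAlgHom x = h (eval (.cell n y t)) := by
        have hz : liftTerm p h t ∈ X.deg n := by
          rw [liftTerm_eq]; exact lift_mem p h hg.1
        obtain ⟨x, hx, hdx, hpx⟩ := p.exists_lift_cell hf hw hz
          (by rw [ih.1, hg.bd_eval, map_zero]) hmem (by rw [ih.2, ← hd, bd_cell hg])
        exact ⟨x, hx, fun _ => hdx, fun h => absurd hg h, hpx⟩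
      rw [← liftTerm_eq, liftTerm, dif_pos H]
      refine ⟨?_, H.choose_spec.2.2.2⟩
      rw [H.choose_spec.2.1 hg, bd_cell hg, liftTerm_eq]
    · have H : ∃ x ∈ X.deg (n + 1), (Good n y t → X.d x = liftTerm p h t) ∧
          (¬ Good n y t → X.d x = 0) ∧ p.toAlgHom x = h (eval (.cell n y t)) := by
        obtain ⟨x, hx, hdx, hpx⟩ := p.exists_lift_cell hf hw (Submodule.zero_mem _) (map_zero _)
          hmem (by rw [← hd, bd_cell_of_not hg, map_zero, map_zero])
        exact ⟨x, hx, fun h => absurd h hg, fun _ => hdx, hpx⟩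
      rw [← liftTerm_eq, liftTerm, dif_pos H]
      refine ⟨?_, H.choose_spec.2.2.2⟩
      rw [H.choose_spec.2.2.1 hg, bd_cell_of_not hg, map_zero]
  | scalar c =>
    refine ⟨?_, by simp [eval]⟩
    rw [eval, bd_algebraMap, map_zero, AlgHom.commutes]
    exact X.d_deg_zero _ (SetLike.algebraMap_mem_graded X.deg c)
  | add s t hs ht => simp only [eval, map_add, hs.1, hs.2, ht.1, ht.2, and_self]
  | mul s t hs ht =>
    simp only [eval, map_mul, bd_mul, X.d_mul, map_add, hs.1, hs.2, ht.1, ht.2, lift_sgn, and_self]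

end Lifting

theorem resolution_isCofibrant : (resolution Y).IsCofibrant := by
  intro X Z p h hf hw
  have hl := lift_spec (h := h.toAlgHom) hf hw h.map_deg h.map_d
  refine ⟨⟨lift p h.toAlgHom, fun n x hx => lift_mem p _ hx, fun x => ?_⟩, fun x => ?_⟩
  · obtain ⟨t, rfl⟩ := eval_surjective x
    exact (hl t).1.symm
  · obtain ⟨t, rfl⟩ := eval_surjective x
    exact (hl t).2

end Resolution

theorem CofibrantReplacement.nonempty (K A : Type u) [CommRing K] [Ring A] [Algebra K A] :
    Nonempty (CofibrantReplacement K A) :=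
  ⟨⟨_, Resolution.resolution_isCofibrant (ChainAlgebra.ofAlgebra K A), _,
    Resolution.resolutionHom_isWeakEquiv _⟩⟩

namespace CofibrantReplacement

variable {K : Type u} [CommRing K] {A B : Type u} [Ring A] [Algebra K A] [Ring B] [Algebra K B]

theorem nonempty_lift (φ : A →ₐ[K] B) (Q : CofibrantReplacement K A)
    (Q' : CofibrantReplacement K B) : Nonempty (Q.Lift Q' φ) := by
  have hfib : Q'.π.IsFibration := fun n hn y hy => by
    have hy' : y ∈ ChainAlgebra.trivialGrading K B n := hy
    rw [ChainAlgebra.trivialGrading, if_neg hn.ne'] at hy'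
    exact ⟨0, Submodule.zero_mem _,
      (map_zero Q'.π.toAlgHom).trans ((Submodule.mem_bot K (M := B)).1 hy').symm⟩
  have hdeg (n : ℕ) (x : Q.P.carrier) (hx : x ∈ Q.P.deg n) :
      φ (Q.aug x) ∈ ChainAlgebra.trivialGrading K B n := by
    cases n with
    | zero => exact Submodule.mem_top
    | succ n =>
      have : Q.aug x = 0 := Q.π.killsPos n x hx
      rw [this, map_zero]
      exact Submodule.zero_mem _
  have hd (x : Q.P.carrier) : φ (Q.aug (Q.P.d x)) = 0 := by
    have : Q.aug (Q.P.d x) = 0 := Q.π.map_d x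
    rw [this, map_zero]
  obtain ⟨g, hg⟩ := Q.isCofibrant Q'.P (ChainAlgebra.ofAlgebra K B) Q'.π
    ⟨φ.comp Q.aug, hdeg, hd⟩ hfib Q'.isWeakEquiv
  exact ⟨g, AlgHom.ext hg⟩

end CofibrantReplacement

/-! ### Lifting of homomorphisms and of derivations on cofibrant chain algebras -/

section LiftingThrough

variable {K : Type u} [CommRing K]

/-- The underlying algebra of a cofibrant chain algebra is projective: homomorphisms from it lift
through surjections. It is a retract of the free algebra that underlies its resolution. -/
theorem ChainAlgebra.IsCofibrant.exists_algHom_lift {P : ChainAlgebra K} (hP : P.IsCofibrant)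
    {E G : Type u} [Ring E] [Algebra K E] [Ring G] [Algebra K G] (q : E →ₐ[K] G)
    (h : P.carrier →ₐ[K] G) (hq : ∀ x, ∃ y, q y = h x) :
    ∃ l : P.carrier →ₐ[K] E, ∀ x, q (l x) = h x := by
  obtain ⟨s, hs⟩ := hP _ _ (Resolution.resolutionHom P) (ChainAlgebra.Hom.id P)
    (Resolution.resolutionHom_isFibration P) (Resolution.resolutionHom_isWeakEquiv P)
  choose m hm using fun g : Resolution.Gen P => hq (Resolution.aug (FreeAlgebra.ι K g))
  have hml : q.comp (FreeAlgebra.lift K m) = h.comp Resolution.aug := by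
    ext g
    simpa using hm g
  let s' : P.carrier →ₐ[K] FreeAlgebra K (Resolution.Gen P) := s.toAlgHom
  refine ⟨(FreeAlgebra.lift K m).comp s', fun x => ?_⟩
  have h₁ : Resolution.aug (s' x) = x := hs x
  have h₂ := DFunLike.congr_fun hml (s' x)
  simpa [h₁] using h₂

/-- The lift can be chosen to vanish in positive degrees if the given homomorphism does. -/
theorem ChainAlgebra.IsCofibrant.exists_algHom_lift_killsPos {P : ChainAlgebra K}
    (hP : P.IsCofibrant) {E G : Type u} [Ring E] [Algebra K E] [Ring G] [Algebra K G]
    (q : E →ₐ[K] G) (h : P.carrier →ₐ[K] G) (hh : P.KillsPos h) (hq : ∀ x, ∃ y, q y = h x) :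
    ∃ l : P.carrier →ₐ[K] E, P.KillsPos l ∧ ∀ x, q (l x) = h x := by
  obtain ⟨l, hl⟩ := hP.exists_algHom_lift q h hq
  refine ⟨l.comp P.projZero, fun n x hx => ?_, fun x => ?_⟩
  · simp [P.projZero_of_pos hx]
  · rw [AlgHom.comp_apply, hl, hh.comp_projZero]

section Actions

variable {R C : Type u} [Ring R] [Algebra K R] [Ring C] [Algebra K C]

/-- The left action of `R` on a `C`-module through a homomorphism `R → C`. -/
def leftAct (α : R →ₐ[K] C) (J : Type u) [AddCommGroup J] [Module K J] [Module C J]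
    [IsScalarTower K C J] : R →ₗ[K] J →ₗ[K] J :=
  (Algebra.lsmul K K J).toLinearMap ∘ₗ α.toLinearMap

/-- The right action of `R` on a right `C`-module through a homomorphism `R → C`. -/
def rightAct (β : R →ₐ[K] C) (J : Type u) [AddCommGroup J] [Module K J] [Module Cᵐᵒᵖ J]
    [IsScalarTower K Cᵐᵒᵖ J] : R →ₗ[K] J →ₗ[K] J :=
  (Algebra.lsmul K K J (A := Cᵐᵒᵖ)).toLinearMap ∘ₗ (opLinearEquiv K).toLinearMap ∘ₗ β.toLinearMap

variable {J : Type u} [AddCommGroup J] [Module K J]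

@[simp] theorem leftAct_apply [Module C J] [IsScalarTower K C J] (α : R →ₐ[K] C) (x : R) (j : J) :
    leftAct α J x j = α x • j := rfl

@[simp] theorem rightAct_apply [Module Cᵐᵒᵖ J] [IsScalarTower K Cᵐᵒᵖ J] (β : R →ₐ[K] C) (x : R)
    (j : J) :
    rightAct β J x j = op (β x) • j := rfl

end Actions

/-- An `R`-bimodule structure on a `K`-module `J`, given by its actions `l` and `r`. -/
structure BimoduleAction (R J : Type u) [Ring R] [Algebra K R] [AddCommGroup J] [Module K J] where
  l : R →ₗ[K] J →ₗ[K] J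
  r : R →ₗ[K] J →ₗ[K] J
  l_one : ∀ j, l 1 j = j
  r_one : ∀ j, r 1 j = j
  l_mul : ∀ x y j, l (x * y) j = l x (l y j)
  r_mul : ∀ x y j, r (x * y) j = r y (r x j)
  l_r : ∀ x y j, l x (r y j) = r y (l x j)

/-- A bimodule together with a Hochschild 2-cocycle `c` with values in it. -/
structure TwoCocycle (R J : Type u) [Ring R] [Algebra K R] [AddCommGroup J] [Module K J] extends
    BimoduleAction (K := K) R J where
  c : R →ₗ[K] R →ₗ[K] J
  cocycle : ∀ x y z, l x (c y z) + c x (y * z) = c (x * y) z + r z (c x y)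

namespace TwoCocycle

variable {R J : Type u} [Ring R] [Algebra K R] [AddCommGroup J] [Module K J]

theorem c_one_right (T : TwoCocycle (K := K) R J) (x : R) : T.c x 1 = T.l x (T.c 1 1) := by
  simpa [T.r_one, add_comm] using (T.cocycle x 1 1).symm

theorem c_one_left (T : TwoCocycle (K := K) R J) (x : R) : T.c 1 x = T.r x (T.c 1 1) := by
  simpa [T.l_one] using T.cocycle 1 1 x

/-- The zero cocycle with values in a bimodule over `C`, which is a bimodule over `R` through two
homomorphisms `R → C`. -/
def ofAlgHom {C : Type u} [Ring C] [Algebra K C] [Module C J] [Module Cᵐᵒᵖ J]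
    [SMulCommClass C Cᵐᵒᵖ J] [IsScalarTower K C J] [IsScalarTower K Cᵐᵒᵖ J] (α β : R →ₐ[K] C) :
    TwoCocycle (K := K) R J where
  l := leftAct α J
  r := rightAct β J
  c := 0
  l_one := by simp
  r_one := by simp
  l_mul := by simp [mul_smul]
  r_mul := by simp [mul_smul]
  l_r x y j := smul_comm (α x) (op (β y)) j
  cocycle := by simp

/-- The extension of `R` by the square-zero ideal `J` that belongs to a 2-cocycle. -/
def Ext (_ : TwoCocycle (K := K) R J) : Type u := R × J

namespace Ext

variable (T : TwoCocycle (K := K) R J)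

instance : AddCommGroup T.Ext := inferInstanceAs (AddCommGroup (R × J))
instance : Module K T.Ext := inferInstanceAs (Module K (R × J))

variable {T} in
@[ext] theorem ext {a b : T.Ext} (h₁ : a.1 = b.1) (h₂ : a.2 = b.2) : a = b := Prod.ext h₁ h₂

instance : Mul T.Ext := ⟨fun a b => (a.1 * b.1, T.l a.1 b.2 + T.r b.1 a.2 + T.c a.1 b.1)⟩
-- The cocycle is not assumed to be normalized, so the unit is corrected by `c 1 1`.
instance : One T.Ext := ⟨(1, -T.c 1 1)⟩

variable {T}

@[simp] theorem add_fst (a b : T.Ext) : (a + b).1 = a.1 + b.1 := rfl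
@[simp] theorem add_snd (a b : T.Ext) : (a + b).2 = a.2 + b.2 := rfl
@[simp] theorem zero_fst : (0 : T.Ext).1 = 0 := rfl
@[simp] theorem zero_snd : (0 : T.Ext).2 = 0 := rfl
@[simp] theorem smul_fst (k : K) (a : T.Ext) : (k • a).1 = k • a.1 := rfl
@[simp] theorem smul_snd (k : K) (a : T.Ext) : (k • a).2 = k • a.2 := rfl
@[simp] theorem one_fst : (1 : T.Ext).1 = 1 := rfl
@[simp] theorem one_snd : (1 : T.Ext).2 = -T.c 1 1 := rfl
@[simp] theorem mul_fst (a b : T.Ext) : (a * b).1 = a.1 * b.1 := rfl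
@[simp] theorem mul_snd (a b : T.Ext) :
    (a * b).2 = T.l a.1 b.2 + T.r b.1 a.2 + T.c a.1 b.1 := rfl

instance : Ring T.Ext where
  __ := (inferInstance : AddCommGroup T.Ext)
  mul_assoc a b c := by
    ext
    · simp [mul_assoc]
    · have h := T.cocycle a.1 b.1 c.1
      simp only [mul_snd, mul_fst, map_add, T.l_mul, T.r_mul, T.l_r]
      rw [add_assoc, add_assoc, add_comm (T.r c.1 (T.c a.1 b.1)), ← h]
      abel
  one_mul a := by
    ext
    · simp
    · rw [mul_snd, one_fst, one_snd, map_neg, T.l_one, ← T.c_one_left, neg_add_cancel_right]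
  mul_one a := by
    ext
    · simp
    · rw [mul_snd, one_fst, one_snd, map_neg, T.r_one, ← T.c_one_right, add_right_comm,
        neg_add_cancel, zero_add]
  left_distrib a b c := by
    ext
    · simp [mul_add]
    · simp only [mul_snd, add_fst, add_snd, map_add, LinearMap.add_apply]; abel
  right_distrib a b c := by
    ext
    · simp [add_mul]
    · simp only [mul_snd, add_fst, add_snd, map_add, LinearMap.add_apply]; abel
  zero_mul a := by ext <;> simp
  mul_zero a := by ext <;> simp

instance : Algebra K T.Ext :=
  Algebra.ofModule (fun k a b => by ext <;> simp) (fun k a b => by ext <;> simp)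

variable (T) in
/-- The projection of the extension to `R`. -/
def fst : T.Ext →ₐ[K] R :=
  AlgHom.ofLinearMap (LinearMap.fst K R J : T.Ext →ₗ[K] R) rfl fun _ _ => rfl

@[simp] theorem fst_apply (a : T.Ext) : fst T a = a.1 := rfl

end Ext

end TwoCocycle

namespace ChainAlgebra

variable {P : ChainAlgebra K} {J : Type u} [AddCommGroup J] [Module K J]

/-- On a cofibrant chain algebra, a 2-cocycle is a coboundary, and a cochain that bounds it can be
chosen to lift a given map `δ` that is compatible with the cocycle. For the zero cocycle this is the
lifting of derivations. -/
theorem IsCofibrant.exists_derivation_lift (hP : P.IsCofibrant)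
    (T : TwoCocycle (K := K) P.carrier J) {J' : Type u} [AddCommGroup J'] [Module K J']
    (f : J →ₗ[K] J') (δ : P.carrier →ₗ[K] J') (hδ : ∀ x, ∃ j, f j = δ x)
    (h : ∀ x y j k, f j = δ x → f k = δ y → f (T.l x k + T.r y j + T.c x y) = δ (x * y)) :
    ∃ s : P.carrier →ₗ[K] J, (∀ x y, s (x * y) = T.l x (s y) + T.r y (s x) + T.c x y) ∧
      ∀ x, f (s x) = δ x := by
  have h1 : f (-T.c 1 1) = δ 1 := by
    obtain ⟨j, hj⟩ := hδ 1
    have := h 1 1 j j hj hj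
    rw [mul_one, ← hj, T.l_one, T.r_one, map_add, map_add, add_assoc, add_eq_left] at this
    rw [map_neg, ← hj, neg_eq_iff_add_eq_zero, add_comm, this]
  -- A splitting of the subalgebra of pairs `(x, j)` with `f j = δ x` is the graph of `s`.
  let S : Subalgebra K T.Ext :=
    { carrier := {a | f a.2 = δ a.1}
      mul_mem' := fun {a b} ha hb => h _ _ _ _ ha hb
      add_mem' := fun {a b} (ha : _ = _) (hb : _ = _) => by
        change f (a + b).2 = δ (a + b).1
        simp [ha, hb]
      algebraMap_mem' := fun k => by
        change f (algebraMap K T.Ext k).2 = δ (algebraMap K T.Ext k).1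
        rw [Algebra.algebraMap_eq_smul_one]
        simp only [TwoCocycle.Ext.smul_snd, TwoCocycle.Ext.smul_fst, TwoCocycle.Ext.one_snd,
          TwoCocycle.Ext.one_fst, map_smul, h1] }
  obtain ⟨t, ht⟩ := hP.exists_algHom_lift ((TwoCocycle.Ext.fst T).comp S.val) (AlgHom.id K _)
    (fun x => by
      obtain ⟨j, hj⟩ := hδ x
      exact ⟨⟨(x, j), hj⟩, rfl⟩)
  have ht' (x : P.carrier) : (t x).1.1 = x := ht x
  refine ⟨(LinearMap.snd K P.carrier J : T.Ext →ₗ[K] J) ∘ₗ S.val.toLinearMap ∘ₗ t.toLinearMap,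
    fun x y => ?_, fun x => ?_⟩
  · change (t (x * y)).1.2 = T.l x (t y).1.2 + T.r y (t x).1.2 + T.c x y
    simp [ht']
  · have : f (t x).1.2 = δ (t x).1.1 := (t x).2
    rwa [ht'] at this

/-- If the positive degrees act trivially and the cocycle is concentrated in degree `k`, then a
cochain that bounds it can be replaced by its part of degree `k`. -/
theorem derivation_comp_proj (l r : P.carrier →ₗ[K] J →ₗ[K] J)
    (c : P.carrier →ₗ[K] P.carrier →ₗ[K] J) (hl : P.KillsPos l) (hr : P.KillsPos r) (k : ℕ)
    (hc : ∀ i j x y, x ∈ P.deg i → y ∈ P.deg j → i + j ≠ k → c x y = 0) (s : P.carrier →ₗ[K] J)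
    (hs : ∀ x y, s (x * y) = l x (s y) + r y (s x) + c x y) (x y : P.carrier) :
    s (P.proj k (x * y)) = l x (s (P.proj k y)) + r y (s (P.proj k x)) + c x y := by
  induction x using P.homogeneous_induction with
  | add x x' hx hx' => simp only [add_mul, map_add, hx, hx', LinearMap.add_apply]; abel
  | homogeneous i x hx =>
    induction y using P.homogeneous_induction with
    | add y y' hy hy' => simp only [mul_add, map_add, hy, hy', LinearMap.add_apply]; abel
    | homogeneous j y hy =>
      have hl' : i ≠ 0 → l x = 0 := fun h => by
        obtain ⟨i, rfl⟩ := Nat.exists_eq_succ_of_ne_zero h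
        exact hl i x hx
      have hr' : j ≠ 0 → r y = 0 := fun h => by
        obtain ⟨j, rfl⟩ := Nat.exists_eq_succ_of_ne_zero h
        exact hr j y hy
      have h₁ : i + j = k → l x (s (P.proj k y)) = l x (s y) := fun h => by
        by_cases hi : i = 0
        · rw [P.proj_of_mem (by rwa [← h, hi, zero_add])]
        · simp [hl' hi]
      have h₂ : i + j = k → r y (s (P.proj k x)) = r y (s x) := fun h => by
        by_cases hj : j = 0
        · rw [P.proj_of_mem (by rwa [← h, hj, add_zero])]
        · simp [hr' hj]
      by_cases h : i + j = k
      · rw [P.proj_of_mem (h ▸ P.mul_mem hx hy), hs, h₁ h, h₂ h]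
      · rw [P.proj_of_mem_ne (P.mul_mem hx hy) h, hc i j x y hx hy h, map_zero, add_zero]
        have h₃ : l x (s (P.proj k y)) = 0 := by
          by_cases hi : i = 0
          · rw [P.proj_of_mem_ne hy (by omega), map_zero, map_zero]
          · simp [hl' hi]
        have h₄ : r y (s (P.proj k x)) = 0 := by
          by_cases hj : j = 0
          · rw [P.proj_of_mem_ne hx (by omega), map_zero, map_zero]
          · simp [hr' hj]
        rw [h₃, h₄, add_zero]

end ChainAlgebra

end LiftingThrough

/-! ### Hochschild cochains of low tensor degree -/

namespace Hochschild

variable {K : Type u} [CommRing K] {X : ChainAlgebra K} {A : Type u} [Ring A] [Algebra K A]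
  {M : Type u} [AddCommGroup M] [Module K M]

theorem eq_vec_one {α : Type*} (x : Fin 1 → α) : x = ![x 0] := by
  ext i; fin_cases i; rfl

theorem eq_vec_two {α : Type*} (x : Fin 2 → α) : x = ![x 0, x 1] := by
  ext i; fin_cases i <;> rfl

theorem eq_vec_three {α : Type*} (x : Fin 3 → α) : x = ![x 0, x 1, x 2] := by
  ext i; fin_cases i <;> rfl

/-- Cochains of tensor degree one are linear maps. -/
def curryOne : MultilinearMap K (fun _ : Fin 1 => X.carrier) M ≃ₗ[K] (X.carrier →ₗ[K] M) :=
  (MultilinearMap.ofSubsingletonₗ K K X.carrier M (0 : Fin 1)).symm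

/-- Cochains of tensor degree two are bilinear maps. -/
def curryTwo :
    MultilinearMap K (fun _ : Fin 2 => X.carrier) M ≃ₗ[K] (X.carrier →ₗ[K] X.carrier →ₗ[K] M) :=
  multilinearCurryLeftEquiv K (fun _ : Fin 2 => X.carrier) M ≪≫ₗ curryOne.congrRight

/-- Cochains of tensor degree three are trilinear maps. -/
def curryThree : MultilinearMap K (fun _ : Fin 3 => X.carrier) M ≃ₗ[K]
    (X.carrier →ₗ[K] X.carrier →ₗ[K] X.carrier →ₗ[K] M) :=
  multilinearCurryLeftEquiv K (fun _ : Fin 3 => X.carrier) M ≪≫ₗ curryTwo.congrRight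

@[simp] theorem curryOne_apply (u : MultilinearMap K (fun _ : Fin 1 => X.carrier) M)
    (x : X.carrier) : curryOne u x = u ![x] := by
  change u _ = _
  congr 1
  exact eq_vec_one _

@[simp] theorem curryTwo_apply (u : MultilinearMap K (fun _ : Fin 2 => X.carrier) M)
    (x y : X.carrier) : curryTwo u x y = u ![x, y] := by
  change curryOne (u.curryLeft x) y = _
  rw [curryOne_apply]
  rfl

@[simp] theorem curryThree_apply (u : MultilinearMap K (fun _ : Fin 3 => X.carrier) M)
    (x y z : X.carrier) : curryThree u x y z = u ![x, y, z] := by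
  change curryTwo (u.curryLeft x) y z = _
  rw [curryTwo_apply]
  rfl

@[simp] theorem curryOne_symm_apply (D : X.carrier →ₗ[K] M) (x : X.carrier) :
    curryOne.symm D ![x] = D x := by
  rw [← curryOne_apply, LinearEquiv.apply_symm_apply]

@[simp] theorem curryTwo_symm_apply (b : X.carrier →ₗ[K] X.carrier →ₗ[K] M) (x y : X.carrier) :
    curryTwo.symm b ![x, y] = b x y := by
  rw [← curryTwo_apply, LinearEquiv.apply_symm_apply]

theorem innerD_apply (p : ℕ) (u : MultilinearMap K (fun _ : Fin p => X.carrier) M)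
    (x : Fin p → X.carrier) : innerD X M p u x = ∑ i, u fun j => tensorD X i j (x j) := by
  simp [innerD]

theorem innerD_one (u : MultilinearMap K (fun _ : Fin 1 => X.carrier) M) (x : X.carrier) :
    innerD X M 1 u ![x] = u ![X.d x] := by
  have h₀ : (fun j => tensorD X (0 : Fin 1) j (![x] j)) = ![X.d x] := by
    rw [eq_vec_one fun j => _]; simp [tensorD]
  rw [innerD_apply, Fin.sum_univ_one, h₀]

theorem innerD_two (u : MultilinearMap K (fun _ : Fin 2 => X.carrier) M) (x y : X.carrier) :
    innerD X M 2 u ![x, y] = u ![X.d x, y] + u ![X.sgn x, X.d y] := by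
  have h₀ : (fun j => tensorD X (0 : Fin 2) j (![x, y] j)) = ![X.d x, y] := by
    rw [eq_vec_two fun j => _]; simp [tensorD]
  have h₁ : (fun j => tensorD X (1 : Fin 2) j (![x, y] j)) = ![X.sgn x, X.d y] := by
    rw [eq_vec_two fun j => _]; simp [tensorD]
  rw [innerD_apply, Fin.sum_univ_two, h₀, h₁]

theorem innerD_three (u : MultilinearMap K (fun _ : Fin 3 => X.carrier) M) (x y z : X.carrier) :
    innerD X M 3 u ![x, y, z] =
      u ![X.d x, y, z] + u ![X.sgn x, X.d y, z] + u ![X.sgn x, X.sgn y, X.d z] := by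
  have h₀ : (fun j => tensorD X (0 : Fin 3) j (![x, y, z] j)) = ![X.d x, y, z] := by
    rw [eq_vec_three fun j => _]; simp [tensorD]
  have h₁ : (fun j => tensorD X (1 : Fin 3) j (![x, y, z] j)) = ![X.sgn x, X.d y, z] := by
    rw [eq_vec_three fun j => _]; simp [tensorD]
  have h₂ : (fun j => tensorD X (2 : Fin 3) j (![x, y, z] j)) = ![X.sgn x, X.sgn y, X.d z] := by
    rw [eq_vec_three fun j => _]; simp [tensorD]
  rw [innerD_apply, Fin.sum_univ_three, h₀, h₁, h₂]

variable [Module A M] [Module Aᵐᵒᵖ M] [IsScalarTower K A M] [IsScalarTower K Aᵐᵒᵖ M]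
  (ρ : X.carrier →ₐ[K] A)

theorem outerD_apply (p : ℕ) (u : MultilinearMap K (fun _ : Fin p => X.carrier) M)
    (x : Fin (p + 1) → X.carrier) :
    outerD X ρ M p u x = ρ (x 0) • u (fun j => x j.succ) +
      ∑ i : Fin p, (-1 : K) ^ ((i : ℕ) + 1) • u (Fin.contractNth i.castSucc (· * ·) x) +
        (-1 : K) ^ (p + 1) • op (ρ (x (Fin.last p))) • u fun j => x j.castSucc := by
  simp [outerD, cofaceLeft, cofaceRight, cofaceMid]

theorem outerD_one (u : MultilinearMap K (fun _ : Fin 1 => X.carrier) M) (x y : X.carrier) :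
    outerD X ρ M 1 u ![x, y] = ρ x • u ![y] - u ![x * y] + op (ρ y) • u ![x] := by
  have h₀ : Fin.contractNth (Fin.castSucc (0 : Fin 1)) (· * ·) ![x, y] = ![x * y] := eq_vec_one _
  rw [outerD_apply, Fin.sum_univ_one, h₀, eq_vec_one fun j => ![x, y] j.succ,
    eq_vec_one fun j => ![x, y] j.castSucc]
  simp [sub_eq_add_neg]

theorem outerD_two (u : MultilinearMap K (fun _ : Fin 2 => X.carrier) M) (x y z : X.carrier) :
    outerD X ρ M 2 u ![x, y, z] =
      ρ x • u ![y, z] - u ![x * y, z] + u ![x, y * z] - op (ρ z) • u ![x, y] := by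
  have h₀ : Fin.contractNth (Fin.castSucc (0 : Fin 2)) (· * ·) ![x, y, z] = ![x * y, z] :=
    eq_vec_two _
  have h₁ : Fin.contractNth (Fin.castSucc (1 : Fin 2)) (· * ·) ![x, y, z] = ![x, y * z] :=
    eq_vec_two _
  have h₂ : (fun j : Fin 2 => ![x, y, z] j.castSucc) = ![x, y] := eq_vec_two _
  have h₃ : (fun j : Fin 2 => ![x, y, z] j.succ) = ![y, z] := eq_vec_two _
  rw [outerD_apply, Fin.sum_univ_two, h₀, h₁, h₂, h₃]
  have h : ![x, y, z] (Fin.last 2) = z := rfl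
  rw [h]
  simp [pow_succ, sub_eq_add_neg, add_assoc]

theorem outerD_three (u : MultilinearMap K (fun _ : Fin 3 => X.carrier) M) (x y z w : X.carrier) :
    outerD X ρ M 3 u ![x, y, z, w] =
      ρ x • u ![y, z, w] - u ![x * y, z, w] + u ![x, y * z, w] - u ![x, y, z * w] +
        op (ρ w) • u ![x, y, z] := by
  have h₀ : Fin.contractNth (Fin.castSucc (0 : Fin 3)) (· * ·) ![x, y, z, w] = ![x * y, z, w] :=
    eq_vec_three _
  have h₁ : Fin.contractNth (Fin.castSucc (1 : Fin 3)) (· * ·) ![x, y, z, w] = ![x, y * z, w] :=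
    eq_vec_three _
  have h₂ : Fin.contractNth (Fin.castSucc (2 : Fin 3)) (· * ·) ![x, y, z, w] = ![x, y, z * w] :=
    eq_vec_three _
  have h₃ : (fun j : Fin 3 => ![x, y, z, w] j.castSucc) = ![x, y, z] := eq_vec_three _
  have h₄ : (fun j : Fin 3 => ![x, y, z, w] j.succ) = ![y, z, w] := eq_vec_three _
  rw [outerD_apply, Fin.sum_univ_three, h₀, h₁, h₂, h₃, h₄]
  have h : ![x, y, z, w] (Fin.last 3) = w := rfl
  rw [h]
  simp [pow_succ, sub_eq_add_neg, add_assoc]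

/-- A homomorphism from a chain algebra to an algebra that is a morphism of chain algebras. -/
structure IsAugmentation (ρ : X.carrier →ₐ[K] A) : Prop where
  killsPos : X.KillsPos ρ
  map_d : ∀ x, ρ (X.d x) = 0

variable {ρ}

theorem IsAugmentation.map_sgn (hρ : IsAugmentation ρ) (x : X.carrier) : ρ (X.sgn x) = ρ x :=
  hρ.killsPos.comp_sgn x

variable (ρ) in
/-- A derivation of degree `n` from a chain algebra to a bimodule in degree zero. -/
structure IsDerivation (n : ℕ) (D : X.carrier →ₗ[K] M) : Prop where
  vanish : ∀ k, k ≠ n → ∀ x ∈ X.deg k, D x = 0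
  map_mul : ∀ x y, D (x * y) = ρ x • D y + op (ρ y) • D x

variable (ρ) in
/-- A derivation of degree `n` that is a cocycle: it vanishes on boundaries. -/
structure IsDerCocycle (n : ℕ) (D : X.carrier →ₗ[K] M) : Prop extends IsDerivation ρ n D where
  map_d : ∀ x, D (X.d x) = 0

section Vanishing

variable [SMulCommClass A Aᵐᵒᵖ M]

/-- Bilinear Hochschild cocycles on a cofibrant chain algebra are coboundaries. -/
theorem exists_primitive_two (hX : X.IsCofibrant) (hρ : IsAugmentation ρ) (k : ℕ)
    (c : X.carrier →ₗ[K] X.carrier →ₗ[K] M)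
    (hc : ∀ i j x y, x ∈ X.deg i → y ∈ X.deg j → i + j ≠ k → c x y = 0)
    (h : ∀ x y z, ρ x • c y z + c x (y * z) = c (x * y) z + op (ρ z) • c x y) :
    ∃ e : X.carrier →ₗ[K] M, (∀ j, j ≠ k → ∀ x ∈ X.deg j, e x = 0) ∧
      ∀ x y, e (x * y) = ρ x • e y + op (ρ y) • e x + c x y := by
  let T : TwoCocycle (K := K) X.carrier M :=
    { TwoCocycle.ofAlgHom ρ ρ with c := c, cocycle := h }
  obtain ⟨s, hs, -⟩ := hX.exists_derivation_lift T (0 : M →ₗ[K] M) 0 (fun x => ⟨0, rfl⟩)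
    (fun _ _ _ _ _ _ => rfl)
  have hs' := ChainAlgebra.derivation_comp_proj T.l T.r T.c
    (fun n x hx => by ext j; simp [T, TwoCocycle.ofAlgHom, hρ.killsPos n x hx])
    (fun n x hx => by ext j; simp [T, TwoCocycle.ofAlgHom, hρ.killsPos n x hx]) k hc s hs
  refine ⟨s ∘ₗ X.proj k, fun j hj x hx => ?_, hs'⟩
  rw [LinearMap.comp_apply, X.proj_of_mem_ne hx hj, map_zero]

/-- The bimodule of linear maps `f : X → M` with `f 1 = 0`, where `(x f)(z) = x f(z)` and
`(f y)(z) = f(y z) - f(y) z`, with the 2-cocycle that belongs to a trilinear Hochschild cocycle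
which vanishes if the last argument is `1`. -/
def homCocycle (ρ : X.carrier →ₐ[K] A)
    (c : X.carrier →ₗ[K] X.carrier →ₗ[K] X.carrier →ₗ[K] M)
    (hc : ∀ x y, c x y 1 = 0)
    (h : ∀ x y z w, ρ x • c y z w - c (x * y) z w + c x (y * z) w - c x y (z * w) +
      op (ρ w) • c x y z = 0) :
    TwoCocycle (K := K) X.carrier
      (LinearMap.ker (LinearMap.applyₗ (R := K) (M₂ := M) (1 : X.carrier))) where
  l := LinearMap.mk₂ K (fun x f => ⟨leftAct ρ M x ∘ₗ f.1, by
      have : f.1 1 = 0 := f.2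
      simp [this]⟩)
    (fun x x' f => by ext z; simp) (fun k x f => by ext z; simp)
    (fun x f f' => by ext z; simp) (fun k x f => by ext z; simp)
  r := LinearMap.mk₂ K (fun y f =>
      ⟨f.1 ∘ₗ LinearMap.mulLeft K y - (rightAct ρ M).flip (f.1 y), by simp⟩)
    (fun x x' f => by ext z; simp [add_mul]; abel)
    (fun k x f => by ext z; simp [smul_sub])
    (fun x f f' => by ext z; simp; abel) (fun k x f => by ext z; simp [smul_sub])
  c := LinearMap.mk₂ K (fun x y => ⟨c x y, hc x y⟩)
    (fun x x' f => by ext z; simp) (fun k x f => by ext z; simp)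
    (fun x f f' => by ext z; simp) (fun k x f => by ext z; simp)
  l_one f := by ext z; simp
  r_one f := by
    have : f.1 1 = 0 := f.2
    ext z; simp [this]
  l_mul x y f := by ext z; simp [mul_smul]
  r_mul x y f := by ext z; simp [mul_smul]
  l_r x y f := by ext z; simp [smul_sub, smul_comm (ρ x) (op (ρ z))]
  cocycle x y z := by
    ext w
    have := h x y z w
    simp only [LinearMap.mk₂_apply, Submodule.coe_add, LinearMap.add_apply, LinearMap.comp_apply,
      leftAct_apply, LinearMap.sub_apply, LinearMap.mulLeft_apply, LinearMap.flip_apply,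
      rightAct_apply]
    rw [← sub_eq_zero, ← this]
    abel

/-- Trilinear Hochschild cocycles in degree zero on a cofibrant chain algebra are coboundaries. A
trilinear cocycle is a bilinear one with values in the bimodule of linear maps. -/
theorem exists_primitive_three (hX : X.IsCofibrant) (hρ : IsAugmentation ρ)
    (c : X.carrier →ₗ[K] X.carrier →ₗ[K] X.carrier →ₗ[K] M)
    (hc : ∀ x y z, c (X.projZero x) (X.projZero y) (X.projZero z) = c x y z)
    (h : ∀ x y z w, ρ x • c y z w - c (x * y) z w + c x (y * z) w - c x y (z * w) +
      op (ρ w) • c x y z = 0) :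
    ∃ b : X.carrier →ₗ[K] X.carrier →ₗ[K] M,
      (∀ i j x y, x ∈ X.deg i → y ∈ X.deg j → i + j ≠ 0 → b x y = 0) ∧
      ∀ x y z, ρ x • b y z - b (x * y) z + b x (y * z) - op (ρ z) • b x y = c x y z := by
  -- The coboundary of `u` is `-u(x, y) z`; adding it makes the cocycle vanish for `z = 1`.
  let u : X.carrier →ₗ[K] X.carrier →ₗ[K] M := c.compr₂ (LinearMap.applyₗ 1)
  have hu (x y z : X.carrier) : ρ x • u y z - u (x * y) z + u x (y * z) = 0 := by
    simpa [u] using h x y z 1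
  let v : X.carrier →ₗ[K] X.carrier →ₗ[K] X.carrier →ₗ[K] M := c - u.compr₂ (rightAct ρ M).flip
  have hv (x y z : X.carrier) : v x y z = c x y z - op (ρ z) • u x y := rfl
  obtain ⟨s, hs, -⟩ := hX.exists_derivation_lift (homCocycle ρ v (by simp [v, u]) (by
    intro x y z w
    have h₁ := h x y z w
    have h₂ := congrArg (op (ρ w) • ·) (hu x y z)
    simp only [smul_add, smul_sub, smul_zero, ← smul_comm (ρ x) (op (ρ w))] at h₂
    simp only [hv, smul_sub, _root_.map_mul, op_mul, mul_smul]
    rw [← sub_eq_zero.2 (h₁.trans h₂.symm)]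
    abel)) (0 : _ →ₗ[K] M) 0 (fun x => ⟨0, rfl⟩) (fun _ _ _ _ _ _ => rfl)
  have hs' (x y z : X.carrier) : (s (x * y)).1 z =
      ρ x • (s y).1 z + ((s x).1 (y * z) - op (ρ z) • (s x).1 y) +
        (c x y z - op (ρ z) • u x y) := by
    rw [hs]; rfl
  let b : X.carrier →ₗ[K] X.carrier →ₗ[K] M :=
    -((Submodule.subtype _ ∘ₗ s + u).compl₁₂ X.projZero.toLinearMap X.projZero.toLinearMap)
  have hb (x y : X.carrier) :
      b x y = -((s (X.projZero x)).1 (X.projZero y) + u (X.projZero x) (X.projZero y)) := rfl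
  refine ⟨b, fun i j x y hx hy hij => ?_, fun x y z => ?_⟩
  · rw [hb]
    rcases i with _ | i
    · rcases j with _ | j
      · exact absurd rfl hij
      · simp [X.projZero_of_pos hy]
    · simp [X.projZero_of_pos hx]
  · have h₁ := hs' (X.projZero x) (X.projZero y) (X.projZero z)
    have h₂ := hu (X.projZero x) (X.projZero y) (X.projZero z)
    rw [hc, hρ.killsPos.comp_projZero, hρ.killsPos.comp_projZero] at h₁
    rw [hρ.killsPos.comp_projZero] at h₂
    simp only [hb, _root_.map_mul, smul_neg, smul_add, h₁]
    rw [← sub_eq_zero, ← neg_eq_zero, ← h₂]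
    abel

end Vanishing

end Hochschild

/-! ### Hochschild cohomology of cofibrant chain algebras and derivations -/

namespace Hochschild

variable {K : Type u} [CommRing K] {X : ChainAlgebra K} {A : Type u} [Ring A] [Algebra K A]
  {M : Type u} [AddCommGroup M] [Module K M]

/-- A multilinear map that vanishes on homogeneous elements is zero. -/
theorem multilinear_eq_zero {p : ℕ} (u : MultilinearMap K (fun _ : Fin p => X.carrier) M)
    (h : ∀ (k : Fin p → ℕ) (x : Fin p → X.carrier), (∀ j, x j ∈ X.deg (k j)) → u x = 0) :
    u = 0 := by
  classical
  ext x
  have hx : x = fun j => ∑ i ∈ (DirectSum.decompose X.deg (x j)).support,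
      (DirectSum.decompose X.deg (x j) i : X.carrier) :=
    funext fun j => (DirectSum.sum_support_decompose X.deg (x j)).symm
  rw [hx, u.map_sum_finset, zero_apply]
  exact Finset.sum_eq_zero fun r _ => h r _ fun j => SetLike.coe_mem _

theorem cochains_apply_eq_zero {n p : ℕ} (hn : n < p) {c : Cochain X M} (hc : c ∈ cochains X M n) :
    c p = 0 :=
  multilinear_eq_zero _ fun k x hx => hc p k x hx (by omega)

theorem cochains_apply_zero {n : ℕ} {c : Cochain X M} (hc : c ∈ cochains X M (n + 1)) : c 0 = 0 :=
  multilinear_eq_zero _ fun k x hx => hc 0 k x hx (by simp)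

theorem cochains_apply_one {n k : ℕ} {c : Cochain X M} (hc : c ∈ cochains X M (n + 1)) (hk : k ≠ n)
    {x : X.carrier} (hx : x ∈ X.deg k) : c 1 ![x] = 0 :=
  hc 1 (fun _ => k) ![x] (fun j => by fin_cases j; exact hx) (by simp; omega)

theorem cochains_apply_two {n i j : ℕ} {c : Cochain X M} (hc : c ∈ cochains X M (n + 2))
    (hk : i + j ≠ n) {x y : X.carrier} (hx : x ∈ X.deg i) (hy : y ∈ X.deg j) : c 2 ![x, y] = 0 :=
  hc 2 ![i, j] ![x, y] (fun j => by fin_cases j <;> assumption) (by simp; omega)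

theorem cochains_apply_three_projZero {c : Cochain X M} (hc : c ∈ cochains X M 3)
    (x y z : X.carrier) : c 3 ![X.projZero x, X.projZero y, X.projZero z] = c 3 ![x, y, z] := by
  have h (i j k : ℕ) (x y z : X.carrier) (hx : x ∈ X.deg i) (hy : y ∈ X.deg j) (hz : z ∈ X.deg k)
      (hijk : i + j + k ≠ 0) : c 3 ![x, y, z] = 0 :=
    hc 3 ![i, j, k] ![x, y, z] (fun j => by fin_cases j <;> assumption)
      (by simp [Fin.sum_univ_three]; omega)
  simp only [← curryThree_apply] at h ⊢
  induction x using X.homogeneous_induction with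
  | add x x' hx hx' => simp only [map_add, LinearMap.add_apply, hx, hx']
  | homogeneous i x hx =>
    induction y using X.homogeneous_induction with
    | add y y' hy hy' => simp only [map_add, LinearMap.add_apply, hy, hy']
    | homogeneous j y hy =>
      induction z using X.homogeneous_induction with
      | add z z' hz hz' => simp only [map_add, hz, hz']
      | homogeneous k z hz =>
        by_cases hijk : i + j + k = 0
        · obtain ⟨rfl, rfl, rfl⟩ : i = 0 ∧ j = 0 ∧ k = 0 := by omega
          rw [X.projZero_of_mem hx, X.projZero_of_mem hy, X.projZero_of_mem hz]
        · rw [h i j k x y z hx hy hz hijk]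
          rcases i with _ | i
          · rcases j with _ | j
            · rcases k with _ | k
              · exact absurd rfl hijk
              · simp [X.projZero_of_pos hz, -curryThree_apply]
            · simp [X.projZero_of_pos hy, -curryThree_apply]
          · simp [X.projZero_of_pos hx, -curryThree_apply]

/-- The total cochain of tensor degree one given by a linear map. -/
def ofLinear : (X.carrier →ₗ[K] M) →ₗ[K] Cochain X M :=
  LinearMap.single K _ 1 ∘ₗ curryOne.symm.toLinearMap

/-- The total cochain of tensor degree two given by a bilinear map. -/
def ofBilinear : (X.carrier →ₗ[K] X.carrier →ₗ[K] M) →ₗ[K] Cochain X M :=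
  LinearMap.single K (fun p : ℕ => MultilinearMap K (fun _ : Fin p => X.carrier) M) 2 ∘ₗ
    curryTwo.symm.toLinearMap

@[simp] theorem ofLinear_one (D : X.carrier →ₗ[K] M) : ofLinear D 1 = curryOne.symm D := by
  simp [ofLinear]

theorem ofLinear_of_ne (D : X.carrier →ₗ[K] M) {p : ℕ} (hp : p ≠ 1) : ofLinear D p = 0 := by
  simp [ofLinear, hp]

@[simp] theorem ofBilinear_two (b : X.carrier →ₗ[K] X.carrier →ₗ[K] M) :
    ofBilinear b 2 = curryTwo.symm b := by
  simp [ofBilinear]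

theorem ofBilinear_of_ne (b : X.carrier →ₗ[K] X.carrier →ₗ[K] M) {p : ℕ} (hp : p ≠ 2) :
    ofBilinear b p = 0 := by
  simp [ofBilinear, hp]

theorem ofLinear_mem_cochains {n : ℕ} {D : X.carrier →ₗ[K] M}
    (hD : ∀ k, k ≠ n → ∀ x ∈ X.deg k, D x = 0) : ofLinear D ∈ cochains X M (n + 1) := by
  intro p k x hx hn
  by_cases hp : p = 1
  · subst hp
    rw [ofLinear_one, eq_vec_one x, curryOne_symm_apply]
    exact hD (k 0) (by simp at hn; omega) _ (hx 0)
  · rw [ofLinear_of_ne D hp, zero_apply]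

theorem ofBilinear_mem_cochains {n : ℕ} {b : X.carrier →ₗ[K] X.carrier →ₗ[K] M}
    (hb : ∀ i j x y, x ∈ X.deg i → y ∈ X.deg j → i + j ≠ n → b x y = 0) :
    ofBilinear b ∈ cochains X M (n + 2) := by
  intro p k x hx hn
  by_cases hp : p = 2
  · subst hp
    rw [ofBilinear_two, eq_vec_two x, curryTwo_symm_apply]
    exact hb (k 0) (k 1) _ _ (hx 0) (hx 1) (by simp at hn; omega)
  · rw [ofBilinear_of_ne b hp, zero_apply]

variable [Module A M] [Module Aᵐᵒᵖ M] [IsScalarTower K A M] [IsScalarTower K Aᵐᵒᵖ M]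
  {ρ : X.carrier →ₐ[K] A}

theorem totalD_zero (c : Cochain X M) : totalD X ρ M c 0 = 0 := by
  simp [totalD, innerD]

theorem totalD_succ (c : Cochain X M) (p : ℕ) : totalD X ρ M c (p + 1) =
    outerD X ρ M p (c p) + (-1 : K) ^ (p + 1) • innerD X M (p + 1) (c (p + 1)) := rfl

theorem totalD_one {c : Cochain X M} (hc : c 0 = 0) (x : X.carrier) :
    totalD X ρ M c 1 ![x] = -c 1 ![X.d x] := by
  rw [totalD_succ, hc]
  simp [innerD_one]

theorem totalD_two (c : Cochain X M) (x y : X.carrier) :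
    totalD X ρ M c 2 ![x, y] = ρ x • c 1 ![y] - c 1 ![x * y] + op (ρ y) • c 1 ![x] +
      (c 2 ![X.d x, y] + c 2 ![X.sgn x, X.d y]) := by
  rw [totalD_succ]
  simp [innerD_two, outerD_one]

theorem totalD_three (c : Cochain X M) (x y z : X.carrier) :
    totalD X ρ M c 3 ![x, y, z] =
      ρ x • c 2 ![y, z] - c 2 ![x * y, z] + c 2 ![x, y * z] - op (ρ z) • c 2 ![x, y] -
        (c 3 ![X.d x, y, z] + c 3 ![X.sgn x, X.d y, z] + c 3 ![X.sgn x, X.sgn y, X.d z]) := by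
  rw [totalD_succ]
  simp [innerD_three, outerD_two, pow_succ, sub_eq_add_neg]

theorem totalD_four {c : Cochain X M} (hc : c 4 = 0) (x y z w : X.carrier) :
    totalD X ρ M c 4 ![x, y, z, w] =
      ρ x • c 3 ![y, z, w] - c 3 ![x * y, z, w] + c 3 ![x, y * z, w] - c 3 ![x, y, z * w] +
        op (ρ w) • c 3 ![x, y, z] := by
  rw [totalD_succ, hc]
  simp [outerD_three]

/-- Total cochains that are concentrated in tensor degrees one to three are equal if their values
are. -/
theorem cochain_ext {c c' : Cochain X M} (h₀ : c 0 = c' 0) (h₁ : ∀ x, c 1 ![x] = c' 1 ![x])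
    (h₂ : ∀ x y, c 2 ![x, y] = c' 2 ![x, y]) (h₃ : ∀ x y z, c 3 ![x, y, z] = c' 3 ![x, y, z])
    (h₄ : ∀ p, 3 < p → c p = c' p) : c = c' := by
  funext p
  match p with
  | 0 => exact h₀
  | 1 => ext x; rw [eq_vec_one x]; exact h₁ _
  | 2 => ext x; rw [eq_vec_two x]; exact h₂ _ _
  | 3 => ext x; rw [eq_vec_three x]; exact h₃ _ _ _
  | p + 4 => exact h₄ _ (by omega)

/-- A derivation that vanishes on boundaries is a total cocycle. -/
theorem IsDerCocycle.ofLinear_mem_cocycles {n : ℕ} {D : X.carrier →ₗ[K] M}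
    (hD : IsDerCocycle ρ n D) : ofLinear D ∈ cocycles X ρ M (n + 1) := by
  refine ⟨ofLinear_mem_cochains hD.vanish, LinearMap.mem_ker.2 ?_⟩
  have h₂ := ofLinear_of_ne D (p := 2) (by simp)
  have h₃ := ofLinear_of_ne D (p := 3) (by simp)
  refine cochain_ext (totalD_zero _) (fun x => ?_) (fun x y => ?_) (fun x y z => ?_) fun p hp => ?_
  · rw [totalD_one (ofLinear_of_ne D (by simp))]
    simp [hD.map_d]
  · rw [totalD_two, h₂]
    simp [hD.map_mul]
  · rw [totalD_three, h₂, h₃]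
    simp
  · obtain ⟨p, rfl⟩ : ∃ q, p = q + 1 := ⟨p - 1, by omega⟩
    rw [totalD_succ, ofLinear_of_ne D (by omega), ofLinear_of_ne D (by omega)]
    simp

/-- The class of a derivation that vanishes on boundaries. -/
def IsDerCocycle.cls {n : ℕ} {D : X.carrier →ₗ[K] M} (hD : IsDerCocycle ρ n D) :
    Cohomology X ρ M (n + 1) :=
  Submodule.Quotient.mk ⟨ofLinear D, hD.ofLinear_mem_cocycles⟩

theorem IsDerCocycle.cls_eq_mk_iff {n : ℕ} {D : X.carrier →ₗ[K] M} (hD : IsDerCocycle ρ n D)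
    (c : cocycles X ρ M (n + 1)) :
    hD.cls = Submodule.Quotient.mk c ↔ ∃ e ∈ cochains X M n, totalD X ρ M e = ofLinear D - c.1 := by
  rw [IsDerCocycle.cls, Submodule.Quotient.eq]
  rfl

theorem IsDerCocycle.cls_eq_iff {n : ℕ} {D D' : X.carrier →ₗ[K] M} (hD : IsDerCocycle ρ n D)
    (hD' : IsDerCocycle ρ n D') :
    hD.cls = hD'.cls ↔ ∃ e ∈ cochains X M n, totalD X ρ M e = ofLinear (D - D') := by
  rw [map_sub]
  exact hD.cls_eq_mk_iff ⟨_, hD'.ofLinear_mem_cocycles⟩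

/-- If two derivations differ by the composite of a derivation with the differential, then their
classes agree. -/
theorem IsDerCocycle.cls_eq {n : ℕ} {D D' t : X.carrier →ₗ[K] M} (hD : IsDerCocycle ρ (n + 1) D)
    (hD' : IsDerCocycle ρ (n + 1) D') (ht : IsDerivation ρ n t) (h : ∀ x, D x - D' x = t (X.d x)) :
    hD.cls = hD'.cls := by
  rw [cls_eq_iff]
  refine ⟨ofLinear (-t), ofLinear_mem_cochains fun k hk x hx => ?_, ?_⟩
  · rw [LinearMap.neg_apply, ht.vanish k hk x hx, neg_zero]
  have h₂ (D : X.carrier →ₗ[K] M) := ofLinear_of_ne D (p := 2) (by simp)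
  have h₃ (D : X.carrier →ₗ[K] M) := ofLinear_of_ne D (p := 3) (by simp)
  refine cochain_ext ?_ (fun x => ?_) (fun x y => ?_) (fun x y z => ?_) fun p hp => ?_
  · rw [totalD_zero, ofLinear_of_ne _ (by simp)]
  · rw [totalD_one (ofLinear_of_ne _ (by simp))]
    simp [h]
  · rw [totalD_two, h₂, h₂]
    simp [ht.map_mul]
  · rw [totalD_three, h₂, h₃, h₃]
    simp
  · obtain ⟨p, rfl⟩ : ∃ q, p = q + 1 := ⟨p - 1, by omega⟩
    rw [totalD_succ, ofLinear_of_ne _ (by omega), ofLinear_of_ne _ (by omega),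
      ofLinear_of_ne _ (by omega)]
    simp

section Cofibrant

variable [SMulCommClass A Aᵐᵒᵖ M]

/-- The bilinear part of a total cochain can be removed if it is a Hochschild cocycle: the linear
part then becomes a derivation. -/
theorem exists_derivation (hX : X.IsCofibrant) (hρ : IsAugmentation ρ) {k : ℕ}
    {c₁ : X.carrier →ₗ[K] M} {c₂ : X.carrier →ₗ[K] X.carrier →ₗ[K] M}
    (hc₁ : ∀ j, j ≠ k + 1 → ∀ x ∈ X.deg j, c₁ x = 0)
    (hc₂ : ∀ i j x y, x ∈ X.deg i → y ∈ X.deg j → i + j ≠ k → c₂ x y = 0)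
    (h₁ : ∀ x y, c₁ (x * y) = ρ x • c₁ y + op (ρ y) • c₁ x + (c₂ (X.d x) y + c₂ (X.sgn x) (X.d y)))
    (h₂ : ∀ x y z, ρ x • c₂ y z + c₂ x (y * z) = c₂ (x * y) z + op (ρ z) • c₂ x y) :
    ∃ e : X.carrier →ₗ[K] M, (∀ j, j ≠ k → ∀ x ∈ X.deg j, e x = 0) ∧
      (∀ x y, e (x * y) = ρ x • e y + op (ρ y) • e x + c₂ x y) ∧
      IsDerivation ρ (k + 1) (c₁ - e ∘ₗ X.d) := by
  obtain ⟨e, he, hm⟩ := exists_primitive_two hX hρ k c₂ hc₂ h₂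
  refine ⟨e, he, hm, fun j hj x hx => ?_, fun x y => ?_⟩
  · have : e (X.d x) = 0 := by
      cases j with
      | zero => rw [X.d_deg_zero x hx, map_zero]
      | succ j => exact he j (by omega) _ (X.d_mem j x hx)
    simp [hc₁ j hj x hx, this]
  · simp only [LinearMap.sub_apply, LinearMap.comp_apply, X.d_mul, h₁, map_add, hm, hρ.map_d,
      hρ.map_sgn, op_zero, zero_smul, smul_sub]
    abel

/-- Every class of degree two is the class of a derivation: the component of tensor degree two is a
Hochschild cocycle, hence the coboundary of a cochain that can be subtracted. -/
theorem exists_cls_eq_two (hX : X.IsCofibrant) (hρ : IsAugmentation ρ) (x : Cohomology X ρ M 2) :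
    ∃ (D : X.carrier →ₗ[K] M) (hD : IsDerCocycle ρ 1 D), hD.cls = x := by
  obtain ⟨⟨c, hc, hcd⟩, rfl⟩ := Submodule.Quotient.mk_surjective _ x
  have hd (p : ℕ) : totalD X ρ M c p = 0 := congrFun (LinearMap.mem_ker.1 hcd) p
  have h0 := cochains_apply_zero hc
  have h3 := cochains_apply_eq_zero (p := 3) (by simp) hc
  have hd₁ (x : X.carrier) : c 1 ![X.d x] = 0 := by
    rw [← neg_eq_zero, ← totalD_one (ρ := ρ) h0, hd, zero_apply]
  obtain ⟨e, he, hm, hD⟩ := exists_derivation (c₁ := curryOne (c 1)) (c₂ := curryTwo (c 2)) hX hρ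
    (fun j hj x hx => by rw [curryOne_apply]; exact cochains_apply_one hc hj hx)
    (fun i j x y hx hy hij => by rw [curryTwo_apply]; exact cochains_apply_two hc hij hx hy)
    (fun x y => by
      have := totalD_two (ρ := ρ) c x y
      rw [hd, zero_apply] at this
      simp only [curryOne_apply, curryTwo_apply]
      rw [← sub_eq_zero, ← neg_eq_zero, this]
      abel)
    (fun x y z => by
      have := totalD_three (ρ := ρ) c x y z
      rw [hd, h3] at this
      simp only [zero_apply, add_zero, sub_zero] at this
      simp only [curryTwo_apply]
      rw [← sub_eq_zero, this]
      abel)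
  refine ⟨_, ⟨hD, fun x => by simp [hd₁, X.d_d]⟩, ?_⟩
  rw [IsDerCocycle.cls_eq_mk_iff]
  refine ⟨ofLinear e, ofLinear_mem_cochains he, ?_⟩
  have h₀' (D : X.carrier →ₗ[K] M) := ofLinear_of_ne D (p := 0) (by simp)
  have h₂' (D : X.carrier →ₗ[K] M) := ofLinear_of_ne D (p := 2) (by simp)
  have h₃' (D : X.carrier →ₗ[K] M) := ofLinear_of_ne D (p := 3) (by simp)
  refine cochain_ext ?_ (fun x => ?_) (fun x y => ?_) (fun x y z => ?_) fun p hp => ?_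
  · simp [totalD_zero, h₀', h0]
  · rw [totalD_one (h₀' _)]
    simp
  · rw [totalD_two, h₂']
    simp [hm, h₂']
    abel
  · rw [totalD_three, h₂', h₃']
    simp [h₃', h3]
  · obtain ⟨p, rfl⟩ : ∃ q, p = q + 1 := ⟨p - 1, by omega⟩
    have hp := cochains_apply_eq_zero (p := p + 1) (by omega) hc
    rw [totalD_succ, ofLinear_of_ne _ (by omega), ofLinear_of_ne _ (by omega)]
    simp [hp, ofLinear_of_ne _ (show p + 1 ≠ 1 by omega)]

/-- Every class of degree three is the class of a derivation: the component of tensor degree three,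
which is concentrated in degree zero, is removed first, and then the one of tensor degree two. -/
theorem exists_cls_eq_three (hX : X.IsCofibrant) (hρ : IsAugmentation ρ) (x : Cohomology X ρ M 3) :
    ∃ (D : X.carrier →ₗ[K] M) (hD : IsDerCocycle ρ 2 D), hD.cls = x := by
  obtain ⟨⟨c, hc, hcd⟩, rfl⟩ := Submodule.Quotient.mk_surjective _ x
  have hd (p : ℕ) : totalD X ρ M c p = 0 := congrFun (LinearMap.mem_ker.1 hcd) p
  have h0 := cochains_apply_zero hc
  have h4 := cochains_apply_eq_zero (p := 4) (by simp) hc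
  have hd₁ (x : X.carrier) : c 1 ![X.d x] = 0 := by
    rw [← neg_eq_zero, ← totalD_one (ρ := ρ) h0, hd, zero_apply]
  have hd₃ (x y z : X.carrier) := totalD_three (ρ := ρ) c x y z
  simp only [hd, zero_apply] at hd₃
  obtain ⟨b, hb, hbc⟩ := exists_primitive_three (c := curryThree (c 3)) hX hρ
    (fun x y z => by simpa using cochains_apply_three_projZero hc x y z)
    (fun x y z w => by
      simp only [curryThree_apply]
      rw [← totalD_four h4, hd, zero_apply])
  simp only [curryThree_apply] at hbc
  -- The bilinear part after the trilinear part has been removed.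
  let c₂ : X.carrier →ₗ[K] X.carrier →ₗ[K] M :=
    curryTwo (c 2) - (b ∘ₗ X.d + b.compl₁₂ X.sgn X.d)
  have hc₂ (x y : X.carrier) : c₂ x y = c 2 ![x, y] - (b (X.d x) y + b (X.sgn x) (X.d y)) := by
    simp [c₂]
  obtain ⟨e, he, hm, hD⟩ := exists_derivation (c₁ := curryOne (c 1)) (c₂ := c₂) hX hρ
    (fun j hj x hx => by rw [curryOne_apply]; exact cochains_apply_one hc hj hx)
    (fun i j x y hx hy hij => by
      have h₁ : b (X.d x) y = 0 := by
        cases i with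
        | zero => simp [X.d_deg_zero x hx]
        | succ i => exact hb i j _ _ (X.d_mem i x hx) hy (by omega)
      have h₂ : b (X.sgn x) (X.d y) = 0 := by
        cases j with
        | zero => simp [X.d_deg_zero y hy]
        | succ j => exact hb i j _ _ (X.sgn_mem hx) (X.d_mem j y hy) (by omega)
      rw [hc₂, cochains_apply_two hc hij hx hy, h₁, h₂, add_zero, sub_zero])
    (fun x y => by
      have := totalD_two (ρ := ρ) c x y
      rw [hd, zero_apply] at this
      simp only [curryOne_apply, hc₂, X.d_d, X.d_sgn, X.sgn_sgn, map_zero, map_neg,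
        LinearMap.neg_apply, LinearMap.zero_apply]
      refine sub_eq_zero.1 (neg_eq_zero.1 (Eq.trans ?_ this.symm))
      abel)
    (fun x y z => by
      have h := hd₃ x y z
      rw [← hbc, ← hbc, ← hbc] at h
      simp only [hρ.map_d, hρ.map_sgn, op_zero, zero_smul] at h
      simp only [hc₂, X.d_mul, X.sgn_mul, map_add, LinearMap.add_apply, smul_sub, smul_add]
      rw [← sub_eq_zero, h]
      abel)
  refine ⟨_, ⟨hD, fun x => by simp [hd₁, X.d_d]⟩, ?_⟩
  rw [IsDerCocycle.cls_eq_mk_iff]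
  refine ⟨ofLinear e - ofBilinear b, Submodule.sub_mem _ (ofLinear_mem_cochains he)
    (ofBilinear_mem_cochains hb), ?_⟩
  have h₀ (D : X.carrier →ₗ[K] M) := ofLinear_of_ne D (p := 0) (by simp)
  have h₂ (D : X.carrier →ₗ[K] M) := ofLinear_of_ne D (p := 2) (by simp)
  have h₃ (D : X.carrier →ₗ[K] M) := ofLinear_of_ne D (p := 3) (by simp)
  have h₀' (b : X.carrier →ₗ[K] X.carrier →ₗ[K] M) := ofBilinear_of_ne b (p := 0) (by simp)
  have h₁' (b : X.carrier →ₗ[K] X.carrier →ₗ[K] M) := ofBilinear_of_ne b (p := 1) (by simp)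
  have h₃' (b : X.carrier →ₗ[K] X.carrier →ₗ[K] M) := ofBilinear_of_ne b (p := 3) (by simp)
  refine cochain_ext ?_ (fun x => ?_) (fun x y => ?_) (fun x y z => ?_) fun p hp => ?_
  · simp [totalD_zero, h₀, h0]
  · rw [totalD_one (by simp [h₀, h₀'])]
    simp [h₁']
  · rw [totalD_two]
    simp [hm, h₂, h₁', hc₂]
    abel
  · rw [totalD_three]
    simp [h₃, h₂, h₃', ← hbc]
    abel
  · obtain ⟨p, rfl⟩ : ∃ q, p = q + 1 := ⟨p - 1, by omega⟩
    have hp := cochains_apply_eq_zero (p := p + 1) (by omega) hc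
    rw [totalD_succ]
    simp [hp, ofLinear_of_ne _ (show p + 1 ≠ 1 by omega), ofLinear_of_ne _ (show p ≠ 1 by omega),
      ofBilinear_of_ne _ (show p + 1 ≠ 2 by omega), ofBilinear_of_ne _ (show p ≠ 2 by omega)]

/-- A cochain that bounds the difference of two derivations of degree one is itself a derivation. -/
theorem IsDerCocycle.exists_of_cls_eq_two {D D' : X.carrier →ₗ[K] M} (hD : IsDerCocycle ρ 1 D)
    (hD' : IsDerCocycle ρ 1 D') (h : hD.cls = hD'.cls) :
    ∃ t : X.carrier →ₗ[K] M, IsDerivation ρ 0 t ∧ ∀ x, D x - D' x = t (X.d x) := by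
  obtain ⟨e, he, hed⟩ := (hD.cls_eq_iff hD').1 h
  have h0 := cochains_apply_zero he
  have h2 := cochains_apply_eq_zero (p := 2) (by simp) he
  refine ⟨-curryOne (e 1), ⟨fun j hj x hx => ?_, fun x y => ?_⟩, fun x => ?_⟩
  · simp [cochains_apply_one he hj hx]
  · have := totalD_two (ρ := ρ) e x y
    rw [hed, ofLinear_of_ne _ (by simp), h2] at this
    simp only [zero_apply, add_zero] at this
    simp only [LinearMap.neg_apply, curryOne_apply, smul_neg]
    rw [← sub_eq_zero, this]
    abel
  · have := totalD_one (ρ := ρ) h0 x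
    rw [hed] at this
    simpa using this

/-- A cochain that bounds the difference of two derivations of degree two becomes a derivation once
its bilinear part has been removed. -/
theorem IsDerCocycle.exists_of_cls_eq_three (hX : X.IsCofibrant) (hρ : IsAugmentation ρ)
    {D D' : X.carrier →ₗ[K] M} (hD : IsDerCocycle ρ 2 D)
    (hD' : IsDerCocycle ρ 2 D') (h : hD.cls = hD'.cls) :
    ∃ t : X.carrier →ₗ[K] M, IsDerivation ρ 1 t ∧ ∀ x, D x - D' x = t (X.d x) := by
  obtain ⟨e, he, hed⟩ := (hD.cls_eq_iff hD').1 h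
  have h0 := cochains_apply_zero he
  have h3 := cochains_apply_eq_zero (p := 3) (by simp) he
  obtain ⟨s, hs, hm, ht⟩ := exists_derivation (c₁ := curryOne (e 1)) (c₂ := curryTwo (e 2)) hX hρ
    (fun j hj x hx => by rw [curryOne_apply]; exact cochains_apply_one he hj hx)
    (fun i j x y hx hy hij => by rw [curryTwo_apply]; exact cochains_apply_two he hij hx hy)
    (fun x y => by
      have := totalD_two (ρ := ρ) e x y
      rw [hed, ofLinear_of_ne _ (by simp), zero_apply] at this
      simp only [curryOne_apply, curryTwo_apply]
      rw [← sub_eq_zero, ← neg_eq_zero, this]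
      abel)
    (fun x y z => by
      have := totalD_three (ρ := ρ) e x y z
      rw [hed, ofLinear_of_ne _ (by simp), h3] at this
      simp only [zero_apply, add_zero, sub_zero] at this
      simp only [curryTwo_apply]
      rw [← sub_eq_zero, this]
      abel)
  refine ⟨-(curryOne (e 1) - s ∘ₗ X.d), ⟨fun j hj x hx => ?_, fun x y => ?_⟩, fun x => ?_⟩
  · rw [LinearMap.neg_apply, ht.vanish j hj x hx, neg_zero]
  · simp only [LinearMap.neg_apply, ht.map_mul, smul_neg]
    abel
  · have := totalD_one (ρ := ρ) h0 x
    rw [hed] at this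
    simpa [X.d_d] using this

end Cofibrant

theorem IsDerCocycle.add {n : ℕ} {D D' : X.carrier →ₗ[K] M} (hD : IsDerCocycle ρ n D)
    (hD' : IsDerCocycle ρ n D') : IsDerCocycle ρ n (D + D') where
  vanish k hk x hx := by simp [hD.vanish k hk x hx, hD'.vanish k hk x hx]
  map_mul x y := by simp only [LinearMap.add_apply, hD.map_mul, hD'.map_mul, smul_add]; abel
  map_d x := by simp [hD.map_d, hD'.map_d]

theorem IsDerCocycle.cls_add {n : ℕ} {D D' : X.carrier →ₗ[K] M} (hD : IsDerCocycle ρ n D)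
    (hD' : IsDerCocycle ρ n D') : (hD.add hD').cls = hD.cls + hD'.cls := by
  rw [cls, cls, cls, ← Submodule.Quotient.mk_add]
  congr 1
  exact Subtype.ext (map_add ofLinear D D')

section Functoriality

variable {B : Type u} [Ring B] [Algebra K B] {N : Type u} [AddCommGroup N] [Module K N] [Module B N]
  [Module Bᵐᵒᵖ N] [IsScalarTower K B N] [IsScalarTower K Bᵐᵒᵖ N]

theorem IsDerCocycle.push {φ : A →ₐ[K] B} (f : BimoduleHom φ M N) {n : ℕ} {D : X.carrier →ₗ[K] M}
    (hD : IsDerCocycle ρ n D) : IsDerCocycle (φ.comp ρ) n (f.toLinearMap ∘ₗ D) where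
  vanish k hk x hx := by simp [hD.vanish k hk x hx]
  map_mul x y := by simp [hD.map_mul, f.map_smul_left, f.map_smul_right]
  map_d x := by simp [hD.map_d]

theorem push_cls {φ : A →ₐ[K] B} (f : BimoduleHom φ M N) {n : ℕ} {D : X.carrier →ₗ[K] M}
    (hD : IsDerCocycle ρ n D) : push X ρ f (n + 1) hD.cls = (hD.push f).cls := by
  refine congrArg Submodule.Quotient.mk (Subtype.ext (funext fun p => ?_))
  change f.toLinearMap.compMultilinearMap (ofLinear D p) = ofLinear (f.toLinearMap ∘ₗ D) p
  by_cases hp : p = 1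
  · subst hp
    ext x
    rw [eq_vec_one x]
    simp
  · rw [ofLinear_of_ne _ hp, ofLinear_of_ne _ hp]
    ext x
    simp

theorem IsDerCocycle.pull {Y : ChainAlgebra K} (g : X.Hom Y) {ρ : Y.carrier →ₐ[K] B}
    {σ : X.carrier →ₐ[K] B} (hg : ρ.comp g.toAlgHom = σ) {n : ℕ} {D : Y.carrier →ₗ[K] N}
    (hD : IsDerCocycle ρ n D) : IsDerCocycle σ n (D ∘ₗ g.toAlgHom.toLinearMap) where
  vanish k hk x hx := by simp [hD.vanish k hk _ (g.map_deg k x hx)]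
  map_mul x y := by simp [hD.map_mul, ← hg]
  map_d x := by simp [g.map_d, hD.map_d]

theorem pull_cls {Y : ChainAlgebra K} (g : X.Hom Y) {ρ : Y.carrier →ₐ[K] B}
    {σ : X.carrier →ₐ[K] B} (hg : ρ.comp g.toAlgHom = σ) {n : ℕ} {D : Y.carrier →ₗ[K] N}
    (hD : IsDerCocycle ρ n D) : Hochschild.pull g ρ hg N (n + 1) hD.cls = (hD.pull g hg).cls := by
  refine congrArg Submodule.Quotient.mk (Subtype.ext (funext fun p => ?_))
  change (ofLinear D p).compLinearMap _ = ofLinear (D ∘ₗ g.toAlgHom.toLinearMap) p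
  by_cases hp : p = 1
  · subst hp
    ext x
    rw [eq_vec_one x, ofLinear_one, ofLinear_one, curryOne_symm_apply]
    have h : (fun i => g.toAlgHom (![x 0] i)) = ![g.toAlgHom (x 0)] := eq_vec_one _
    change curryOne.symm D (fun i => g.toAlgHom (![x 0] i)) = D (g.toAlgHom (x 0))
    rw [h, curryOne_symm_apply]
  · rw [ofLinear_of_ne _ hp, ofLinear_of_ne _ hp]
    rfl

end Functoriality

end Hochschild

/-! ### Cofibrant replacements -/

namespace CofibrantReplacement

variable {K : Type u} [CommRing K] {A : Type u} [Ring A] [Algebra K A]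

theorem isAugmentation (Q : CofibrantReplacement K A) : Hochschild.IsAugmentation Q.aug where
  killsPos := Q.π.killsPos
  map_d := Q.π.map_d

theorem aug_surjective (Q : CofibrantReplacement K A) : Function.Surjective Q.aug := by
  intro a
  obtain ⟨x, -, -, y, -, h⟩ := (Q.isWeakEquiv 0).2 a (Submodule.mem_top (R := K) (M := A)) rfl
  exact ⟨x, (sub_eq_zero.1 h.symm)⟩

/-- A cofibrant replacement is acyclic in positive degrees. -/
theorem exists_d_eq (Q : CofibrantReplacement K A) {n : ℕ} {x : Q.P.carrier}
    (hx : x ∈ Q.P.deg (n + 1)) (hd : Q.P.d x = 0) : ∃ y ∈ Q.P.deg (n + 2), Q.P.d y = x :=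
  (Q.isWeakEquiv (n + 1)).1 x hx hd
    ⟨0, Submodule.zero_mem _, (map_zero _).trans (Q.π.killsPos n x hx).symm⟩

/-- The kernel of the augmentation in degree zero consists of boundaries. -/
theorem exists_d_eq_of_aug_eq_zero (Q : CofibrantReplacement K A) {x : Q.P.carrier}
    (hx : x ∈ Q.P.deg 0) (h : Q.aug x = 0) : ∃ y ∈ Q.P.deg 1, Q.P.d y = x :=
  (Q.isWeakEquiv 0).1 x hx (Q.P.d_deg_zero x hx)
    ⟨0, Submodule.zero_mem _, (map_zero _).trans h.symm⟩

/-- The identity of a cofibrant replacement. -/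
def idLift (Q : CofibrantReplacement K A) : Q.Lift Q (AlgHom.id K A) :=
  ⟨ChainAlgebra.Hom.id Q.P, rfl⟩

end CofibrantReplacement

theorem ChainAlgebra.proj_d {K : Type u} [CommRing K] (X : ChainAlgebra K) (n : ℕ) (x : X.carrier) :
    X.proj n (X.d x) = X.d (X.proj (n + 1) x) := by
  induction x using X.homogeneous_induction with
  | add x y hx hy => simp only [map_add, hx, hy]
  | homogeneous m x hx =>
    cases m with
    | zero => rw [X.d_deg_zero x hx, map_zero, X.proj_of_mem_ne hx (by omega), map_zero]
    | succ m =>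
      by_cases h : m = n
      · subst h
        rw [X.proj_of_mem (X.d_mem m x hx), X.proj_of_mem hx]
      · rw [X.proj_of_mem_ne (X.d_mem m x hx) h, X.proj_of_mem_ne hx (by omega), map_zero]

/-- A linear map that vanishes outside degree `n` only depends on the part of degree `n`. -/
theorem ChainAlgebra.apply_proj {K : Type u} [CommRing K] (X : ChainAlgebra K) {M : Type u}
    [AddCommGroup M] [Module K M] {n : ℕ} {D : X.carrier →ₗ[K] M}
    (hD : ∀ k, k ≠ n → ∀ x ∈ X.deg k, D x = 0) (x : X.carrier) : D (X.proj n x) = D x := by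
  induction x using X.homogeneous_induction with
  | add x y hx hy => simp only [map_add, hx, hy]
  | homogeneous m x hx =>
    by_cases h : m = n
    · rw [X.proj_of_mem (h ▸ hx)]
    · rw [X.proj_of_mem_ne hx h, hD m h x hx, map_zero]

theorem LinearMap.exists_lift_of_injective {K V M E : Type u} [CommRing K] [AddCommGroup V]
    [Module K V] [AddCommGroup M] [Module K M] [AddCommGroup E] [Module K E] {ι : M →ₗ[K] E}
    (hι : Function.Injective ι) (g : V →ₗ[K] E) (h : ∀ x, ∃ m, ι m = g x) :
    ∃ D : V →ₗ[K] M, ∀ x, ι (D x) = g x := by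
  choose D hD using h
  exact ⟨{ toFun := D
           map_add' := fun x y => hι (by simp [hD])
           map_smul' := fun c x => hι (by simp [hD]) }, hD⟩

theorem Hochschild.IsDerivation.map_one {K : Type u} [CommRing K] {X : ChainAlgebra K} {A : Type u}
    [Ring A] [Algebra K A] {M : Type u} [AddCommGroup M] [Module K M] [Module A M]
    [Module Aᵐᵒᵖ M] {ρ : X.carrier →ₐ[K] A} {n : ℕ} {t : X.carrier →ₗ[K] M}
    (ht : IsDerivation ρ n t) : t 1 = 0 := by
  simpa using ht.map_mul 1 1

section Shukla

variable {K : Type u} [CommRing K] {A : Type u} [Ring A] [Algebra K A]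
  {Q : CofibrantReplacement K A} {M : Type u} [AddCommGroup M] [Module K M] [Module A M]
  [Module Aᵐᵒᵖ M] [IsScalarTower K A M] [IsScalarTower K Aᵐᵒᵖ M]

theorem Shukla.corresponds_id_iff {n : ℕ} {x y : Shukla Q M n} :
    Shukla.Corresponds Q.idLift (BimoduleHom.id K A M) n x y ↔ x = y := by
  obtain ⟨a, rfl⟩ := Submodule.Quotient.mk_surjective _ x
  obtain ⟨b, rfl⟩ := Submodule.Quotient.mk_surjective _ y
  exact Iff.rfl

theorem Shukla.corresponds_scalar_iff (c : K) {n : ℕ} {x y : Shukla Q M n} :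
    Shukla.Corresponds Q.idLift (BimoduleHom.scalar A M c) n x y ↔ y = c • x := by
  obtain ⟨a, rfl⟩ := Submodule.Quotient.mk_surjective _ x
  obtain ⟨b, rfl⟩ := Submodule.Quotient.mk_surjective _ y
  exact eq_comm

end Shukla

/-- A relation between `S` and a type `E` of objects, which is total on both sides and compatible
with a relation `r` on `E` and with equality on `S`, gives a bijection between `S` and the
components of `E`. -/
theorem exists_equiv_quot {S : Type u} {E : Type (u + 1)} (r : E → E → Prop) (R : S → E → Prop)
    (total : ∀ X, ∃ x, R x X) (surj : ∀ x, ∃ X, R x X)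
    (wd : ∀ x y X Y, R x X → R y Y → r X Y → x = y) (refl : ∀ X, r X X)
    (inj : ∀ x X Y, R x X → R x Y → Quot.mk r X = Quot.mk r Y) :
    ∃ Θ : S ≃ Quot r, ∀ x X, Θ x = Quot.mk r X ↔ R x X := by
  choose F hF using surj
  choose G hG using total
  let cl : Quot r → S := Quot.lift G fun X Y h => wd _ _ _ _ (hG X) (hG Y) h
  let Θ : S ≃ Quot r :=
    { toFun := fun x => Quot.mk r (F x)
      invFun := cl
      left_inv := fun x => wd _ _ _ _ (hG _) (hF x) (refl _)
      right_inv := Quot.ind fun X => inj _ _ _ (hF _) (hG X) }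
  refine ⟨Θ, fun x X => ⟨fun h => ?_, fun h => inj _ _ _ (hF x) h⟩⟩
  have : G X = x := by
    have := congrArg cl h
    exact this.symm.trans (Θ.symm_apply_apply x)
  exact this ▸ hG X

/-! ### Pushouts of abelian extensions -/

/-- The data for a pushout of an extension of `A`: a surjection `q : R → A` and a submodule of
`R × M` that is the graph of a homomorphism of `R`-bimodules from the kernel of `q` to `M`. -/
structure ExtensionGraph {K R A : Type u} [CommRing K] [Ring R] [Algebra K R] [Ring A] [Algebra K A]
    (q : R →ₐ[K] A) (M : Type u) [AddCommGroup M] [Module K M] [Module A M] [Module Aᵐᵒᵖ M] where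
  W : Submodule K (R × M)
  surjective : Function.Surjective q
  mul_left : ∀ s a, a ∈ W → (s * a.1, q s • a.2) ∈ W
  mul_right : ∀ s a, a ∈ W → (a.1 * s, op (q s) • a.2) ∈ W
  injective : ∀ m, (0, m) ∈ W → m = 0
  ker : ∀ r, q r = 0 ↔ ∃ m, (r, m) ∈ W

namespace ExtensionGraph

variable {K R A : Type u} [CommRing K] [Ring R] [Algebra K R] [Ring A] [Algebra K A]
  {q : R →ₐ[K] A} {M : Type u} [AddCommGroup M] [Module K M] [Module A M] [Module Aᵐᵒᵖ M]
  [SMulCommClass A Aᵐᵒᵖ M] [IsScalarTower K A M] [IsScalarTower K Aᵐᵒᵖ M]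

/-- The square-zero extension of `R` by `M`. -/
abbrev Split (_ : ExtensionGraph q M) : Type u :=
  (TwoCocycle.ofAlgHom (K := K) (J := M) q q).Ext

variable (G : ExtensionGraph q M)

theorem map_eq_zero {r : R} {m : M} (h : (r, m) ∈ G.W) : q r = 0 := (G.ker r).2 ⟨m, h⟩

/-- The ideal that identifies the elements of the kernel of `q` with their images in `M`. -/
def ideal : Ideal G.Split where
  carrier := {a | (a.1, -a.2) ∈ G.W}
  add_mem' {a b} ha hb := by
    have := G.W.add_mem ha hb
    change (a.1 + b.1, -(a.2 + b.2)) ∈ G.W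
    rwa [neg_add]
  zero_mem' := by
    change ((0 : R), -(0 : M)) ∈ G.W
    rw [neg_zero]
    exact G.W.zero_mem
  smul_mem' s a ha := by
    have := G.mul_left s.1 _ ha
    have h := G.map_eq_zero ha
    change (s.1 * a.1, -(q s.1 • a.2 + op (q a.1) • s.2 + 0)) ∈ G.W
    simpa [h] using this

theorem mem_ideal {a : G.Split} : a ∈ G.ideal ↔ (a.1, -a.2) ∈ G.W := Iff.rfl

instance : G.ideal.IsTwoSided where
  mul_mem_of_left {a} s ha := by
    have := G.mul_right s.1 _ ha
    have h := G.map_eq_zero ha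
    change (a.1 * s.1, -(q a.1 • s.2 + op (q s.1) • a.2 + 0)) ∈ G.W
    simpa [h] using this

/-- The inclusion of `R` into the split extension. -/
def inl : R →ₐ[K] G.Split :=
  AlgHom.ofLinearMap (LinearMap.inl K R M : R →ₗ[K] G.Split)
    (TwoCocycle.Ext.ext rfl (neg_zero (G := M)).symm)
    (fun x y => TwoCocycle.Ext.ext rfl (by
      change (0 : M) = q x • 0 + op (q y) • 0 + 0
      simp))

/-- The inclusion of `M` into the split extension. -/
def inr : M →ₗ[K] G.Split := (LinearMap.inr K R M : M →ₗ[K] G.Split)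

@[simp] theorem inr_fst (m : M) : (G.inr m).1 = 0 := rfl

@[simp] theorem inr_snd (m : M) : (G.inr m).2 = m := rfl

/-- The pushout of `R → A` along the homomorphism from the kernel to `M`. -/
def pushout : AbelianExtension K A M where
  E := G.Split ⧸ G.ideal
  ι := (Ideal.Quotient.mkₐ K G.ideal).toLinearMap ∘ₗ G.inr
  π := Ideal.Quotient.liftₐ G.ideal (q.comp (TwoCocycle.Ext.fst _))
    fun a ha => G.map_eq_zero (G.mem_ideal.1 ha)
  ι_injective := by
    refine (injective_iff_map_eq_zero _).2 fun m hm => ?_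
    have h := G.mem_ideal.1 (Ideal.Quotient.eq_zero_iff_mem.1 hm)
    exact neg_eq_zero.1 (G.injective _ h)
  exact e := by
    obtain ⟨a, rfl⟩ := Ideal.Quotient.mk_surjective e
    constructor
    · intro h
      obtain ⟨m, hm⟩ := (G.ker a.1).1 h
      refine ⟨a.2 + m, Ideal.Quotient.eq.2 (G.mem_ideal.2 ?_)⟩
      change ((0 : R) - a.1, -(a.2 + m - a.2)) ∈ G.W
      simpa using G.W.neg_mem hm
    · rintro ⟨m, hm⟩
      rw [← hm]
      exact map_zero q
  π_surjective a := by
    obtain ⟨r, rfl⟩ := G.surjective a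
    exact ⟨Ideal.Quotient.mk _ (G.inl r), rfl⟩
  mul_ι_ι m m' := by
    refine congrArg (Ideal.Quotient.mk G.ideal)
      (a₁ := G.inr m * G.inr m') (a₂ := 0) ?_
    ext <;> simp [TwoCocycle.ofAlgHom]
  smul_left e m := by
    obtain ⟨a, rfl⟩ := Ideal.Quotient.mk_surjective e
    refine congrArg (Ideal.Quotient.mk G.ideal)
      (a₁ := G.inr (q a.1 • m)) (a₂ := a * G.inr m) ?_
    ext <;> simp [TwoCocycle.ofAlgHom]
  smul_right e m := by
    obtain ⟨a, rfl⟩ := Ideal.Quotient.mk_surjective e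
    refine congrArg (Ideal.Quotient.mk G.ideal)
      (a₁ := G.inr (op (q a.1) • m)) (a₂ := G.inr m * a) ?_
    ext <;> simp [TwoCocycle.ofAlgHom]

/-- The homomorphism from `R` to the pushout. -/
def toPushout : R →ₐ[K] G.pushout.E := (Ideal.Quotient.mkₐ K G.ideal).comp G.inl

theorem toPushout_eq {r : R} {m : M} (h : (r, m) ∈ G.W) : G.toPushout r = G.pushout.ι m := by
  refine Ideal.Quotient.eq.2 (G.mem_ideal.2 ?_)
  change (r - 0, -(0 - m)) ∈ G.W
  simpa using h

/-- Morphisms out of the pushout. -/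
theorem nonempty_homOver {B N : Type u} [Ring B] [Algebra K B] [AddCommGroup N] [Module K N]
    [Module B N] [Module Bᵐᵒᵖ N] {φ : A →ₐ[K] B} (f : BimoduleHom φ M N)
    (Y : AbelianExtension K B N) (v : R →ₐ[K] Y.E) (hπ : ∀ r, Y.π (v r) = φ (q r))
    (hv : ∀ r m, (r, m) ∈ G.W → v r = Y.ι (f.toLinearMap m)) :
    Nonempty (AbelianExtension.HomOver f G.pushout Y) := by
  let F : G.Split →ₐ[K] Y.E := AlgHom.ofLinearMap
    (v.toLinearMap.coprod (Y.ι ∘ₗ f.toLinearMap) : G.Split →ₗ[K] Y.E)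
    (by
      change v 1 + Y.ι (f.toLinearMap (-0)) = 1
      simp)
    (by
      intro a b
      change v (a.1 * b.1) + Y.ι (f.toLinearMap (q a.1 • b.2 + op (q b.1) • a.2 + 0)) =
        (v a.1 + Y.ι (f.toLinearMap a.2)) * (v b.1 + Y.ι (f.toLinearMap b.2))
      rw [add_zero, map_add, map_add, f.map_smul_left, f.map_smul_right, ← hπ, ← hπ, Y.smul_left,
        Y.smul_right, map_mul, mul_add, add_mul, add_mul, Y.mul_ι_ι]
      abel)
  have hF (a : G.Split) : F a = v a.1 + Y.ι (f.toLinearMap a.2) := rfl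
  refine ⟨⟨Ideal.Quotient.liftₐ G.ideal F fun a ha => ?_, fun m => ?_, fun e => ?_⟩⟩
  · rw [hF, hv _ _ (G.mem_ideal.1 ha)]
    simp
  · change v 0 + Y.ι (f.toLinearMap m) = _
    simp
  · obtain ⟨a, rfl⟩ := Ideal.Quotient.mk_surjective e
    change Y.π (v a.1 + Y.ι (f.toLinearMap a.2)) = φ (q a.1)
    rw [map_add, hπ, (Y.exact _).2 ⟨_, rfl⟩, add_zero]

end ExtensionGraph

/-! ### Abelian extensions and derivations -/

namespace AbelianExtension

open Hochschild

variable {K : Type u} [CommRing K] {A B : Type u} [Ring A] [Algebra K A] [Ring B] [Algebra K B]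
  {M N : Type u} [AddCommGroup M] [Module K M] [Module A M] [Module Aᵐᵒᵖ M]
  [SMulCommClass A Aᵐᵒᵖ M] [IsScalarTower K A M] [IsScalarTower K Aᵐᵒᵖ M]
  [AddCommGroup N] [Module K N] [Module B N] [Module Bᵐᵒᵖ N]
  [SMulCommClass B Bᵐᵒᵖ N] [IsScalarTower K B N] [IsScalarTower K Bᵐᵒᵖ N]

/-- The morphism `u`, `D` of complexes from a cofibrant replacement of `A` to the chain algebra
`M → E` of an extension, in the degrees zero and one. -/
structure Classifies (X : AbelianExtension K A M) (Q : CofibrantReplacement K A)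
    (u : Q.P.carrier →ₐ[K] X.E) (D : Q.P.carrier →ₗ[K] M) : Prop where
  killsPos : Q.P.KillsPos u
  π_map : ∀ x, X.π (u x) = Q.aug x
  ι_map : ∀ x, X.ι (D x) = u (Q.P.d x)

theorem Classifies.isDerCocycle {X : AbelianExtension K A M} {Q : CofibrantReplacement K A}
    {u : Q.P.carrier →ₐ[K] X.E} {D : Q.P.carrier →ₗ[K] M} (h : X.Classifies Q u D) :
    IsDerCocycle Q.aug 1 D where
  vanish k hk x hx := by
    apply X.ι_injective
    rw [h.ι_map, map_zero]
    rcases k with _ | _ | k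
    · rw [Q.P.d_deg_zero x hx, map_zero]
    · exact absurd rfl hk
    · exact h.killsPos k _ (Q.P.d_mem _ x hx)
  map_mul x y := by
    apply X.ι_injective
    rw [h.ι_map, Q.P.d_mul, map_add, map_add, ← h.π_map, ← h.π_map, X.smul_left, X.smul_right,
      h.ι_map, h.ι_map, map_mul, map_mul, h.killsPos.comp_sgn, add_comm]
  map_d x := by
    apply X.ι_injective
    rw [h.ι_map, Q.P.d_d, map_zero, map_zero]

/-- Every extension is classified by a derivation. -/
theorem exists_classifies (X : AbelianExtension K A M) (Q : CofibrantReplacement K A) :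
    ∃ u D, X.Classifies Q u D := by
  obtain ⟨u, hu, hπ⟩ := Q.isCofibrant.exists_algHom_lift_killsPos X.π Q.aug
    Q.isAugmentation.killsPos fun x => X.π_surjective _
  obtain ⟨D, hD⟩ := LinearMap.exists_lift_of_injective X.ι_injective (u.toLinearMap ∘ₗ Q.P.d)
    fun x => (X.exact _).1 (by simp [hπ, Q.isAugmentation.map_d])
  exact ⟨u, D, hu, hπ, hD⟩

/-- The extension `X` represents the class `x`. -/
def Represents (Q : CofibrantReplacement K A) (x : Shukla Q M 2) (X : AbelianExtension K A M) :
    Prop :=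
  ∃ (u : Q.P.carrier →ₐ[K] X.E) (D : Q.P.carrier →ₗ[K] M) (h : X.Classifies Q u D),
    h.isDerCocycle.cls = x

theorem exists_represents (Q : CofibrantReplacement K A) (X : AbelianExtension K A M) :
    ∃ x, Represents Q x X := by
  obtain ⟨u, D, h⟩ := X.exists_classifies Q
  exact ⟨_, u, D, h, rfl⟩

/-- A morphism of extensions over `φ` and `f` identifies the push-forward along `f` of the first
class with the pull-back along `φ` of the second one: the two composites with values in the second
extension differ by a derivation. -/
theorem Represents.corresponds {Q : CofibrantReplacement K A} {Q' : CofibrantReplacement K B}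
    {φ : A →ₐ[K] B} (g : Q.Lift Q' φ) {f : BimoduleHom φ M N} {X : AbelianExtension K A M}
    {Y : AbelianExtension K B N} {x : Shukla Q M 2} {y : Shukla Q' N 2} (hx : Represents Q x X)
    (hy : Represents Q' y Y) (H : HomOver f X Y) : Shukla.Corresponds g f 2 x y := by
  obtain ⟨u, D, h, rfl⟩ := hx
  obtain ⟨v, D', h', rfl⟩ := hy
  let α : Q.P.carrier →ₐ[K] Y.E := H.toAlgHom.comp u
  let β : Q.P.carrier →ₐ[K] Y.E := v.comp g.1.toAlgHom
  have hα (x) : Y.π (α x) = φ (Q.aug x) := by simp [α, H.map_π, h.π_map]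
  have hβ (x) : Y.π (β x) = φ (Q.aug x) := by
    have := DFunLike.congr_fun g.2 x
    simpa [β, h'.π_map] using this
  obtain ⟨t, ht⟩ := LinearMap.exists_lift_of_injective Y.ι_injective (α.toLinearMap - β.toLinearMap)
    fun x => (Y.exact _).1 (by simp [hα, hβ])
  simp only [LinearMap.sub_apply, AlgHom.toLinearMap_apply] at ht
  have htd : IsDerivation (φ.comp Q.aug) 0 t := by
    refine ⟨fun k hk x hx => Y.ι_injective ?_, fun x y => Y.ι_injective ?_⟩
    · obtain ⟨k, rfl⟩ := Nat.exists_eq_succ_of_ne_zero hk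
      rw [ht, map_zero, sub_eq_zero]
      simp [α, β, h.killsPos k x hx, h'.killsPos k _ (g.1.map_deg _ x hx)]
    · rw [map_add, AlgHom.comp_apply, AlgHom.comp_apply, ← hα, ← hβ, Y.smul_left, Y.smul_right, ht,
        ht, ht, map_mul, map_mul, mul_sub, sub_mul]
      abel
  have hp := push_cls f h.isDerCocycle
  have hq := pull_cls g.1 g.2 h'.isDerCocycle
  refine hp.trans (Eq.trans ?_ hq.symm)
  refine IsDerCocycle.cls_eq _ _ htd fun x => Y.ι_injective ?_
  rw [map_sub, ht]
  simp only [LinearMap.comp_apply, AlgHom.toLinearMap_apply, ← H.map_ι, h.ι_map, h'.ι_map, α, β,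
    AlgHom.comp_apply, g.1.map_d]

section Canonical

variable (Q : CofibrantReplacement K A) {D : Q.P.carrier →ₗ[K] M} (hD : IsDerCocycle Q.aug 1 D)

/-- The homomorphism from the kernel of the augmentation to `M` that maps a boundary `d x` in degree
zero to `D x` and vanishes in positive degrees. -/
def derivationGraph : ExtensionGraph Q.aug M where
  W :=
    { carrier := {a | ∃ x, Q.P.projZero a.1 = Q.P.projZero (Q.P.d x) ∧ a.2 = D x}
      add_mem' := by
        rintro a b ⟨x, hx, hx'⟩ ⟨y, hy, hy'⟩
        exact ⟨x + y, by simp [hx, hy], by simp [hx', hy']⟩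
      zero_mem' := ⟨0, by simp, by simp⟩
      smul_mem' := by
        rintro c a ⟨x, hx, hx'⟩
        exact ⟨c • x, by simp [hx], by simp [hx']⟩ }
  surjective := Q.aug_surjective
  mul_left := by
    rintro s a ⟨x, hx, hx'⟩
    have hs := Q.P.projZero_mem s
    refine ⟨Q.P.projZero s * x, ?_, ?_⟩
    · rw [Q.P.d_mul, Q.P.d_deg_zero _ hs, zero_mul, zero_add, map_mul, hx, Q.P.sgn_of_mem hs]
      simp [Q.P.projZero_of_mem hs]
    · rw [hD.map_mul, hD.vanish 0 (by simp) _ hs, smul_zero, add_zero,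
        Q.isAugmentation.killsPos.comp_projZero, hx']
  mul_right := by
    rintro s a ⟨x, hx, hx'⟩
    have hs := Q.P.projZero_mem s
    refine ⟨x * Q.P.projZero s, ?_, ?_⟩
    · rw [Q.P.d_mul, Q.P.d_deg_zero _ hs, mul_zero, add_zero, map_mul, hx, map_mul,
        Q.P.projZero_of_mem hs]
    · rw [hD.map_mul, hD.vanish 0 (by simp) _ hs, smul_zero, zero_add,
        Q.isAugmentation.killsPos.comp_projZero, hx']
  injective := by
    rintro m ⟨x, hx, hx'⟩
    have hx₁ : Q.P.d (Q.P.proj 1 x) = 0 := by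
      rw [← Q.P.proj_d]
      exact hx.symm.trans (map_zero _)
    obtain ⟨y, -, hy⟩ := Q.exists_d_eq (Q.P.proj_mem 1 x) hx₁
    change m = D x at hx'
    rw [hx', ← Q.P.apply_proj hD.vanish, ← hy, hD.map_d]
  ker r := by
    rw [← Q.isAugmentation.killsPos.comp_projZero]
    constructor
    · intro h
      obtain ⟨x, hx, hx'⟩ := Q.exists_d_eq_of_aug_eq_zero (Q.P.projZero_mem r) h
      exact ⟨D x, x, by rw [hx', Q.P.projZero_of_mem (Q.P.projZero_mem r)], rfl⟩
    · rintro ⟨m, x, hx, -⟩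
      change Q.P.projZero r = _ at hx
      rw [hx, Q.isAugmentation.killsPos.comp_projZero, Q.isAugmentation.map_d]

theorem classifies_pushout :
    (derivationGraph Q hD).pushout.Classifies Q (derivationGraph Q hD).toPushout D where
  killsPos n x hx :=
    ((derivationGraph Q hD).toPushout_eq (m := 0)
      ⟨0, by simp [Q.P.projZero_of_pos hx], by simp⟩).trans (map_zero _)
  π_map _ := rfl
  ι_map x := ((derivationGraph Q hD).toPushout_eq ⟨x, rfl, rfl⟩).symm

end Canonical

/-- The pushout along a derivation maps to every extension whose class corresponds to the one of the
derivation. -/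
theorem Represents.nonempty_homOver {Q : CofibrantReplacement K A} {Q' : CofibrantReplacement K B}
    {φ : A →ₐ[K] B} (g : Q.Lift Q' φ) {f : BimoduleHom φ M N} {D : Q.P.carrier →ₗ[K] M}
    (hD : IsDerCocycle Q.aug 1 D) {Y : AbelianExtension K B N} {y : Shukla Q' N 2}
    (hy : Represents Q' y Y) (H : Shukla.Corresponds g f 2 hD.cls y) :
    Nonempty (HomOver f (derivationGraph Q hD).pushout Y) := by
  obtain ⟨v, D', h', rfl⟩ := hy
  have hp := push_cls f hD
  have hq := pull_cls g.1 g.2 h'.isDerCocycle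
  obtain ⟨t, ht, htd⟩ := IsDerCocycle.exists_of_cls_eq_two _ _ (hp.symm.trans (Eq.trans H hq))
  let β : Q.P.carrier →ₐ[K] Y.E := v.comp g.1.toAlgHom
  have hβ (x) : Y.π (β x) = φ (Q.aug x) := by
    have := DFunLike.congr_fun g.2 x
    simpa [β, h'.π_map] using this
  -- The lift of `φ ∘ aug` to `Y.E` is corrected by the derivation `t` to map `d x` to `f (D x)`.
  let v' : Q.P.carrier →ₐ[K] Y.E := AlgHom.ofLinearMap (β.toLinearMap + Y.ι ∘ₗ t)
    (by simp [ht.map_one]) (by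
      intro x y
      simp only [LinearMap.add_apply, AlgHom.toLinearMap_apply, LinearMap.comp_apply, ht.map_mul,
        map_add, map_mul, AlgHom.comp_apply, ← hβ, Y.smul_left, Y.smul_right, mul_add, add_mul,
        Y.mul_ι_ι]
      abel)
  have hv' (x) : v' x = β x + Y.ι (t x) := rfl
  have hk : Q.P.KillsPos v' := fun n x hx => by
    rw [hv', ht.vanish _ n.succ_ne_zero x hx]
    simp [β, h'.killsPos n _ (g.1.map_deg _ x hx)]
  refine (derivationGraph Q hD).nonempty_homOver f Y v' (fun r => ?_) ?_
  · rw [hv', map_add, hβ, (Y.exact _).2 ⟨_, rfl⟩, add_zero]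
  · rintro r m ⟨x, hx, hx'⟩
    change Q.P.projZero r = _ at hx
    change m = D x at hx'
    rw [← hk.comp_projZero, hx, hk.comp_projZero, hv', ← htd, hx']
    simp [β, g.1.map_d, ← h'.ι_map]

/-- Every class is represented by a pushout that maps to all extensions with corresponding
classes. -/
theorem exists_universal (Q : CofibrantReplacement K A) (x : Shukla Q M 2) :
    ∃ X, Represents Q x X ∧ ∀ (B : Type u) [Ring B] [Algebra K B] (N : Type u) [AddCommGroup N]
      [Module K N] [Module B N] [Module Bᵐᵒᵖ N] [SMulCommClass B Bᵐᵒᵖ N] [IsScalarTower K B N]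
      [IsScalarTower K Bᵐᵒᵖ N] (φ : A →ₐ[K] B) (Q' : CofibrantReplacement K B) (g : Q.Lift Q' φ)
      (f : BimoduleHom φ M N) (Y : AbelianExtension K B N) (y : Shukla Q' N 2),
      Represents Q' y Y → Shukla.Corresponds g f 2 x y → Nonempty (HomOver f X Y) := by
  obtain ⟨D, hD, rfl⟩ := exists_cls_eq_two Q.isCofibrant Q.isAugmentation x
  exact ⟨_, ⟨_, D, classifies_pushout Q hD, rfl⟩,
    fun _ _ _ _ _ _ _ _ _ _ _ _ _ g _ _ _ hy H => hy.nonempty_homOver g hD H⟩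

/-- The class of a Baer sum is the sum of the classes. -/
theorem IsBaerSum.represents {Q : CofibrantReplacement K A} {X Y Z : AbelianExtension K A M}
    (h : IsBaerSum X Y Z) {x y : Shukla Q M 2} (hx : Represents Q x X) (hy : Represents Q y Y) :
    Represents Q (x + y) Z := by
  obtain ⟨u, D, hu, rfl⟩ := hx
  obtain ⟨v, D', hv, rfl⟩ := hy
  obtain ⟨h, hπ, hι⟩ := h
  let w : Q.P.carrier →ₐ[K] AlgHom.equalizer (X.π.comp (AlgHom.fst K X.E Y.E))
      (Y.π.comp (AlgHom.snd K X.E Y.E)) :=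
    (u.prod v).codRestrict _ fun x => by
      change X.π (u x) = Y.π (v x)
      rw [hu.π_map, hv.π_map]
  have hw : Z.Classifies Q (h.comp w) (D + D') := by
    refine ⟨fun n x hx => ?_, fun x => ?_, fun x => ?_⟩
    · have : w x = 0 := by
        apply Subtype.ext
        change (u x, v x) = 0
        rw [hu.killsPos n x hx, hv.killsPos n x hx]
        rfl
      rw [AlgHom.comp_apply, this, map_zero]
    · rw [AlgHom.comp_apply, hπ]
      exact hu.π_map x
    · rw [AlgHom.comp_apply, hι (w (Q.P.d x)) (D x) (D' x)]
      · rfl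
      · change (u (Q.P.d x), v (Q.P.d x)) = _
        rw [hu.ι_map, hv.ι_map]
  exact ⟨_, _, hw, IsDerCocycle.cls_add _ _⟩

/-- Baer sums exist: they are pushouts of the fibre product along the addition `M × M → M`. -/
theorem exists_isBaerSum (X Y : AbelianExtension K A M) : ∃ Z, IsBaerSum X Y Z := by
  let R := AlgHom.equalizer (X.π.comp (AlgHom.fst K X.E Y.E)) (Y.π.comp (AlgHom.snd K X.E Y.E))
  have hR (r : R) : Y.π r.1.2 = X.π r.1.1 := r.2.symm
  let q : R →ₐ[K] A := (X.π.comp (AlgHom.fst K X.E Y.E)).comp R.val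
  have hq (r : R) : q r = X.π r.1.1 := rfl
  let G : ExtensionGraph q M :=
    { W :=
        { carrier := {a | ∃ m m', a.1.1 = (X.ι m, Y.ι m') ∧ a.2 = m + m'}
          add_mem' := by
            rintro a b ⟨m, m', h, h'⟩ ⟨n, n', k, k'⟩
            refine ⟨m + n, m' + n', ?_, ?_⟩
            · rw [map_add, map_add, ← Prod.mk_add_mk, ← h, ← k]; rfl
            · rw [Prod.snd_add, h', k']; abel
          zero_mem' := ⟨0, 0, by rw [map_zero, map_zero]; rfl, by simp⟩
          smul_mem' := by
            rintro c a ⟨m, m', h, h'⟩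
            refine ⟨c • m, c • m', ?_, by rw [Prod.smul_snd, h', smul_add]⟩
            rw [map_smul, map_smul, ← Prod.smul_mk, ← h]; rfl }
      surjective := fun a => by
        obtain ⟨e, rfl⟩ := X.π_surjective a
        obtain ⟨e', he'⟩ := Y.π_surjective (X.π e)
        exact ⟨⟨(e, e'), he'.symm⟩, rfl⟩
      mul_left := by
        rintro s a ⟨m, m', h, h'⟩
        refine ⟨q s • m, q s • m', ?_, by rw [h', smul_add]⟩
        change s.1 * a.1.1 = _
        rw [h, hq, X.smul_left, ← hR, Y.smul_left]
        rfl
      mul_right := by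
        rintro s a ⟨m, m', h, h'⟩
        refine ⟨op (q s) • m, op (q s) • m', ?_, by rw [h', smul_add]⟩
        change a.1.1 * s.1 = _
        rw [h, hq, X.smul_right, ← hR, Y.smul_right]
        rfl
      injective := by
        rintro m ⟨n, n', h, h'⟩
        have h₁ : n = 0 := X.ι_injective (by rw [map_zero]; exact (congrArg Prod.fst h).symm)
        have h₂ : n' = 0 := Y.ι_injective (by rw [map_zero]; exact (congrArg Prod.snd h).symm)
        change m = _ at h'
        rw [h', h₁, h₂, add_zero]
      ker := fun r => by
        constructor
        · intro h
          obtain ⟨m, hm⟩ := (X.exact _).1 h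
          obtain ⟨m', hm'⟩ := (Y.exact _).1 ((hR r).trans h)
          exact ⟨m + m', m, m', by rw [hm, hm']; rfl, rfl⟩
        · rintro ⟨_, m, m', h, _⟩
          change r.1 = _ at h
          rw [hq, h]
          exact (X.exact _).2 ⟨m, rfl⟩ }
  exact ⟨G.pushout, G.toPushout, fun e => rfl, fun e m m' h => G.toPushout_eq ⟨m, m', h, rfl⟩⟩

end AbelianExtension

/-! ### Pushouts of crossed extensions -/

/-- The data for a pushout of a crossed extension of `A`: a surjection `q : R → A`, an `R`-bimodule
`J` with a homomorphism of bimodules `bd : J → R` onto the kernel of `q`, and a submodule of `J × M`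
that is the graph of a homomorphism from the kernel of `bd` to `M`. The crossed bimodule identity is
only required up to elements of the kernel that are mapped to zero in `M`. -/
structure CrossedGraph {K R A : Type u} [CommRing K] [Ring R] [Algebra K R] [Ring A] [Algebra K A]
    (q : R →ₐ[K] A) (J M : Type u) [AddCommGroup J] [Module K J] [AddCommGroup M] [Module K M]
    [Module A M] [Module Aᵐᵒᵖ M] extends BimoduleAction (K := K) R J where
  bd : J →ₗ[K] R
  bd_l : ∀ x j, bd (l x j) = x * bd j
  bd_r : ∀ x j, bd (r x j) = bd j * x
  W : Submodule K (J × M)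
  surjective : Function.Surjective q
  range : ∀ x, q x = 0 ↔ ∃ j, bd j = x
  W_left : ∀ x a, a ∈ W → (l x a.1, q x • a.2) ∈ W
  W_right : ∀ x a, a ∈ W → (r x a.1, op (q x) • a.2) ∈ W
  peiffer : ∀ j k, (l (bd j) k - r (bd k) j, 0) ∈ W
  injective : ∀ m, (0, m) ∈ W → m = 0
  ker : ∀ j, bd j = 0 ↔ ∃ m, (j, m) ∈ W

namespace CrossedGraph

variable {K R A : Type u} [CommRing K] [Ring R] [Algebra K R] [Ring A] [Algebra K A]
  {q : R →ₐ[K] A} {J M : Type u} [AddCommGroup J] [Module K J] [AddCommGroup M] [Module K M]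
  [Module A M] [Module Aᵐᵒᵖ M] [SMulCommClass A Aᵐᵒᵖ M] [IsScalarTower K A M]
  [IsScalarTower K Aᵐᵒᵖ M] (G : CrossedGraph q J M)

theorem map_bd (j : J) : q (G.bd j) = 0 := (G.range _).2 ⟨j, rfl⟩

/-- The submodule of `J × M` that identifies the elements of the kernel of `bd` with their
images. -/
def rel : Submodule K (J × M) :=
  G.W.comap (LinearMap.id.prodMap (-LinearMap.id) : J × M →ₗ[K] J × M)

theorem mem_rel {a : J × M} : a ∈ G.rel ↔ (a.1, -a.2) ∈ G.W := Iff.rfl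

/-- The pushout of `J` along the homomorphism from the kernel of `bd` to `M`. -/
def Top : Type u := (J × M) ⧸ G.rel

instance : AddCommGroup G.Top := inferInstanceAs (AddCommGroup ((J × M) ⧸ G.rel))
instance : Module K G.Top := inferInstanceAs (Module K ((J × M) ⧸ G.rel))

/-- The projection to the pushout. -/
def cl : J × M →ₗ[K] G.Top := G.rel.mkQ

theorem cl_surjective : Function.Surjective G.cl := G.rel.mkQ_surjective

theorem cl_eq_zero {a : J × M} : G.cl a = 0 ↔ (a.1, -a.2) ∈ G.W :=
  Submodule.Quotient.mk_eq_zero _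

/-- The left action of an element on the pushout. -/
def actLeft (x : R) : G.Top →ₗ[K] G.Top :=
  Submodule.mapQ G.rel G.rel ((G.l x).prodMap (leftAct q M x)) fun a ha => by
    have := G.W_left x _ (G.mem_rel.1 ha)
    rw [smul_neg] at this
    exact this

/-- The right action of an element on the pushout. -/
def actRight (x : R) : G.Top →ₗ[K] G.Top :=
  Submodule.mapQ G.rel G.rel ((G.r x).prodMap (rightAct q M x)) fun a ha => by
    have := G.W_right x _ (G.mem_rel.1 ha)
    rw [smul_neg] at this
    exact this

theorem actLeft_cl (x : R) (a : J × M) : G.actLeft x (G.cl a) = G.cl (G.l x a.1, q x • a.2) := rfl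

theorem actRight_cl (x : R) (a : J × M) :
    G.actRight x (G.cl a) = G.cl (G.r x a.1, op (q x) • a.2) := rfl

instance : Module R G.Top where
  smul x c := G.actLeft x c
  one_smul c := by
    obtain ⟨a, rfl⟩ := G.cl_surjective c
    change G.actLeft 1 (G.cl a) = _
    rw [actLeft_cl, G.l_one, map_one, one_smul]
  mul_smul x y c := by
    obtain ⟨a, rfl⟩ := G.cl_surjective c
    change G.actLeft (x * y) (G.cl a) = G.actLeft x (G.actLeft y (G.cl a))
    rw [actLeft_cl, actLeft_cl, actLeft_cl, G.l_mul, map_mul, mul_smul]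
  smul_zero x := map_zero (G.actLeft x)
  smul_add x := map_add (G.actLeft x)
  add_smul x y c := by
    obtain ⟨a, rfl⟩ := G.cl_surjective c
    change G.actLeft (x + y) (G.cl a) = G.actLeft x (G.cl a) + G.actLeft y (G.cl a)
    rw [actLeft_cl, actLeft_cl, actLeft_cl, ← map_add, map_add, map_add, add_smul]
    rfl
  zero_smul c := by
    obtain ⟨a, rfl⟩ := G.cl_surjective c
    change G.actLeft 0 (G.cl a) = 0
    rw [actLeft_cl, map_zero, map_zero, zero_smul]
    exact map_zero G.cl

instance : Module Rᵐᵒᵖ G.Top where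
  smul x c := G.actRight x.unop c
  one_smul c := by
    obtain ⟨a, rfl⟩ := G.cl_surjective c
    change G.actRight 1 (G.cl a) = _
    rw [actRight_cl, G.r_one, map_one, op_one, one_smul]
  mul_smul x y c := by
    obtain ⟨a, rfl⟩ := G.cl_surjective c
    change G.actRight (y.unop * x.unop) (G.cl a) = G.actRight x.unop (G.actRight y.unop (G.cl a))
    rw [actRight_cl, actRight_cl, actRight_cl, G.r_mul, map_mul, op_mul, mul_smul]
  smul_zero x := map_zero (G.actRight x.unop)
  smul_add x := map_add (G.actRight x.unop)
  add_smul x y c := by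
    obtain ⟨a, rfl⟩ := G.cl_surjective c
    change G.actRight (x.unop + y.unop) (G.cl a) =
      G.actRight x.unop (G.cl a) + G.actRight y.unop (G.cl a)
    rw [actRight_cl, actRight_cl, actRight_cl, ← map_add, map_add, map_add, op_add, add_smul]
    rfl
  zero_smul c := by
    obtain ⟨a, rfl⟩ := G.cl_surjective c
    change G.actRight 0 (G.cl a) = 0
    rw [actRight_cl, map_zero, map_zero, op_zero, zero_smul]
    exact map_zero G.cl

theorem smul_cl (x : R) (a : J × M) : x • G.cl a = G.cl (G.l x a.1, q x • a.2) := rfl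

theorem op_smul_cl (x : R) (a : J × M) : op x • G.cl a = G.cl (G.r x a.1, op (q x) • a.2) := rfl

instance : SMulCommClass R Rᵐᵒᵖ G.Top where
  smul_comm x y c := by
    obtain ⟨a, rfl⟩ := G.cl_surjective c
    rw [← op_unop y, op_smul_cl, smul_cl, smul_cl, op_smul_cl, G.l_r,
      smul_comm (q x) (op (q y.unop)) a.2]

instance : IsScalarTower K R G.Top where
  smul_assoc k x c := by
    obtain ⟨a, rfl⟩ := G.cl_surjective c
    rw [smul_cl, smul_cl, map_smul q, map_smul G.l, smul_assoc]
    exact G.cl.map_smul k (G.l x a.1, q x • a.2)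

instance : IsScalarTower K Rᵐᵒᵖ G.Top where
  smul_assoc k x c := by
    obtain ⟨a, rfl⟩ := G.cl_surjective c
    obtain ⟨x, rfl⟩ := op_surjective x
    rw [← op_smul, op_smul_cl, op_smul_cl, map_smul q, map_smul G.r, op_smul, smul_assoc]
    exact G.cl.map_smul k (G.r x a.1, op (q x) • a.2)

/-- The boundary of the pushout. -/
def topBd : G.Top →ₗ[K] R :=
  G.rel.liftQ (G.bd ∘ₗ LinearMap.fst K J M) fun a ha => (G.ker a.1).2 ⟨_, G.mem_rel.1 ha⟩

theorem topBd_cl (a : J × M) : G.topBd (G.cl a) = G.bd a.1 := rfl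

/-- The pushout as a crossed extension. -/
def pushout : CrossedExtension K A M where
  C₀ := R
  C₁ := G.Top
  bd := G.topBd
  bd_smul_left x c := by
    obtain ⟨a, rfl⟩ := G.cl_surjective c
    exact G.bd_l x a.1
  bd_smul_right x c := by
    obtain ⟨a, rfl⟩ := G.cl_surjective c
    exact G.bd_r x a.1
  bd_smul_bd c c' := by
    obtain ⟨a, rfl⟩ := G.cl_surjective c
    obtain ⟨b, rfl⟩ := G.cl_surjective c'
    rw [topBd_cl, topBd_cl, smul_cl, op_smul_cl, G.map_bd, G.map_bd, zero_smul, op_zero, zero_smul,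
      ← sub_eq_zero, ← map_sub, cl_eq_zero]
    simpa using G.peiffer a.1 b.1
  ι := G.cl ∘ₗ LinearMap.inr K J M
  π := q
  ι_injective := by
    refine (injective_iff_map_eq_zero _).2 fun m hm => ?_
    exact neg_eq_zero.1 (G.injective _ (G.cl_eq_zero.1 hm))
  exact₁ c := by
    obtain ⟨a, rfl⟩ := G.cl_surjective c
    rw [topBd_cl, G.ker]
    constructor
    · rintro ⟨m, hm⟩
      refine ⟨a.2 + m, sub_eq_zero.1 ?_⟩
      rw [LinearMap.comp_apply, ← map_sub, cl_eq_zero]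
      simpa using G.W.neg_mem hm
    · rintro ⟨m, hm⟩
      rw [← sub_eq_zero, LinearMap.comp_apply, ← map_sub, cl_eq_zero] at hm
      have := G.W.neg_mem hm
      exact ⟨m - a.2, by simpa using this⟩
  exact₀ x := by
    rw [G.range]
    constructor
    · rintro ⟨j, rfl⟩
      exact ⟨G.cl (j, 0), rfl⟩
    · rintro ⟨c, rfl⟩
      obtain ⟨a, rfl⟩ := G.cl_surjective c
      exact ⟨a.1, rfl⟩
  π_surjective := G.surjective
  smul_left x m := by
    change G.cl (0, q x • m) = G.cl (G.l x 0, q x • m)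
    rw [map_zero]
  smul_right x m := by
    change G.cl (0, op (q x) • m) = G.cl (G.r x 0, op (q x) • m)
    rw [map_zero]

/-- Morphisms out of the pushout. -/
theorem nonempty_homOver {B N : Type u} [Ring B] [Algebra K B] [AddCommGroup N] [Module K N]
    [Module B N] [Module Bᵐᵒᵖ N] {φ : A →ₐ[K] B} (f : BimoduleHom φ M N)
    (Y : CrossedExtension K B N) (v₀ : R →ₐ[K] Y.C₀) (v₁ : J →ₗ[K] Y.C₁)
    (hπ : ∀ x, Y.π (v₀ x) = φ (q x)) (hl : ∀ x j, v₁ (G.l x j) = v₀ x • v₁ j)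
    (hr : ∀ x j, v₁ (G.r x j) = op (v₀ x) • v₁ j) (hbd : ∀ j, Y.bd (v₁ j) = v₀ (G.bd j))
    (hv : ∀ j m, (j, m) ∈ G.W → v₁ j = Y.ι (f.toLinearMap m)) :
    Nonempty (CrossedExtension.HomOver f G.pushout Y) := by
  let F : G.Top →ₗ[K] Y.C₁ := G.rel.liftQ (v₁.coprod (Y.ι ∘ₗ f.toLinearMap)) fun a ha => by
    rw [LinearMap.mem_ker, LinearMap.coprod_apply, hv _ _ (G.mem_rel.1 ha)]
    simp
  have hF (a : J × M) : F (G.cl a) = v₁ a.1 + Y.ι (f.toLinearMap a.2) := rfl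
  refine ⟨⟨v₀, ⟨F, fun (x : R) c => ?_, fun (x : R) c => ?_⟩, fun c => ?_, fun m => ?_, hπ⟩⟩
  · obtain ⟨a, rfl⟩ := G.cl_surjective c
    change v₁ (G.l x a.1) + Y.ι (f.toLinearMap (q x • a.2)) = v₀ x • F (G.cl a)
    rw [hF, hl, f.map_smul_left, ← hπ, Y.smul_left, smul_add]
  · obtain ⟨a, rfl⟩ := G.cl_surjective c
    change v₁ (G.r x a.1) + Y.ι (f.toLinearMap (op (q x) • a.2)) = op (v₀ x) • F (G.cl a)
    rw [hF, hr, f.map_smul_right, ← hπ, Y.smul_right, smul_add]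
  · obtain ⟨a, rfl⟩ := G.cl_surjective c
    change Y.bd (F (G.cl a)) = v₀ (G.bd a.1)
    rw [hF, map_add, hbd, (Y.exact₁ _).2 ⟨_, rfl⟩, add_zero]
  · change F (G.cl (0, m)) = _
    rw [hF, map_zero, zero_add]

end CrossedGraph

/-! ### Crossed extensions and derivations -/

namespace ChainAlgebra

variable {K : Type u} [CommRing K] (X : ChainAlgebra K)

theorem proj_mul_of_mem_left {n : ℕ} {x : X.carrier} (hx : x ∈ X.deg 0) (y : X.carrier) :
    X.proj n (x * y) = x * X.proj n y := by
  induction y using X.homogeneous_induction with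
  | add y y' hy hy' => simp only [mul_add, map_add, hy, hy']
  | homogeneous m y hy =>
    have hxy : x * y ∈ X.deg m := by simpa using X.mul_mem hx hy
    by_cases h : m = n
    · rw [X.proj_of_mem (h ▸ hxy), X.proj_of_mem (h ▸ hy)]
    · rw [X.proj_of_mem_ne hxy h, X.proj_of_mem_ne hy h, mul_zero]

theorem proj_mul_of_mem_right {n : ℕ} {y : X.carrier} (hy : y ∈ X.deg 0) (x : X.carrier) :
    X.proj n (x * y) = X.proj n x * y := by
  induction x using X.homogeneous_induction with
  | add x x' hx hx' => simp only [add_mul, map_add, hx, hx']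
  | homogeneous m x hx =>
    have hxy : x * y ∈ X.deg m := X.mul_mem hx hy
    by_cases h : m = n
    · rw [X.proj_of_mem (h ▸ hxy), X.proj_of_mem (h ▸ hx)]
    · rw [X.proj_of_mem_ne hxy h, X.proj_of_mem_ne hx h, zero_mul]

theorem proj_one_mul (x y : X.carrier) :
    X.proj 1 (x * y) = X.projZero x * X.proj 1 y + X.proj 1 x * X.projZero y := by
  induction x using X.homogeneous_induction with
  | add x x' hx hx' => simp only [add_mul, map_add, hx, hx']; abel
  | homogeneous m x hx =>
    rcases m with _ | m
    · rw [X.proj_mul_of_mem_left hx, X.projZero_of_mem hx, X.proj_of_mem_ne hx zero_ne_one,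
        zero_mul, add_zero]
    · rw [X.projZero_of_pos hx, zero_mul, zero_add]
      induction y using X.homogeneous_induction with
      | add y y' hy hy' => simp only [mul_add, map_add, hy, hy']
      | homogeneous k y hy =>
        rcases k with _ | k
        · rw [X.proj_mul_of_mem_right hy, X.projZero_of_mem hy]
        · rw [X.projZero_of_pos hy, mul_zero, X.proj_of_mem_ne (X.mul_mem hx hy) (by omega)]

theorem projZero_d (x : X.carrier) : X.projZero (X.d x) = X.d (X.proj 1 x) := X.proj_d 0 x

/-- A linear map that is concentrated in degree one is odd. -/
theorem apply_sgn_of_vanish {C : Type u} [AddCommGroup C] [Module K C] {s : X.carrier →ₗ[K] C}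
    (hs : ∀ k, k ≠ 1 → ∀ x ∈ X.deg k, s x = 0) (x : X.carrier) : s (X.sgn x) = -s x := by
  induction x using X.homogeneous_induction with
  | add x x' hx hx' => simp only [map_add, hx, hx', neg_add]
  | homogeneous n x hx =>
    by_cases h : n = 1
    · subst h
      simp [X.sgn_of_mem hx]
    · rw [hs n h x hx, hs n h _ (X.sgn_mem hx), neg_zero]

/-- The subalgebra of elements of degree zero. -/
def zeroPart : Subalgebra K X.carrier where
  carrier := X.deg 0
  mul_mem' hx hy := X.mul_mem hx hy
  add_mem' hx hy := (X.deg 0).add_mem hx hy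
  algebraMap_mem' c := SetLike.algebraMap_mem_graded X.deg c

/-- The projection of a chain algebra to its part of degree zero. -/
def toZeroPart : X.carrier →ₐ[K] X.zeroPart := X.projZero.codRestrict _ X.projZero_mem

end ChainAlgebra

namespace CrossedExtension

open Hochschild

variable {K : Type u} [CommRing K] {A B : Type u} [Ring A] [Algebra K A] [Ring B] [Algebra K B]
  {M N : Type u} [AddCommGroup M] [Module K M] [Module A M] [Module Aᵐᵒᵖ M]
  [SMulCommClass A Aᵐᵒᵖ M] [IsScalarTower K A M] [IsScalarTower K Aᵐᵒᵖ M]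
  [AddCommGroup N] [Module K N] [Module B N] [Module Bᵐᵒᵖ N]
  [SMulCommClass B Bᵐᵒᵖ N] [IsScalarTower K B N] [IsScalarTower K Bᵐᵒᵖ N]

/-- The morphism `u₀`, `u₁`, `D` of complexes from a cofibrant replacement of `A` to the chain
algebra `M → C₁ → C₀` of a crossed extension, in the degrees zero, one and two. -/
structure Classifies (X : CrossedExtension K A M) (Q : CofibrantReplacement K A)
    (u₀ : Q.P.carrier →ₐ[K] X.C₀) (u₁ : Q.P.carrier →ₗ[K] X.C₁) (D : Q.P.carrier →ₗ[K] M) :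
    Prop where
  killsPos : Q.P.KillsPos u₀
  vanish : ∀ k, k ≠ 1 → ∀ x ∈ Q.P.deg k, u₁ x = 0
  map_mul : ∀ x y, u₁ (x * y) = u₀ x • u₁ y + op (u₀ y) • u₁ x
  π_map : ∀ x, X.π (u₀ x) = Q.aug x
  bd_map : ∀ x, X.bd (u₁ x) = u₀ (Q.P.d x)
  ι_map : ∀ x, X.ι (D x) = u₁ (Q.P.d x)

theorem Classifies.isDerCocycle {X : CrossedExtension K A M} {Q : CofibrantReplacement K A}
    {u₀ : Q.P.carrier →ₐ[K] X.C₀} {u₁ : Q.P.carrier →ₗ[K] X.C₁} {D : Q.P.carrier →ₗ[K] M}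
    (h : X.Classifies Q u₀ u₁ D) : IsDerCocycle Q.aug 2 D where
  vanish k hk x hx := by
    apply X.ι_injective
    rw [h.ι_map, map_zero]
    cases k with
    | zero => rw [Q.P.d_deg_zero x hx, map_zero]
    | succ k => exact h.vanish k (by omega) _ (Q.P.d_mem _ x hx)
  map_mul x y := by
    apply X.ι_injective
    -- The mixed terms cancel by the crossed bimodule identity.
    have hp := X.bd_smul_bd (u₁ x) (u₁ y)
    rw [h.bd_map, h.bd_map] at hp
    rw [h.ι_map, Q.P.d_mul, map_add, map_add, ← h.π_map, ← h.π_map, X.smul_left, X.smul_right,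
      h.ι_map, h.ι_map, h.map_mul, h.map_mul, h.killsPos.comp_sgn, Q.P.apply_sgn_of_vanish h.vanish,
      hp, smul_neg]
    abel
  map_d x := by
    apply X.ι_injective
    rw [h.ι_map, Q.P.d_d, map_zero, map_zero]

/-- Every crossed extension is classified by a derivation. -/
theorem exists_classifies (X : CrossedExtension K A M) (Q : CofibrantReplacement K A) :
    ∃ u₀ u₁ D, X.Classifies Q u₀ u₁ D := by
  obtain ⟨u₀, hu, hπ⟩ := Q.isCofibrant.exists_algHom_lift_killsPos X.π Q.aug
    Q.isAugmentation.killsPos fun x => X.π_surjective _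
  -- `u₁` is the part of degree one of a derivation that lifts `u₀ ∘ d`.
  let T : TwoCocycle (K := K) Q.P.carrier X.C₁ := TwoCocycle.ofAlgHom u₀ u₀
  obtain ⟨s, hs, hsd⟩ := Q.isCofibrant.exists_derivation_lift T X.bd (u₀.toLinearMap ∘ₗ Q.P.d)
    (fun x => (X.exact₀ _).1 (by simp [hπ, Q.isAugmentation.map_d]))
    (fun x y j k hj hk => by
      change X.bd (u₀ x • k + op (u₀ y) • j + 0) = u₀ (Q.P.d (x * y))
      simp only [LinearMap.comp_apply, AlgHom.toLinearMap_apply] at hj hk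
      rw [add_zero, map_add, X.bd_smul_left, X.bd_smul_right, hj, hk, Q.P.d_mul, map_add, map_mul,
        map_mul, hu.comp_sgn, add_comm])
  have hs₁ := ChainAlgebra.derivation_comp_proj T.l T.r T.c
    (fun n x hx => by ext j; simp [T, TwoCocycle.ofAlgHom, hu n x hx])
    (fun n x hx => by ext j; simp [T, TwoCocycle.ofAlgHom, hu n x hx]) 1
    (fun _ _ _ _ _ _ _ => rfl) s hs
  have hbd (x) : X.bd (s (Q.P.proj 1 x)) = u₀ (Q.P.d x) := by
    rw [hsd, LinearMap.comp_apply, ← Q.P.projZero_d]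
    exact hu.comp_projZero _
  obtain ⟨D, hD⟩ := LinearMap.exists_lift_of_injective X.ι_injective (s ∘ₗ Q.P.proj 1 ∘ₗ Q.P.d)
    fun x => (X.exact₁ _).1 (by
      rw [LinearMap.comp_apply, LinearMap.comp_apply, hbd, Q.P.d_d, map_zero])
  refine ⟨u₀, s ∘ₗ Q.P.proj 1, D, hu, fun k hk x hx => ?_, fun x y => ?_, hπ, hbd, hD⟩
  · rw [LinearMap.comp_apply, Q.P.proj_of_mem_ne hx hk, map_zero]
  · exact (hs₁ x y).trans (add_zero _)

/-- The crossed extension `X` represents the class `x`. -/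
def Represents (Q : CofibrantReplacement K A) (x : Shukla Q M 3) (X : CrossedExtension K A M) :
    Prop :=
  ∃ (u₀ : Q.P.carrier →ₐ[K] X.C₀) (u₁ : Q.P.carrier →ₗ[K] X.C₁) (D : Q.P.carrier →ₗ[K] M)
    (h : X.Classifies Q u₀ u₁ D), h.isDerCocycle.cls = x

theorem exists_represents (Q : CofibrantReplacement K A) (X : CrossedExtension K A M) :
    ∃ x, Represents Q x X := by
  obtain ⟨u₀, u₁, D, h⟩ := X.exists_classifies Q
  exact ⟨_, u₀, u₁, D, h, rfl⟩

/-- A morphism of crossed extensions over `φ` and `f` identifies the push-forward along `f` of the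
first class with the pull-back along `φ` of the second one: the two composites with values in the
second extension are homotopic in degree zero, and the difference in degree one of the composites
and the homotopy is a derivation with values in `N`. -/
theorem Represents.corresponds {Q : CofibrantReplacement K A} {Q' : CofibrantReplacement K B}
    {φ : A →ₐ[K] B} (g : Q.Lift Q' φ) {f : BimoduleHom φ M N} {X : CrossedExtension K A M}
    {Y : CrossedExtension K B N} {x : Shukla Q M 3} {y : Shukla Q' N 3} (hx : Represents Q x X)
    (hy : Represents Q' y Y) (H : HomOver f X Y) : Shukla.Corresponds g f 3 x y := by
  obtain ⟨u₀, u₁, D, h, rfl⟩ := hx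
  obtain ⟨v₀, v₁, D', h', rfl⟩ := hy
  let α₀ : Q.P.carrier →ₐ[K] Y.C₀ := H.hom₀.comp u₀
  let β₀ : Q.P.carrier →ₐ[K] Y.C₀ := v₀.comp g.1.toAlgHom
  let α₁ : Q.P.carrier →ₗ[K] Y.C₁ := H.hom₁.toLinearMap ∘ₗ u₁
  let β₁ : Q.P.carrier →ₗ[K] Y.C₁ := v₁ ∘ₗ g.1.toAlgHom.toLinearMap
  have hα (x) : Y.π (α₀ x) = φ (Q.aug x) := by simp [α₀, H.map_π, h.π_map]
  have hβ (x) : Y.π (β₀ x) = φ (Q.aug x) := by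
    have := DFunLike.congr_fun g.2 x
    simpa [β₀, h'.π_map] using this
  have hα₁ (x) : Y.bd (α₁ x) = α₀ (Q.P.d x) := by simp [α₁, α₀, H.map_bd, h.bd_map]
  have hβ₁ (x) : Y.bd (β₁ x) = β₀ (Q.P.d x) := by simp [β₁, β₀, h'.bd_map, g.1.map_d]
  have hα₂ (x y) : α₁ (x * y) = α₀ x • α₁ y + op (α₀ y) • α₁ x := by
    simp [α₁, α₀, h.map_mul, H.hom₁.map_smul_left, H.hom₁.map_smul_right]
  have hβ₂ (x y) : β₁ (x * y) = β₀ x • β₁ y + op (β₀ y) • β₁ x := by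
    simp [β₁, β₀, h'.map_mul]
  have kα : Q.P.KillsPos α₀ := fun n x hx => by simp [α₀, h.killsPos n x hx]
  have kβ : Q.P.KillsPos β₀ := fun n x hx => by
    simp [β₀, h'.killsPos n _ (g.1.map_deg _ x hx)]
  -- The homotopy in degree zero is a derivation from `α₀` to `β₀`.
  let T : TwoCocycle (K := K) Q.P.carrier Y.C₁ := TwoCocycle.ofAlgHom α₀ β₀
  obtain ⟨s, hs, hsd⟩ := Q.isCofibrant.exists_derivation_lift T Y.bd
    (α₀.toLinearMap - β₀.toLinearMap)
    (fun x => (Y.exact₀ _).1 (by simp [hα, hβ]))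
    (fun x y j k hj hk => by
      change Y.bd (α₀ x • k + op (β₀ y) • j + 0) = α₀ (x * y) - β₀ (x * y)
      simp only [LinearMap.sub_apply, AlgHom.toLinearMap_apply] at hj hk
      rw [add_zero, map_add, Y.bd_smul_left, Y.bd_smul_right, hj, hk, map_mul, map_mul, mul_sub,
        sub_mul]
      abel)
  let s₀ : Q.P.carrier →ₗ[K] Y.C₁ := s ∘ₗ Q.P.proj 0
  have hs₀ (x y) : s₀ (x * y) = α₀ x • s₀ y + op (β₀ y) • s₀ x :=
    (ChainAlgebra.derivation_comp_proj T.l T.r T.c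
      (fun n x hx => by ext j; simp [T, TwoCocycle.ofAlgHom, kα n x hx])
      (fun n x hx => by ext j; simp [T, TwoCocycle.ofAlgHom, kβ n x hx]) 0
      (fun _ _ _ _ _ _ _ => rfl) s hs x y).trans (add_zero _)
  have hbd (x) : Y.bd (s₀ x) = α₀ x - β₀ x := by
    refine (hsd _).trans ?_
    change α₀ (Q.P.projZero x) - β₀ (Q.P.projZero x) = _
    rw [kα.comp_projZero, kβ.comp_projZero]
  have ks : Q.P.KillsPos s₀ := fun n x hx => by
    change s (Q.P.proj 0 x) = 0
    rw [Q.P.proj_of_mem_ne hx n.succ_ne_zero, map_zero]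
  obtain ⟨t, ht⟩ := LinearMap.exists_lift_of_injective Y.ι_injective (α₁ - β₁ - s₀ ∘ₗ Q.P.d)
    fun x => (Y.exact₁ _).1 (by simp [hα₁, hβ₁, hbd])
  simp only [LinearMap.sub_apply, LinearMap.comp_apply] at ht
  have htd : IsDerivation (φ.comp Q.aug) 1 t := by
    refine ⟨fun k hk x hx => Y.ι_injective ?_, fun x y => Y.ι_injective ?_⟩
    · rw [ht, map_zero]
      have h₁ : α₁ x = 0 := by simp [α₁, h.vanish k hk x hx]
      have h₂ : β₁ x = 0 := by simp [β₁, h'.vanish k hk _ (g.1.map_deg _ x hx)]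
      have h₃ : s₀ (Q.P.d x) = 0 := by
        rcases k with _ | _ | k
        · rw [Q.P.d_deg_zero x hx, map_zero]
        · exact absurd rfl hk
        · exact ks k _ (Q.P.d_mem _ x hx)
      rw [h₁, h₂, h₃, sub_zero, sub_zero]
    · -- The left action of `φ (aug x)` is computed by `α₀ x` and the right one by `β₀ y`; the
      -- error terms cancel by the crossed bimodule identity.
      have p₁ := Y.bd_smul_bd (α₁ x) (s₀ y)
      have p₂ := Y.bd_smul_bd (s₀ x) (β₁ y)
      rw [hα₁, hbd, op_sub, sub_smul] at p₁
      rw [hβ₁, hbd, sub_smul] at p₂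
      rw [map_add, AlgHom.comp_apply, AlgHom.comp_apply, ← hα, ← hβ, Y.smul_left, Y.smul_right, ht,
        ht, ht, hα₂, hβ₂, Q.P.d_mul, map_add, hs₀, hs₀, kα.comp_sgn, ks.comp_sgn, p₁, ← p₂]
      simp only [smul_sub]
      abel
  have hp := push_cls f h.isDerCocycle
  have hq := pull_cls g.1 g.2 h'.isDerCocycle
  refine hp.trans (Eq.trans ?_ hq.symm)
  refine IsDerCocycle.cls_eq _ _ htd fun x => Y.ι_injective ?_
  rw [map_sub, ht, Q.P.d_d, map_zero, sub_zero]
  simp only [LinearMap.comp_apply, AlgHom.toLinearMap_apply, ← H.map_ι, h.ι_map, h'.ι_map, α₁, β₁,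
    g.1.map_d]

section Canonical

variable (Q : CofibrantReplacement K A) {D : Q.P.carrier →ₗ[K] M} (hD : IsDerCocycle Q.aug 2 D)

/-- The homomorphism to `M` from the kernel of `P₁ → P₀` that maps a boundary `d x` to `D x`. To
avoid a type for the part of degree one, it is replaced by the whole of `P`, on which the boundary
map and the homomorphism to `M` only depend on the component of degree one. -/
def derivationGraph : CrossedGraph (Q.aug.comp Q.P.zeroPart.val) Q.P.carrier M where
  l := LinearMap.mul K Q.P.carrier ∘ₗ Q.P.zeroPart.val.toLinearMap
  r := (LinearMap.mul K Q.P.carrier).flip ∘ₗ Q.P.zeroPart.val.toLinearMap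
  l_one j := one_mul j
  r_one j := mul_one j
  l_mul x y j := mul_assoc x.1 y.1 j
  r_mul x y j := (mul_assoc j x.1 y.1).symm
  l_r x y j := (mul_assoc x.1 j y.1).symm
  bd := Q.P.toZeroPart.toLinearMap ∘ₗ Q.P.d
  bd_l x j := by
    apply Subtype.ext
    change Q.P.projZero (Q.P.d (x.1 * j)) = x.1 * Q.P.projZero (Q.P.d j)
    rw [Q.P.d_mul, Q.P.d_deg_zero _ x.2, zero_mul, zero_add, map_mul, Q.P.sgn_of_mem x.2]
    simp [Q.P.projZero_of_mem x.2]
  bd_r x j := by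
    apply Subtype.ext
    change Q.P.projZero (Q.P.d (j * x.1)) = Q.P.projZero (Q.P.d j) * x.1
    rw [Q.P.d_mul, Q.P.d_deg_zero _ x.2, mul_zero, add_zero, map_mul, Q.P.projZero_of_mem x.2]
  W :=
    { carrier := {a | ∃ x, Q.P.proj 1 a.1 = Q.P.proj 1 (Q.P.d x) ∧ a.2 = D x}
      add_mem' := by
        rintro a b ⟨x, hx, hx'⟩ ⟨y, hy, hy'⟩
        exact ⟨x + y, by simp [hx, hy], by simp [hx', hy']⟩
      zero_mem' := ⟨0, by simp, by simp⟩
      smul_mem' := by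
        rintro c a ⟨x, hx, hx'⟩
        exact ⟨c • x, by simp [hx], by simp [hx']⟩ }
  surjective a := by
    obtain ⟨x, rfl⟩ := Q.aug_surjective a
    exact ⟨Q.P.toZeroPart x, Q.isAugmentation.killsPos.comp_projZero x⟩
  range x := by
    constructor
    · intro h
      obtain ⟨y, -, hy⟩ := Q.exists_d_eq_of_aug_eq_zero x.2 h
      exact ⟨y, Subtype.ext ((congrArg Q.P.projZero hy).trans (Q.P.projZero_of_mem x.2))⟩
    · rintro ⟨j, rfl⟩
      exact (Q.isAugmentation.killsPos.comp_projZero _).trans (Q.isAugmentation.map_d j)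
  W_left := by
    rintro s a ⟨x, hx, hx'⟩
    refine ⟨s.1 * x, ?_, ?_⟩
    · change Q.P.proj 1 (s.1 * a.1) = _
      rw [Q.P.d_mul, Q.P.d_deg_zero _ s.2, zero_mul, zero_add, Q.P.proj_mul_of_mem_left s.2, hx,
        Q.P.sgn_of_mem s.2, pow_zero, one_smul, Q.P.proj_mul_of_mem_left s.2]
    · rw [hD.map_mul, hD.vanish 0 (by simp) _ s.2, smul_zero, add_zero, hx']
      rfl
  W_right := by
    rintro s a ⟨x, hx, hx'⟩
    refine ⟨x * s.1, ?_, ?_⟩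
    · change Q.P.proj 1 (a.1 * s.1) = _
      rw [Q.P.d_mul, Q.P.d_deg_zero _ s.2, mul_zero, add_zero, Q.P.proj_mul_of_mem_right s.2, hx,
        Q.P.proj_mul_of_mem_right s.2]
    · rw [hD.map_mul, hD.vanish 0 (by simp) _ s.2, smul_zero, zero_add, hx']
      rfl
  peiffer j k := by
    -- The Leibniz rule for the product of the parts of degree one.
    refine ⟨Q.P.proj 1 j * Q.P.proj 1 k, ?_, ?_⟩
    · have hj := Q.P.d_mem 0 _ (Q.P.proj_mem 1 j)
      have hk := Q.P.d_mem 0 _ (Q.P.proj_mem 1 k)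
      change Q.P.proj 1 (Q.P.projZero (Q.P.d j) * k - j * Q.P.projZero (Q.P.d k)) = _
      rw [Q.P.d_mul, Q.P.projZero_d, Q.P.projZero_d, map_sub, map_add,
        Q.P.proj_mul_of_mem_left hj, Q.P.proj_mul_of_mem_left hj,
        Q.P.proj_mul_of_mem_right hk, Q.P.proj_mul_of_mem_right hk,
        Q.P.sgn_of_mem (Q.P.proj_mem 1 j), Q.P.proj_of_mem (Q.P.proj_mem 1 k), map_smul,
        Q.P.proj_of_mem (Q.P.proj_mem 1 j), pow_one, neg_one_smul, neg_mul, sub_eq_add_neg]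
    · rw [hD.map_mul, hD.vanish 1 (by simp) _ (Q.P.proj_mem 1 j),
        hD.vanish 1 (by simp) _ (Q.P.proj_mem 1 k), smul_zero, smul_zero, add_zero]
  injective := by
    rintro m ⟨x, hx, hx'⟩
    have hx₁ : Q.P.d (Q.P.proj 2 x) = 0 := by
      rw [← Q.P.proj_d]
      exact hx.symm.trans (map_zero _)
    obtain ⟨y, -, hy⟩ := Q.exists_d_eq (Q.P.proj_mem 2 x) hx₁
    change m = D x at hx'
    rw [hx', ← Q.P.apply_proj hD.vanish, ← hy, hD.map_d]
  ker j := by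
    have hj : (Q.P.toZeroPart.toLinearMap ∘ₗ Q.P.d) j = 0 ↔ Q.P.d (Q.P.proj 1 j) = 0 := by
      rw [← Q.P.projZero_d]
      exact Subtype.ext_iff
    rw [hj]
    constructor
    · intro h
      obtain ⟨x, hx, hx'⟩ := Q.exists_d_eq (Q.P.proj_mem 1 j) h
      exact ⟨D x, x, by rw [hx', Q.P.proj_of_mem (Q.P.proj_mem 1 j)], rfl⟩
    · rintro ⟨m, x, hx, -⟩
      change Q.P.proj 1 j = _ at hx
      rw [hx, ← Q.P.proj_d, Q.P.d_d, map_zero]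

theorem classifies_pushout :
    (derivationGraph Q hD).pushout.Classifies Q Q.P.toZeroPart
      ((derivationGraph Q hD).cl ∘ₗ LinearMap.inl K _ _ ∘ₗ Q.P.proj 1) D where
  killsPos n x hx := Subtype.ext (Q.P.projZero_of_pos hx)
  vanish k hk x hx := by
    change (derivationGraph Q hD).cl (Q.P.proj 1 x, 0) = 0
    rw [Q.P.proj_of_mem_ne hx hk]
    exact map_zero (derivationGraph Q hD).cl
  map_mul x y := by
    change (derivationGraph Q hD).cl (Q.P.proj 1 (x * y), 0) =
      (derivationGraph Q hD).cl (Q.P.projZero x * Q.P.proj 1 y, Q.aug (Q.P.projZero x) • (0 : M)) +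
      (derivationGraph Q hD).cl
        (Q.P.proj 1 x * Q.P.projZero y, op (Q.aug (Q.P.projZero y)) • (0 : M))
    rw [smul_zero, smul_zero, ← map_add, Q.P.proj_one_mul, Prod.mk_add_mk, add_zero]
  π_map x := Q.isAugmentation.killsPos.comp_projZero x
  bd_map x := by
    apply Subtype.ext
    change Q.P.projZero (Q.P.d (Q.P.proj 1 x)) = Q.P.projZero (Q.P.d x)
    rw [← Q.P.projZero_d, Q.P.projZero_of_mem (Q.P.projZero_mem _)]
  ι_map x := by
    change (derivationGraph Q hD).cl (0, D x) =
      (derivationGraph Q hD).cl (Q.P.proj 1 (Q.P.d x), 0)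
    rw [eq_comm, ← sub_eq_zero, ← map_sub, CrossedGraph.cl_eq_zero]
    refine ⟨x, ?_, ?_⟩
    · simp [Q.P.proj_of_mem (Q.P.proj_mem 1 _)]
    · simp

end Canonical

/-- The pushout along a derivation maps to every crossed extension whose class corresponds to the
one of the derivation. -/
theorem Represents.nonempty_homOver {Q : CofibrantReplacement K A} {Q' : CofibrantReplacement K B}
    {φ : A →ₐ[K] B} (g : Q.Lift Q' φ) {f : BimoduleHom φ M N} {D : Q.P.carrier →ₗ[K] M}
    (hD : IsDerCocycle Q.aug 2 D) {Y : CrossedExtension K B N} {y : Shukla Q' N 3}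
    (hy : Represents Q' y Y) (H : Shukla.Corresponds g f 3 hD.cls y) :
    Nonempty (HomOver f (derivationGraph Q hD).pushout Y) := by
  obtain ⟨v₀, v₁, D', h', rfl⟩ := hy
  have hp := push_cls f hD
  have hq := pull_cls g.1 g.2 h'.isDerCocycle
  have hρ : IsAugmentation (φ.comp Q.aug) :=
    ⟨fun n x hx => by simp [Q.isAugmentation.killsPos n x hx],
      fun x => by simp [Q.isAugmentation.map_d]⟩
  obtain ⟨t, ht, htd⟩ := IsDerCocycle.exists_of_cls_eq_three Q.isCofibrant hρ _ _
    (hp.symm.trans (Eq.trans H hq))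
  let β₀ : Q.P.carrier →ₐ[K] Y.C₀ := v₀.comp g.1.toAlgHom
  let β₁ : Q.P.carrier →ₗ[K] Y.C₁ := v₁ ∘ₗ g.1.toAlgHom.toLinearMap
  have hβ (x) : Y.π (β₀ x) = φ (Q.aug x) := by
    have := DFunLike.congr_fun g.2 x
    simpa [β₀, h'.π_map] using this
  have hβ' (x) : (φ.comp Q.aug) x = Y.π (β₀ x) := (hβ x).symm
  have hβ₁ (x) : Y.bd (β₁ x) = β₀ (Q.P.d x) := by simp [β₁, β₀, h'.bd_map, g.1.map_d]
  have hβ₂ (x y) : β₁ (x * y) = β₀ x • β₁ y + op (β₀ y) • β₁ x := by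
    simp [β₁, β₀, h'.map_mul]
  have kβ : Q.P.KillsPos β₀ := fun n x hx => by
    simp [β₀, h'.killsPos n _ (g.1.map_deg _ x hx)]
  have vβ (k) (hk : k ≠ 1) (x) (hx : x ∈ Q.P.deg k) : β₁ x = 0 :=
    h'.vanish k hk _ (g.1.map_deg _ x hx)
  -- The component in degree one is corrected by the derivation `t` to map `d x` to `f (D x)`.
  let w : Q.P.carrier →ₗ[K] Y.C₁ := β₁ + Y.ι ∘ₗ t
  have hw (x) : w x = β₁ x + Y.ι (t x) := rfl
  have vw (k) (hk : k ≠ 1) (x) (hx : x ∈ Q.P.deg k) : w x = 0 := by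
    rw [hw, vβ k hk x hx, ht.vanish k hk x hx, map_zero, add_zero]
  refine (derivationGraph Q hD).nonempty_homOver f Y (β₀.comp Q.P.zeroPart.val) w (fun x => hβ x)
    (fun x j => ?_) (fun x j => ?_) (fun j => ?_) ?_
  · change w (x.1 * j) = β₀ x.1 • w j
    rw [hw, hw, hβ₂, ht.map_mul, vβ 0 zero_ne_one _ x.2, ht.vanish 0 zero_ne_one _ x.2, smul_zero,
      smul_zero, add_zero, add_zero, smul_add, hβ', Y.smul_left]
  · change w (j * x.1) = op (β₀ x.1) • w j
    rw [hw, hw, hβ₂, ht.map_mul, vβ 0 zero_ne_one _ x.2, ht.vanish 0 zero_ne_one _ x.2, smul_zero,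
      smul_zero, zero_add, zero_add, smul_add, hβ', Y.smul_right]
  · change Y.bd (w j) = β₀ (Q.P.projZero (Q.P.d j))
    rw [kβ.comp_projZero, hw, map_add, hβ₁, (Y.exact₁ _).2 ⟨_, rfl⟩, add_zero]
  · rintro j m ⟨x, hx, hx'⟩
    change Q.P.proj 1 j = _ at hx
    change m = D x at hx'
    rw [← Q.P.apply_proj vw, hx, Q.P.apply_proj vw, hw, ← htd, hx']
    simp [β₁, g.1.map_d, ← h'.ι_map]

/-- Every class is represented by a pushout that maps to all crossed extensions with corresponding
classes. -/
theorem exists_universal (Q : CofibrantReplacement K A) (x : Shukla Q M 3) :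
    ∃ X, Represents Q x X ∧ ∀ (B : Type u) [Ring B] [Algebra K B] (N : Type u) [AddCommGroup N]
      [Module K N] [Module B N] [Module Bᵐᵒᵖ N] [SMulCommClass B Bᵐᵒᵖ N] [IsScalarTower K B N]
      [IsScalarTower K Bᵐᵒᵖ N] (φ : A →ₐ[K] B) (Q' : CofibrantReplacement K B) (g : Q.Lift Q' φ)
      (f : BimoduleHom φ M N) (Y : CrossedExtension K B N) (y : Shukla Q' N 3),
      Represents Q' y Y → Shukla.Corresponds g f 3 x y → Nonempty (HomOver f X Y) := by
  obtain ⟨D, hD, rfl⟩ := exists_cls_eq_three Q.isCofibrant Q.isAugmentation x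
  exact ⟨_, ⟨_, _, D, classifies_pushout Q hD, rfl⟩,
    fun _ _ _ _ _ _ _ _ _ _ _ _ _ g _ _ _ hy H => hy.nonempty_homOver g hD H⟩

/-- The class of a Baer sum is the sum of the classes. -/
theorem IsBaerSum.represents {Q : CofibrantReplacement K A} {X Y Z : CrossedExtension K A M}
    (h : IsBaerSum X Y Z) {x y : Shukla Q M 3} (hx : Represents Q x X) (hy : Represents Q y Y) :
    Represents Q (x + y) Z := by
  obtain ⟨u₀, u₁, D, hu, rfl⟩ := hx
  obtain ⟨v₀, v₁, D', hv, rfl⟩ := hy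
  obtain ⟨h₀, h₁, hl, hr, hbd, hπ, hι⟩ := h
  let w : Q.P.carrier →ₐ[K] AlgHom.equalizer (X.π.comp (AlgHom.fst K X.C₀ Y.C₀))
      (Y.π.comp (AlgHom.snd K X.C₀ Y.C₀)) :=
    (u₀.prod v₀).codRestrict _ fun x => by
      change X.π (u₀ x) = Y.π (v₀ x)
      rw [hu.π_map, hv.π_map]
  have hw₁ (x) : (w x).1.1 = u₀ x := rfl
  have hw₂ (x) : (w x).1.2 = v₀ x := rfl
  have hw : Z.Classifies Q (h₀.comp w) (h₁ ∘ₗ u₁.prod v₁) (D + D') := by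
    refine ⟨fun n x hx => ?_, fun k hk x hx => ?_, fun x y => ?_, fun x => ?_, fun x => ?_,
      fun x => ?_⟩
    · have : w x = 0 := by
        apply Subtype.ext
        change (u₀ x, v₀ x) = 0
        rw [hu.killsPos n x hx, hv.killsPos n x hx]
        rfl
      rw [AlgHom.comp_apply, this, map_zero]
    · change h₁ (u₁ x, v₁ x) = 0
      rw [hu.vanish k hk x hx, hv.vanish k hk x hx]
      exact map_zero h₁
    · change h₁ (u₁ (x * y), v₁ (x * y)) =
        h₀ (w x) • h₁ (u₁ y, v₁ y) + op (h₀ (w y)) • h₁ (u₁ x, v₁ x)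
      rw [← hl, ← hr, ← map_add, hu.map_mul, hv.map_mul]
      rfl
    · rw [AlgHom.comp_apply, hπ]
      exact hu.π_map x
    · refine hbd (w (Q.P.d x)) (u₁ x) (v₁ x) ?_
      rw [hu.bd_map, hv.bd_map]
      rfl
    · change Z.ι (D x + D' x) = h₁ (u₁ (Q.P.d x), v₁ (Q.P.d x))
      rw [← hι, hu.ι_map, hv.ι_map]
  exact ⟨_, _, _, hw, IsDerCocycle.cls_add _ _⟩

/-- Baer sums exist: they are pushouts of the fibre product along the addition `M × M → M`. -/
theorem exists_isBaerSum (X Y : CrossedExtension K A M) : ∃ Z, IsBaerSum X Y Z := by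
  let R := AlgHom.equalizer (X.π.comp (AlgHom.fst K X.C₀ Y.C₀)) (Y.π.comp (AlgHom.snd K X.C₀ Y.C₀))
  have hR (r : R) : Y.π r.1.2 = X.π r.1.1 := r.2.symm
  let q : R →ₐ[K] A := (X.π.comp (AlgHom.fst K X.C₀ Y.C₀)).comp R.val
  have hq (r : R) : q r = X.π r.1.1 := rfl
  let G : CrossedGraph q (X.C₁ × Y.C₁) M :=
    { l := LinearMap.mk₂ K (fun r j => (r.1.1 • j.1, r.1.2 • j.2))
        (fun r r' j => Prod.ext (add_smul _ _ _) (add_smul _ _ _))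
        (fun c r j => Prod.ext (smul_assoc _ _ _) (smul_assoc _ _ _))
        (fun r j j' => Prod.ext (smul_add _ _ _) (smul_add _ _ _))
        (fun c r j => Prod.ext (smul_comm _ _ _) (smul_comm _ _ _))
      r := LinearMap.mk₂ K (fun r j => (op r.1.1 • j.1, op r.1.2 • j.2))
        (fun r r' j => Prod.ext (add_smul (op _) (op _) _) (add_smul (op _) (op _) _))
        (fun c r j => Prod.ext (smul_assoc c (op _) _) (smul_assoc c (op _) _))
        (fun r j j' => Prod.ext (smul_add _ _ _) (smul_add _ _ _))
        (fun c r j => Prod.ext (smul_comm _ _ _) (smul_comm _ _ _))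
      l_one := fun j => Prod.ext (one_smul _ _) (one_smul _ _)
      r_one := fun j => Prod.ext (one_smul _ _) (one_smul _ _)
      l_mul := fun x y j => Prod.ext (mul_smul _ _ _) (mul_smul _ _ _)
      r_mul := fun x y j => Prod.ext (mul_smul (op y.1.1) (op x.1.1) _)
        (mul_smul (op y.1.2) (op x.1.2) _)
      l_r := fun x y j => Prod.ext (smul_comm _ _ _) (smul_comm _ _ _)
      bd := LinearMap.codRestrict (Subalgebra.toSubmodule R) (X.bd.prodMap Y.bd) fun j =>
        ((X.exact₀ _).2 ⟨j.1, rfl⟩).trans ((Y.exact₀ _).2 ⟨j.2, rfl⟩).symm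
      bd_l := fun x j => Subtype.ext (Prod.ext (X.bd_smul_left _ _) (Y.bd_smul_left _ _))
      bd_r := fun x j => Subtype.ext (Prod.ext (X.bd_smul_right _ _) (Y.bd_smul_right _ _))
      W :=
        { carrier := {a | ∃ m m', a.1 = (X.ι m, Y.ι m') ∧ a.2 = m + m'}
          add_mem' := by
            rintro a b ⟨m, m', h, h'⟩ ⟨n, n', k, k'⟩
            refine ⟨m + n, m' + n', ?_, ?_⟩
            · rw [map_add, map_add, ← Prod.mk_add_mk, ← h, ← k]; rfl
            · rw [Prod.snd_add, h', k']; abel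
          zero_mem' := ⟨0, 0, by rw [map_zero, map_zero]; rfl, by simp⟩
          smul_mem' := by
            rintro c a ⟨m, m', h, h'⟩
            refine ⟨c • m, c • m', ?_, by rw [Prod.smul_snd, h', smul_add]⟩
            rw [map_smul, map_smul, ← Prod.smul_mk, ← h]; rfl }
      surjective := fun a => by
        obtain ⟨e, rfl⟩ := X.π_surjective a
        obtain ⟨e', he'⟩ := Y.π_surjective (X.π e)
        exact ⟨⟨(e, e'), he'.symm⟩, rfl⟩
      range := fun r => by
        constructor
        · intro h
          obtain ⟨c, hc⟩ := (X.exact₀ _).1 h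
          obtain ⟨c', hc'⟩ := (Y.exact₀ _).1 ((hR r).trans h)
          exact ⟨(c, c'), Subtype.ext (Prod.ext hc hc')⟩
        · rintro ⟨j, rfl⟩
          exact (X.exact₀ _).2 ⟨j.1, rfl⟩
      W_left := by
        rintro s a ⟨m, m', h, h'⟩
        refine ⟨q s • m, q s • m', ?_, by rw [h', smul_add]⟩
        change (s.1.1 • a.1.1, s.1.2 • a.1.2) = _
        rw [h, hq, X.smul_left, ← hR, Y.smul_left]
      W_right := by
        rintro s a ⟨m, m', h, h'⟩
        refine ⟨op (q s) • m, op (q s) • m', ?_, by rw [h', smul_add]⟩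
        change (op s.1.1 • a.1.1, op s.1.2 • a.1.2) = _
        rw [h, hq, X.smul_right, ← hR, Y.smul_right]
      peiffer := fun j k => by
        refine ⟨0, 0, ?_, (add_zero 0).symm⟩
        refine Prod.ext ?_ ?_
        · change X.bd j.1 • k.1 - op (X.bd k.1) • j.1 = X.ι 0
          rw [X.bd_smul_bd, sub_self, map_zero]
        · change Y.bd j.2 • k.2 - op (Y.bd k.2) • j.2 = Y.ι 0
          rw [Y.bd_smul_bd, sub_self, map_zero]
      injective := by
        rintro m ⟨n, n', h, h'⟩
        have h₁ : n = 0 := X.ι_injective (by rw [map_zero]; exact (congrArg Prod.fst h).symm)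
        have h₂ : n' = 0 := Y.ι_injective (by rw [map_zero]; exact (congrArg Prod.snd h).symm)
        change m = _ at h'
        rw [h', h₁, h₂, add_zero]
      ker := fun j => by
        constructor
        · intro h
          have h := congrArg Subtype.val h
          obtain ⟨m, hm⟩ := (X.exact₁ _).1 (congrArg Prod.fst h)
          obtain ⟨m', hm'⟩ := (Y.exact₁ _).1 (congrArg Prod.snd h)
          exact ⟨m + m', m, m', by rw [hm, hm']; rfl, rfl⟩
        · rintro ⟨_, m, m', h, _⟩
          change j = _ at h
          rw [h]
          exact Subtype.ext (Prod.ext ((X.exact₁ _).2 ⟨m, rfl⟩) ((Y.exact₁ _).2 ⟨m', rfl⟩)) }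
  refine ⟨G.pushout, AlgHom.id K R, G.cl ∘ₗ LinearMap.inl K _ _, fun a c c' => ?_,
    fun a c c' => ?_, fun a c c' h => ?_, fun a => rfl, fun m m' => ?_⟩
  · change G.cl ((a.1.1 • c, a.1.2 • c'), 0) = G.cl ((a.1.1 • c, a.1.2 • c'), q a • (0 : M))
    rw [smul_zero]
  · change G.cl ((op a.1.1 • c, op a.1.2 • c'), 0) =
      G.cl ((op a.1.1 • c, op a.1.2 • c'), op (q a) • (0 : M))
    rw [smul_zero]
  · exact Subtype.ext h.symm
  · change G.cl ((X.ι m, Y.ι m'), 0) = G.cl (0, m + m')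
    rw [← sub_eq_zero, ← map_sub, CrossedGraph.cl_eq_zero]
    exact ⟨m, m', sub_zero _, by simp⟩

end CrossedExtension

/-! ### The isomorphisms -/

section Isomorphisms

variable {K : Type u} [CommRing K] {A : Type u} [Ring A] [Algebra K A] {M : Type u}
  [AddCommGroup M] [Module K M] [Module A M] [Module Aᵐᵒᵖ M] [SMulCommClass A Aᵐᵒᵖ M]
  [IsScalarTower K A M] [IsScalarTower K Aᵐᵒᵖ M]

theorem AbelianExtension.nonempty_hom_refl (X : AbelianExtension K A M) : Nonempty (X.Hom X) :=
  ⟨AlgHom.id K X.E, fun _ => rfl, fun _ => rfl⟩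

theorem CrossedExtension.nonempty_hom_refl (X : CrossedExtension K A M) : Nonempty (X.Hom X) :=
  ⟨AlgHom.id K X.C₀, BimoduleHom.id K X.C₀ X.C₁, fun _ => rfl, fun _ => rfl, fun _ => rfl⟩

theorem Extalg.exists_equiv (Q : CofibrantReplacement K A) :
    ∃ Θ : Shukla Q M 2 ≃ Extalg K A M,
      ∀ x X, Θ x = Extalg.mk X ↔ AbelianExtension.Represents Q x X := by
  refine exists_equiv_quot _ (AbelianExtension.Represents Q)
    (AbelianExtension.exists_represents Q) (fun x => ?_) (fun x y X Y hx hy => ?_)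
    AbelianExtension.nonempty_hom_refl fun x X Y hX hY => ?_
  · obtain ⟨X, hX, -⟩ := AbelianExtension.exists_universal Q x
    exact ⟨X, hX⟩
  · rintro ⟨H⟩
    exact Shukla.corresponds_id_iff.1 (hx.corresponds Q.idLift hy H)
  · obtain ⟨U, -, hU⟩ := AbelianExtension.exists_universal Q x
    have h (Y : AbelianExtension K A M) (hY : AbelianExtension.Represents Q x Y) :
        Nonempty (U.Hom Y) :=
      hU A M (AlgHom.id K A) Q Q.idLift _ Y x hY (Shukla.corresponds_id_iff.2 rfl)
    exact (Quot.sound (h X hX)).symm.trans (Quot.sound (h Y hY))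

theorem Cros.exists_equiv (Q : CofibrantReplacement K A) :
    ∃ Θ : Shukla Q M 3 ≃ Cros K A M,
      ∀ x X, Θ x = Cros.mk X ↔ CrossedExtension.Represents Q x X := by
  refine exists_equiv_quot _ (CrossedExtension.Represents Q)
    (CrossedExtension.exists_represents Q) (fun x => ?_) (fun x y X Y hx hy => ?_)
    CrossedExtension.nonempty_hom_refl fun x X Y hX hY => ?_
  · obtain ⟨X, hX, -⟩ := CrossedExtension.exists_universal Q x
    exact ⟨X, hX⟩
  · rintro ⟨H⟩
    exact Shukla.corresponds_id_iff.1 (hx.corresponds Q.idLift hy H)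
  · obtain ⟨U, -, hU⟩ := CrossedExtension.exists_universal Q x
    have h (Y : CrossedExtension K A M) (hY : CrossedExtension.Represents Q x Y) :
        Nonempty (U.Hom Y) :=
      hU A M (AlgHom.id K A) Q Q.idLift _ Y x hY (Shukla.corresponds_id_iff.2 rfl)
    exact (Quot.sound (h X hX)).symm.trans (Quot.sound (h Y hY))

/-- The bijection that maps a class to the component of the extensions that represent it. -/
def Extalg.equiv (A : Type u) [Ring A] [Algebra K A] (M : Type u) [AddCommGroup M] [Module K M]
    [Module A M] [Module Aᵐᵒᵖ M] [SMulCommClass A Aᵐᵒᵖ M] [IsScalarTower K A M]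
    [IsScalarTower K Aᵐᵒᵖ M] (Q : CofibrantReplacement K A) : Shukla Q M 2 ≃ Extalg K A M :=
  (Extalg.exists_equiv Q).choose

/-- The bijection that maps a class to the component of the crossed extensions that represent
it. -/
def Cros.equiv (A : Type u) [Ring A] [Algebra K A] (M : Type u) [AddCommGroup M] [Module K M]
    [Module A M] [Module Aᵐᵒᵖ M] [SMulCommClass A Aᵐᵒᵖ M] [IsScalarTower K A M]
    [IsScalarTower K Aᵐᵒᵖ M] (Q : CofibrantReplacement K A) : Shukla Q M 3 ≃ Cros K A M :=
  (Cros.exists_equiv Q).choose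

variable {Q : CofibrantReplacement K A}

theorem Extalg.mk_eq_equiv_iff {x : Shukla Q M 2} {X : AbelianExtension K A M} :
    Extalg.mk X = Extalg.equiv A M Q x ↔ AbelianExtension.Represents Q x X :=
  eq_comm.trans ((Extalg.exists_equiv Q).choose_spec x X)

theorem Cros.mk_eq_equiv_iff {x : Shukla Q M 3} {X : CrossedExtension K A M} :
    Cros.mk X = Cros.equiv A M Q x ↔ CrossedExtension.Represents Q x X :=
  eq_comm.trans ((Cros.exists_equiv Q).choose_spec x X)

section Naturality

variable {B : Type u} [Ring B] [Algebra K B] {N : Type u} [AddCommGroup N] [Module K N]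
  [Module B N] [Module Bᵐᵒᵖ N] [SMulCommClass B Bᵐᵒᵖ N] [IsScalarTower K B N]
  [IsScalarTower K Bᵐᵒᵖ N] {Q' : CofibrantReplacement K B} {φ : A →ₐ[K] B} (g : Q.Lift Q' φ)
  (f : BimoduleHom φ M N)

theorem Extalg.corresponds_equiv_iff (x : Shukla Q M 2) (y : Shukla Q' N 2) :
    Shukla.Corresponds g f 2 x y ↔
      Extalg.Corresponds f (Extalg.equiv A M Q x) (Extalg.equiv B N Q' y) := by
  constructor
  · intro h
    obtain ⟨X, hX, hU⟩ := AbelianExtension.exists_universal Q x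
    obtain ⟨Y, hY, -⟩ := AbelianExtension.exists_universal Q' y
    exact ⟨X, Y, mk_eq_equiv_iff.2 hX, mk_eq_equiv_iff.2 hY, hU B N φ Q' g f Y y hY h⟩
  · rintro ⟨X, Y, hX, hY, ⟨H⟩⟩
    exact (mk_eq_equiv_iff.1 hX).corresponds g (mk_eq_equiv_iff.1 hY) H

theorem Cros.corresponds_equiv_iff (x : Shukla Q M 3) (y : Shukla Q' N 3) :
    Shukla.Corresponds g f 3 x y ↔
      Cros.Corresponds f (Cros.equiv A M Q x) (Cros.equiv B N Q' y) := by
  constructor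
  · intro h
    obtain ⟨X, hX, hU⟩ := CrossedExtension.exists_universal Q x
    obtain ⟨Y, hY, -⟩ := CrossedExtension.exists_universal Q' y
    exact ⟨X, Y, mk_eq_equiv_iff.2 hX, mk_eq_equiv_iff.2 hY, hU B N φ Q' g f Y y hY h⟩
  · rintro ⟨X, Y, hX, hY, ⟨H⟩⟩
    exact (mk_eq_equiv_iff.1 hX).corresponds g (mk_eq_equiv_iff.1 hY) H

end Naturality

theorem Extalg.isBaerSum_equiv_iff (x y z : Shukla Q M 2) :
    Extalg.IsBaerSum (Extalg.equiv A M Q x) (Extalg.equiv A M Q y) (Extalg.equiv A M Q z) ↔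
      z = x + y := by
  constructor
  · rintro ⟨X, Y, Z, hX, hY, hZ, h⟩
    have := mk_eq_equiv_iff.2 (h.represents (mk_eq_equiv_iff.1 hX) (mk_eq_equiv_iff.1 hY))
    exact (Extalg.equiv A M Q).injective (hZ.symm.trans this)
  · rintro rfl
    obtain ⟨X, hX, -⟩ := AbelianExtension.exists_universal Q x
    obtain ⟨Y, hY, -⟩ := AbelianExtension.exists_universal Q y
    obtain ⟨Z, hZ⟩ := AbelianExtension.exists_isBaerSum X Y
    exact ⟨X, Y, Z, mk_eq_equiv_iff.2 hX, mk_eq_equiv_iff.2 hY,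
      mk_eq_equiv_iff.2 (hZ.represents hX hY), hZ⟩

theorem Cros.isBaerSum_equiv_iff (x y z : Shukla Q M 3) :
    Cros.IsBaerSum (Cros.equiv A M Q x) (Cros.equiv A M Q y) (Cros.equiv A M Q z) ↔
      z = x + y := by
  constructor
  · rintro ⟨X, Y, Z, hX, hY, hZ, h⟩
    have := mk_eq_equiv_iff.2 (h.represents (mk_eq_equiv_iff.1 hX) (mk_eq_equiv_iff.1 hY))
    exact (Cros.equiv A M Q).injective (hZ.symm.trans this)
  · rintro rfl
    obtain ⟨X, hX, -⟩ := CrossedExtension.exists_universal Q x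
    obtain ⟨Y, hY, -⟩ := CrossedExtension.exists_universal Q y
    obtain ⟨Z, hZ⟩ := CrossedExtension.exists_isBaerSum X Y
    exact ⟨X, Y, Z, mk_eq_equiv_iff.2 hX, mk_eq_equiv_iff.2 hY,
      mk_eq_equiv_iff.2 (hZ.represents hX hY), hZ⟩

end Isomorphisms

theorem mainTheorem3 (K : Type u) [CommRing K] :
    -- Cofibrant replacements exist, and so do their morphisms over homomorphisms of algebras.
    (∀ (A : Type u) [Ring A] [Algebra K A], Nonempty (CofibrantReplacement K A)) ∧
    (∀ (A B : Type u) [Ring A] [Algebra K A] [Ring B] [Algebra K B] (φ : A →ₐ[K] B)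
      (Q : CofibrantReplacement K A) (Q' : CofibrantReplacement K B), Nonempty (Q.Lift Q' φ)) ∧
    -- The isomorphisms `Shukla²(A, M) ≅ Extalg(A, M)`, for every choice of the replacement.
    (∃ Θ : ∀ (A : Type u) [Ring A] [Algebra K A] (M : Type u) [AddCommGroup M] [Module K M]
        [Module A M] [Module Aᵐᵒᵖ M] [SMulCommClass A Aᵐᵒᵖ M] [IsScalarTower K A M]
        [IsScalarTower K Aᵐᵒᵖ M] (Q : CofibrantReplacement K A), Shukla Q M 2 ≃ Extalg K A M,
      -- They are natural in the algebra, in the bimodule and in the replacement,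
      (∀ (A B : Type u) [Ring A] [Algebra K A] [Ring B] [Algebra K B] (φ : A →ₐ[K] B)
        (M N : Type u)
        [AddCommGroup M] [Module K M] [Module A M] [Module Aᵐᵒᵖ M] [SMulCommClass A Aᵐᵒᵖ M]
        [IsScalarTower K A M] [IsScalarTower K Aᵐᵒᵖ M]
        [AddCommGroup N] [Module K N] [Module B N] [Module Bᵐᵒᵖ N] [SMulCommClass B Bᵐᵒᵖ N]
        [IsScalarTower K B N] [IsScalarTower K Bᵐᵒᵖ N]
        (f : BimoduleHom φ M N) (Q : CofibrantReplacement K A) (Q' : CofibrantReplacement K B)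
        (g : Q.Lift Q' φ) (x : Shukla Q M 2) (y : Shukla Q' N 2),
        Shukla.Corresponds g f 2 x y ↔ Extalg.Corresponds f (Θ A M Q x) (Θ B N Q' y)) ∧
      -- and linear for the Baer sum and the action of the scalars on the extensions.
      (∀ (A : Type u) [Ring A] [Algebra K A] (M : Type u) [AddCommGroup M] [Module K M]
        [Module A M] [Module Aᵐᵒᵖ M] [SMulCommClass A Aᵐᵒᵖ M] [IsScalarTower K A M]
        [IsScalarTower K Aᵐᵒᵖ M] (Q : CofibrantReplacement K A),
        (∀ x y z, Extalg.IsBaerSum (Θ A M Q x) (Θ A M Q y) (Θ A M Q z) ↔ z = x + y) ∧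
        ∀ (c : K) (x z),
          Extalg.Corresponds (BimoduleHom.scalar A M c) (Θ A M Q x) (Θ A M Q z) ↔ z = c • x)) ∧
    -- The isomorphisms `Shukla³(A, M) ≅ Cros(A, M)`, with the same properties.
    (∃ Θ : ∀ (A : Type u) [Ring A] [Algebra K A] (M : Type u) [AddCommGroup M] [Module K M]
        [Module A M] [Module Aᵐᵒᵖ M] [SMulCommClass A Aᵐᵒᵖ M] [IsScalarTower K A M]
        [IsScalarTower K Aᵐᵒᵖ M] (Q : CofibrantReplacement K A), Shukla Q M 3 ≃ Cros K A M,
      (∀ (A B : Type u) [Ring A] [Algebra K A] [Ring B] [Algebra K B] (φ : A →ₐ[K] B)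
        (M N : Type u)
        [AddCommGroup M] [Module K M] [Module A M] [Module Aᵐᵒᵖ M] [SMulCommClass A Aᵐᵒᵖ M]
        [IsScalarTower K A M] [IsScalarTower K Aᵐᵒᵖ M]
        [AddCommGroup N] [Module K N] [Module B N] [Module Bᵐᵒᵖ N] [SMulCommClass B Bᵐᵒᵖ N]
        [IsScalarTower K B N] [IsScalarTower K Bᵐᵒᵖ N]
        (f : BimoduleHom φ M N) (Q : CofibrantReplacement K A) (Q' : CofibrantReplacement K B)
        (g : Q.Lift Q' φ) (x : Shukla Q M 3) (y : Shukla Q' N 3),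
        Shukla.Corresponds g f 3 x y ↔ Cros.Corresponds f (Θ A M Q x) (Θ B N Q' y)) ∧
      (∀ (A : Type u) [Ring A] [Algebra K A] (M : Type u) [AddCommGroup M] [Module K M]
        [Module A M] [Module Aᵐᵒᵖ M] [SMulCommClass A Aᵐᵒᵖ M] [IsScalarTower K A M]
        [IsScalarTower K Aᵐᵒᵖ M] (Q : CofibrantReplacement K A),
        (∀ x y z, Cros.IsBaerSum (Θ A M Q x) (Θ A M Q y) (Θ A M Q z) ↔ z = x + y) ∧
        ∀ (c : K) (x z),
          Cros.Corresponds (BimoduleHom.scalar A M c) (Θ A M Q x) (Θ A M Q z) ↔ z = c • x)) := by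
  refine ⟨fun A _ _ => CofibrantReplacement.nonempty K A,
    fun A B _ _ _ _ φ Q Q' => CofibrantReplacement.nonempty_lift φ Q Q',
    ⟨Extalg.equiv, ?_,
      fun A _ _ M _ _ _ _ _ _ _ Q => ⟨Extalg.isBaerSum_equiv_iff, fun c x z => ?_⟩⟩,
    ⟨Cros.equiv, ?_, fun A _ _ M _ _ _ _ _ _ _ Q => ⟨Cros.isBaerSum_equiv_iff, fun c x z => ?_⟩⟩⟩
  · intros
    exact Extalg.corresponds_equiv_iff _ _ _ _
  · exact (Extalg.corresponds_equiv_iff Q.idLift _ x z).symm.trans (Shukla.corresponds_scalar_iff c)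
  · intros
    exact Cros.corresponds_equiv_iff _ _ _ _
  · exact (Cros.corresponds_equiv_iff Q.idLift _ x z).symm.trans (Shukla.corresponds_scalar_iff c)
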